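/- **Proposition (a full exceptional collection of equivariant line bundles on $\mathbb{P}^2$ minus its torus-fixed points).** Let $\mathbf k$ be a field and let $U=\mathbb A^3\setminus\bigcup_{i\ne j}\{z_i=z_j=0\}$ be the open subset of affine $3$-space over $\mathbf k$ where at most one coordinate vanishes, with the natural action of the torus $\mathbf G_m^3$. For $p\in\mathbb Z^3$ let $\mathcal O(p)$ be the $\mathbf G_m^3$-equivariant line bundle on $U$ obtained by restricting the sheaf that corresponds to the $\mathbb Z^3$-graded module $S(p)$ over $S=\mathbf k[z_1,z_2,z_3]$, where $z_i$ has degree equal to the $i$-th standard basis vector and $S(p)_q=S_{p+q}$. (The category of $\mathbf G_m^3$-equivariant coherent sheaves on $U$ is equivalent to that of torus-equivariant coherent sheaves on $\mathbb P^2$ minus its three torus-fixed points.) Consider the set of points $p\in\mathbb Z^3$ $$\{(0,0,m): m\ge 0\}\prec\{(a,-a,0): a\neq 0\}\prec\{(a,1-a,0): a\ne 1\}\prec\{(1,0,-m): m\ge 0\},$$ where $m$ and $a$ are integers, with any total order $\prec$ in which these four blocks follow each other as indicated, the points $(0,0,m)$ are ordered by increasing $m$, and the points $(1,0,-m)$ are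 ordered by decreasing $m$; the order among the points $(a,-a,0)$ and the order among the points $(a,1-a,0)$ are arbitrary. Then the line bundles $\mathcal O(p)$, for $p$ in this ordered set, form a full exceptional collection in the bounded derived category $\mathbf D^b(\operatorname{coh}[U/\mathbf G_m^3])$ of $\mathbf G_m^3$-equivariant coherent sheaves on $U$. That is: 1. for every $p$ in the set, $\operatorname{Hom}(\mathcal O(p),\mathcal O(p))=\mathbf k\cdot\mathrm{id}\cong\mathbf k$ and $\operatorname{Hom}(\mathcal O(p),\mathcal O(p)[s])=0$ for all integers $s\ne 0$; 2. $\operatorname{Hom}(\mathcal O(p_2),\mathcal O(p_1)[s])=0$ for all $p_1\prec p_2$ and all $s\in\mathbb Z$; 3. the smallest strictly full triangulated subcategory of $\mathbf D^b(\operatorname{coh}[U/\mathbf G_m^3])$ that contains all these $\mathcal O(p)$ is $\mathbf D^b(\operatorname{coh}[U/\mathbf G_m^3])$ itself. -/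

import Mathlib

open CategoryTheory CategoryTheory.Limits

universe w u

noncomputable section

/-- Polynomial functions on affine `n`-space over `k`. -/
abbrev PolyRing (k : Type u) [Field k] (n : ℕ) : Type u := MvPolynomial (Fin n) k

/-- The `ℤⁿ`-grading of the polynomial ring: the variable `z i` has degree `ε i`. -/
def polyDegree (k : Type u) [Field k] (n : ℕ) (q : Fin n → ℤ) :
    Submodule k (PolyRing k n) :=
  MvPolynomial.weightedHomogeneousSubmodule k (fun i : Fin n => (Pi.single i 1 : Fin n → ℤ)) q

/-- A `ℤⁿ`-graded module over `k[z₁, …, zₙ]`, i.e. a quasi-coherent sheaf on affine `n`-space that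
is equivariant for the torus `𝔾ₘⁿ` (an action of a diagonalizable group on a module is a grading by
its character group). The module is the direct sum of its homogeneous pieces `M_q`. -/
structure GrMod (k : Type u) [Field k] (n : ℕ) where
  carrier : Type u
  [addCommGroup : AddCommGroup carrier]
  [module : Module (PolyRing k n) carrier]
  piece : (Fin n → ℤ) → AddSubgroup carrier
  isInternal : DirectSum.IsInternal piece
  smul_mem : ∀ (p q : Fin n → ℤ) (a : PolyRing k n) (m : carrier),
    a ∈ polyDegree k n p → m ∈ piece q → a • m ∈ piece (p + q)

namespace GrMod

variable {k : Type u} [Field k] {n : ℕ}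

instance : CoeSort (GrMod k n) (Type u) := ⟨GrMod.carrier⟩

instance (M : GrMod k n) : AddCommGroup M := M.addCommGroup

instance (M : GrMod k n) : Module (PolyRing k n) M := M.module

/-- Morphisms of graded modules: linear maps that preserve degrees. -/
@[ext]
structure Hom (M N : GrMod k n) where
  lin : M →ₗ[PolyRing k n] N
  map_mem : ∀ (q : Fin n → ℤ) (m : M), m ∈ M.piece q → lin m ∈ N.piece q

instance : Category (GrMod k n) where
  Hom M N := Hom M N
  id M := ⟨LinearMap.id, fun _ _ h => h⟩
  comp f g := ⟨g.lin ∘ₗ f.lin, fun q m h => g.map_mem q _ (f.map_mem q m h)⟩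

@[simp] lemma id_lin (M : GrMod k n) : Hom.lin (𝟙 M) = LinearMap.id := rfl

@[simp] lemma comp_lin {M N P : GrMod k n} (f : M ⟶ N) (g : N ⟶ P) :
    Hom.lin (f ≫ g) = g.lin ∘ₗ f.lin := rfl

@[ext]
lemma hom_ext {M N : GrMod k n} (f g : M ⟶ N) (h : f.lin = g.lin) : f = g := Hom.ext h

lemma hom_ext' {M N : GrMod k n} {f g : M ⟶ N} (h : ∀ x, f.lin x = g.lin x) : f = g :=
  Hom.ext (LinearMap.ext h)

lemma C_mem (c : k) : (MvPolynomial.C c : PolyRing k n) ∈ polyDegree k n 0 :=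
  MvPolynomial.isWeightedHomogeneous_C _ c

section Preadditive

variable (M N : GrMod k n)

instance : Zero (M ⟶ N) := ⟨⟨0, fun q _ _ => (N.piece q).zero_mem⟩⟩
instance : Add (M ⟶ N) :=
  ⟨fun f g => ⟨f.lin + g.lin, fun q m h => (N.piece q).add_mem (f.map_mem q m h) (g.map_mem q m h)⟩⟩
instance : Neg (M ⟶ N) := ⟨fun f => ⟨-f.lin, fun q m h => (N.piece q).neg_mem (f.map_mem q m h)⟩⟩
instance : Sub (M ⟶ N) :=
  ⟨fun f g => ⟨f.lin - g.lin, fun q m h => (N.piece q).sub_mem (f.map_mem q m h) (g.map_mem q m h)⟩⟩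
instance : SMul ℕ (M ⟶ N) :=
  ⟨fun c f => ⟨c • f.lin, fun q m h => (N.piece q).nsmul_mem (f.map_mem q m h) c⟩⟩
instance : SMul ℤ (M ⟶ N) :=
  ⟨fun c f => ⟨c • f.lin, fun q m h => (N.piece q).zsmul_mem (f.map_mem q m h) c⟩⟩

instance : AddCommGroup (M ⟶ N) :=
  Function.Injective.addCommGroup (fun f : M ⟶ N => f.lin) (fun _ _ h => Hom.ext h)
    rfl (fun _ _ => rfl) (fun _ => rfl) (fun _ _ => rfl) (fun _ _ => rfl) (fun _ _ => rfl)

/-- A scalar `c ∈ k` acts through the constant polynomial `c`. -/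
instance : SMul k (M ⟶ N) :=
  ⟨fun c f => ⟨(MvPolynomial.C c : PolyRing k n) • f.lin, fun q m h => by
    simpa using N.smul_mem 0 q _ _ (C_mem c) (f.map_mem q m h)⟩⟩

variable {M N}

@[simp] lemma zero_lin : Hom.lin (0 : M ⟶ N) = 0 := rfl
@[simp] lemma add_lin (f g : M ⟶ N) : Hom.lin (f + g) = f.lin + g.lin := rfl
@[simp] lemma smul_lin (c : k) (f : M ⟶ N) :
    Hom.lin (c • f) = (MvPolynomial.C c : PolyRing k n) • f.lin := rfl

end Preadditive

instance : Preadditive (GrMod k n) where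
  add_comp P Q R f f' g := by ext x; simp
  comp_add P Q R f g g' := by ext x; simp

instance (M N : GrMod k n) : Module k (M ⟶ N) where
  one_smul f := by ext x; simp
  mul_smul a b f := by ext x; simp [mul_smul]
  smul_zero a := by ext x; simp
  smul_add a f g := by ext x; simp
  add_smul a b f := by ext x; simp [add_smul]
  zero_smul f := by ext x; simp

instance : Linear k (GrMod k n) where
  smul_comp X Y Z r f g := by ext x; simp
  comp_smul X Y Z f r g := by ext x; simp

section Internal

open DirectSum

/-- A family of subgroups with an additive decomposition map is internal. -/
lemma isInternal_of_decomp {X : Type u} [AddCommGroup X] (P : (Fin n → ℤ) → AddSubgroup X)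
    (D : X →+ ⨁ q, P q) (h₁ : ∀ x, DirectSum.coeAddMonoidHom P (D x) = x)
    (h₂ : ∀ q (x : P q), D x = DirectSum.of (fun q => P q) q x) : DirectSum.IsInternal P := by
  refine ⟨?_, fun x => ⟨D x, h₁ x⟩⟩
  have : D.comp (DirectSum.coeAddMonoidHom P) = AddMonoidHom.id _ := by
    ext q x : 2
    simp [h₂]
  exact Function.LeftInverse.injective (g := D) (fun d => DFunLike.congr_fun this d)

/-- The decomposition of an element into homogeneous components. -/
def decomp (M : GrMod k n) : M ≃+ ⨁ q, M.piece q :=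
  (AddEquiv.ofBijective (DirectSum.coeAddMonoidHom M.piece) M.isInternal).symm

lemma coe_decomp (M : GrMod k n) (x : M) :
    DirectSum.coeAddMonoidHom M.piece (M.decomp x) = x :=
  (AddEquiv.ofBijective (DirectSum.coeAddMonoidHom M.piece) M.isInternal).apply_symm_apply x

lemma decomp_coe (M : GrMod k n) (q : Fin n → ℤ) (x : M.piece q) :
    M.decomp x = DirectSum.of (fun q => M.piece q) q x := by
  rw [decomp, AddEquiv.symm_apply_eq]
  exact (DirectSum.coeAddMonoidHom_of M.piece q x).symm

/-- A degree-preserving map induces maps on the homogeneous pieces. -/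
def Hom.pieceMap {M N : GrMod k n} (f : M ⟶ N) (q : Fin n → ℤ) : M.piece q →+ N.piece q where
  toFun x := ⟨f.lin x, f.map_mem q x x.2⟩
  map_zero' := by ext; simp
  map_add' x y := by ext; simp

lemma decomp_map {M N : GrMod k n} (f : M ⟶ N) (x : M) :
    N.decomp (f.lin x) = DirectSum.map (fun q => Hom.pieceMap f q) (M.decomp x) := by
  have : (N.decomp.toAddMonoidHom.comp f.lin.toAddMonoidHom).comp
      (DirectSum.coeAddMonoidHom M.piece) = DirectSum.map (fun q => Hom.pieceMap f q) := by
    ext q x : 2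
    simp only [AddMonoidHom.comp_apply, DirectSum.coeAddMonoidHom_of, DirectSum.map_of]
    exact decomp_coe N q ⟨f.lin x, f.map_mem q x x.2⟩
  rw [← this]
  simp [coe_decomp]

lemma decomp_map_apply {M N : GrMod k n} (f : M ⟶ N) (x : M) (q : Fin n → ℤ) :
    (N.decomp (f.lin x) q : N) = f.lin (M.decomp x q) := by
  rw [decomp_map]; rfl

lemma sum_decomp (M : GrMod k n) (x : M) [∀ q (y : M.piece q), Decidable (y ≠ 0)] :
    ∑ q ∈ DFinsupp.support (M.decomp x), ((M.decomp x q : M.piece q) : M) = x := by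
  classical
  conv_rhs => rw [← coe_decomp M x]
  rw [DirectSum.coeAddMonoidHom_eq_dfinsuppSum]
  unfold DFinsupp.sum
  congr!

end Internal

section Kernel

variable {M N : GrMod k n} (f : M ⟶ N)

/-- The kernel of a morphism of graded modules. -/
def ker : GrMod k n where
  carrier := LinearMap.ker f.lin
  piece q := (M.piece q).comap (LinearMap.ker f.lin).subtype.toAddMonoidHom
  isInternal := by
    classical
    have hk : ∀ (x : LinearMap.ker f.lin) q, ((M.decomp x q : M.piece q) : M) ∈ LinearMap.ker f.lin := by
      intro x q
      rw [LinearMap.mem_ker, ← decomp_map_apply, LinearMap.mem_ker.1 x.2]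
      simp
    constructor
    · intro a b hab
      have h1 := congrArg (fun z : LinearMap.ker f.lin => (z : M)) hab
      let P := fun q => (M.piece q).comap (LinearMap.ker f.lin).subtype.toAddMonoidHom
      let j : ∀ q, P q →+ M.piece q := fun q =>
        { toFun := fun x => ⟨x.1.1, x.2⟩, map_zero' := rfl, map_add' := fun _ _ => rfl }
      have key : (DirectSum.coeAddMonoidHom M.piece).comp (DirectSum.map j) =
          (LinearMap.ker f.lin).subtype.toAddMonoidHom.comp (DirectSum.coeAddMonoidHom P) := by
        ext q x
        simp [j]
      have hj : Function.Injective (DirectSum.map j) :=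
        (DirectSum.map_injective j).2 (fun q x y h => by
          have := congrArg (fun z : M.piece q => (z : M)) h
          exact Subtype.ext (Subtype.ext this))
      apply hj
      apply M.isInternal.1
      have h2 := DFunLike.congr_fun key a
      have h3 := DFunLike.congr_fun key b
      exact h2.trans (h1.trans h3.symm)
    · intro x
      refine ⟨∑ q ∈ DFinsupp.support (M.decomp x.1),
        DirectSum.of (fun q => (M.piece q).comap (LinearMap.ker f.lin).subtype.toAddMonoidHom) q
          ⟨⟨M.decomp x.1 q, hk x q⟩, (M.decomp x.1 q).2⟩, ?_⟩
      rw [map_sum]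
      apply Subtype.ext
      simp only [DirectSum.coeAddMonoidHom_of, AddSubmonoidClass.coe_finsetSum]
      exact sum_decomp M x.1
  smul_mem p q a m ha hm := M.smul_mem p q a m ha hm

/-- The inclusion of the kernel. -/
def kerι : ker f ⟶ M := ⟨(LinearMap.ker f.lin).subtype, fun _ _ h => h⟩

lemma kerι_comp : kerι f ≫ f = 0 := hom_ext' fun x => x.2

/-- The kernel has the universal property. -/
def kerIsLimit : IsLimit (KernelFork.ofι (kerι f) (kerι_comp f)) :=
  KernelFork.IsLimit.ofι _ _
    (fun g hg => ⟨g.lin.codRestrict _ (fun x => LinearMap.congr_fun (congrArg Hom.lin hg) x),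
      fun q m h => g.map_mem q m h⟩)
    (fun _ _ => hom_ext' fun _ => rfl)
    (fun _ _ _ hm => hom_ext' fun x =>
      Subtype.ext (LinearMap.congr_fun (congrArg Hom.lin hm) x))

/-- The cokernel of a morphism of graded modules. -/
def coker : GrMod k n where
  carrier := N ⧸ LinearMap.range f.lin
  piece q := (N.piece q).map (LinearMap.range f.lin).mkQ.toAddMonoidHom
  isInternal := by
    let R := LinearMap.range f.lin
    let P := fun q => (N.piece q).map (LinearMap.range f.lin).mkQ.toAddMonoidHom
    let j : ∀ q, N.piece q →+ P q := fun q =>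
        { toFun := fun x => ⟨R.mkQ x.1, x.1, x.2, rfl⟩,
          map_zero' := Subtype.ext (map_zero _), map_add' := fun _ _ => Subtype.ext (map_add _ _ _) }
    let D₀ : N →+ DirectSum _ (fun q => P q) := (DirectSum.map j).comp N.decomp.toAddMonoidHom
    have hD₀ : ∀ q (x : N.piece q), D₀ x = DirectSum.of (fun q => P q) q (j q x) := by
      intro q x
      change DirectSum.map j (N.decomp x) = _
      rw [decomp_coe, DirectSum.map_of]
    have hker : ∀ x ∈ R, D₀ x = 0 := by
      rintro _ ⟨m, rfl⟩
      change DirectSum.map j (N.decomp (f.lin m)) = 0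
      rw [decomp_map]
      ext q
      change R.mkQ (f.lin _) = 0
      rw [Submodule.mkQ_apply, Submodule.Quotient.mk_eq_zero]
      exact ⟨_, rfl⟩
    let D : (N ⧸ R) →+ DirectSum _ (fun q => P q) :=
      QuotientAddGroup.lift R.toAddSubgroup D₀ hker
    have hD : ∀ x, D (R.mkQ x) = D₀ x := fun x => rfl
    refine isInternal_of_decomp P D ?_ ?_
    · intro x
      obtain ⟨x, rfl⟩ := R.mkQ_surjective x
      rw [hD]
      have key : (DirectSum.coeAddMonoidHom P).comp (DirectSum.map j) =
          R.mkQ.toAddMonoidHom.comp (DirectSum.coeAddMonoidHom N.piece) := by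
        ext q x
        simp [j]
      have := DFunLike.congr_fun key (N.decomp x)
      refine this.trans ?_
      simp [coe_decomp]
    · rintro q ⟨_, x, hx, rfl⟩
      exact hD₀ q ⟨x, hx⟩
  smul_mem := by
    rintro p q a _ ha ⟨m, hm, rfl⟩
    exact ⟨a • m, N.smul_mem p q a m ha hm, by simp⟩

/-- The projection to the cokernel. -/
def cokerπ : N ⟶ coker f :=
  ⟨(LinearMap.range f.lin).mkQ, fun _ m h => ⟨m, h, rfl⟩⟩

lemma comp_cokerπ : f ≫ cokerπ f = 0 := hom_ext' fun x =>
  (Submodule.Quotient.mk_eq_zero _).2 ⟨x, rfl⟩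

/-- The cokernel has the universal property. -/
def cokerIsColimit : IsColimit (CokernelCofork.ofπ (cokerπ f) (comp_cokerπ f)) :=
  CokernelCofork.IsColimit.ofπ _ _
    (fun g hg => ⟨(LinearMap.range f.lin).liftQ g.lin (by
        rintro _ ⟨x, rfl⟩
        exact LinearMap.congr_fun (congrArg Hom.lin hg) x), by
        rintro q _ ⟨m, hm, rfl⟩
        exact g.map_mem q m hm⟩)
    (fun _ _ => hom_ext' fun _ => rfl)
    (fun g hg m hm => hom_ext' fun x => by
      obtain ⟨x, rfl⟩ := (LinearMap.range f.lin).mkQ_surjective x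
      exact LinearMap.congr_fun (congrArg Hom.lin hm) x)

lemma injective_of_mono [Mono f] : Function.Injective f.lin := by
  rw [injective_iff_map_eq_zero]
  intro x hx
  have h : kerι f = 0 := by
    rw [← cancel_mono f, kerι_comp, zero_comp]
  exact LinearMap.congr_fun (congrArg Hom.lin h) ⟨x, hx⟩

lemma surjective_of_epi [Epi f] : Function.Surjective f.lin := by
  have h : cokerπ f = 0 := by
    rw [← cancel_epi f, comp_cokerπ, comp_zero]
  intro y
  have := LinearMap.congr_fun (congrArg Hom.lin h) y
  exact (Submodule.Quotient.mk_eq_zero _).1 this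

lemma piece_of_injective (hf : Function.Injective f.lin) (q : Fin n → ℤ) (m : M)
    (h : f.lin m ∈ N.piece q) : m ∈ M.piece q := by
  have h1 : f.lin (M.decomp m q) = f.lin m := by
    rw [← decomp_map_apply, decomp_coe N q ⟨_, h⟩, DirectSum.of_eq_same]
  rw [← hf h1]
  exact (M.decomp m q).2

lemma piece_of_surjective (hf : Function.Surjective f.lin) (q : Fin n → ℤ) (y : N)
    (h : y ∈ N.piece q) : ∃ m ∈ M.piece q, f.lin m = y := by
  obtain ⟨m, rfl⟩ := hf y
  refine ⟨M.decomp m q, (M.decomp m q).2, ?_⟩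
  rw [← decomp_map_apply, decomp_coe N q ⟨_, h⟩, DirectSum.of_eq_same]

end Kernel

instance : HasKernels (GrMod k n) := ⟨fun f => ⟨⟨⟨_, kerIsLimit f⟩⟩⟩⟩

instance : HasCokernels (GrMod k n) := ⟨fun f => ⟨⟨⟨_, cokerIsColimit f⟩⟩⟩⟩

/-- A monomorphism is the kernel of its cokernel. -/
abbrev normalMono {M N : GrMod k n} (f : M ⟶ N) [Mono f] : NormalMono f where
  Z := coker f
  g := cokerπ f
  w := comp_cokerπ f
  isLimit := by
    have hf := injective_of_mono f
    let e := LinearEquiv.ofInjective f.lin hf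
    refine KernelFork.IsLimit.ofι _ _
      (fun g hg => ⟨e.symm.toLinearMap ∘ₗ g.lin.codRestrict (LinearMap.range f.lin) (fun x =>
        (Submodule.Quotient.mk_eq_zero _).1 (LinearMap.congr_fun (congrArg Hom.lin hg) x)),
        fun q m h => piece_of_injective f hf q _ ?_⟩)
      (fun g hg => hom_ext' fun x => ?_)
      (fun g hg m hm => (cancel_mono f).1 (hm.trans (Eq.symm (hom_ext' fun x => ?_))))
    · have := congrArg Subtype.val (e.apply_symm_apply
        (g.lin.codRestrict (LinearMap.range f.lin) (fun x =>
        (Submodule.Quotient.mk_eq_zero _).1 (LinearMap.congr_fun (congrArg Hom.lin hg) x)) m))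
      have h2 := g.map_mem q m h
      rw [show g.lin m = _ from this.symm] at h2
      exact h2
    · exact congrArg Subtype.val (e.apply_symm_apply _)
    · exact congrArg Subtype.val (e.apply_symm_apply _)

/-- An epimorphism is the cokernel of its kernel. -/
abbrev normalEpi {M N : GrMod k n} (f : M ⟶ N) [Epi f] : NormalEpi f where
  W := ker f
  g := kerι f
  w := kerι_comp f
  isColimit := by
    have hf := surjective_of_epi f
    let e := LinearMap.quotKerEquivOfSurjective f.lin hf
    have key : ∀ {Z : GrMod k n} (g : M ⟶ Z) (hg : kerι f ≫ g = 0) (x : M),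
        (LinearMap.ker f.lin).liftQ g.lin (fun x hx =>
          LinearMap.congr_fun (congrArg Hom.lin hg) ⟨x, hx⟩) (e.symm (f.lin x)) = g.lin x := by
      intro Z g hg x
      have : e.symm (f.lin x) = (LinearMap.ker f.lin).mkQ x := by
        rw [LinearEquiv.symm_apply_eq]; rfl
      rw [this]; rfl
    refine CokernelCofork.IsColimit.ofπ _ _
      (fun g hg => ⟨(LinearMap.ker f.lin).liftQ g.lin (fun x hx =>
          LinearMap.congr_fun (congrArg Hom.lin hg) ⟨x, hx⟩) ∘ₗ e.symm.toLinearMap,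
        fun q y h => ?_⟩)
      (fun g hg => hom_ext' fun x => key g hg x)
      (fun g hg m hm => (cancel_epi f).1 (hm.trans (hom_ext' fun x => (key g hg x).symm)))
    obtain ⟨m, hm, rfl⟩ := piece_of_surjective f hf q y h
    have := key g hg m
    have h2 := g.map_mem q m hm
    rw [← this] at h2
    exact h2

/-- The direct sum of two graded modules. -/
def prod (M N : GrMod k n) : GrMod k n where
  carrier := M × N
  piece q := (M.piece q).prod (N.piece q)
  isInternal := by
    let P := fun q => (M.piece q).prod (N.piece q)
    let i₁ : ∀ q, M.piece q →+ P q := fun q =>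
      { toFun := fun x => ⟨(x.1, 0), x.2, (N.piece q).zero_mem⟩, map_zero' := rfl
        map_add' := fun x y => Subtype.ext (Prod.ext rfl (add_zero (0 : N)).symm) }
    let i₂ : ∀ q, N.piece q →+ P q := fun q =>
      { toFun := fun x => ⟨(0, x.1), (M.piece q).zero_mem, x.2⟩, map_zero' := rfl
        map_add' := fun x y => Subtype.ext (Prod.ext (add_zero (0 : M)).symm rfl) }
    let D : (M × N) →+ DirectSum _ (fun q => P q) :=
      AddMonoidHom.coprod ((DirectSum.map i₁).comp M.decomp.toAddMonoidHom)
        ((DirectSum.map i₂).comp N.decomp.toAddMonoidHom)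
    refine isInternal_of_decomp P D ?_ ?_
    · rintro ⟨x, y⟩
      have k1 : (DirectSum.coeAddMonoidHom P).comp (DirectSum.map i₁) =
          (AddMonoidHom.inl M N).comp (DirectSum.coeAddMonoidHom M.piece) := by
        ext q x <;> simp [i₁]
      have k2 : (DirectSum.coeAddMonoidHom P).comp (DirectSum.map i₂) =
          (AddMonoidHom.inr M N).comp (DirectSum.coeAddMonoidHom N.piece) := by
        ext q x <;> simp [i₂]
      have h1 := DFunLike.congr_fun k1 (M.decomp x)
      have h2 := DFunLike.congr_fun k2 (N.decomp y)
      simp only [AddMonoidHom.comp_apply, coe_decomp] at h1 h2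
      change DirectSum.coeAddMonoidHom P (DirectSum.map i₁ (M.decomp x) +
        DirectSum.map i₂ (N.decomp y)) = _
      rw [map_add, h1, h2]
      simp
    · rintro q ⟨⟨x, y⟩, hx, hy⟩
      change DirectSum.map i₁ (M.decomp x) + DirectSum.map i₂ (N.decomp y) = _
      rw [decomp_coe M q ⟨x, hx⟩, decomp_coe N q ⟨y, hy⟩, DirectSum.map_of, DirectSum.map_of,
        ← map_add]
      congr 1
      exact Subtype.ext (Prod.ext (add_zero x) (zero_add y))
  smul_mem p q a m ha hm := ⟨M.smul_mem p q a m.1 ha hm.1, N.smul_mem p q a m.2 ha hm.2⟩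

/-- The zero graded module. -/
def zeroObj : GrMod k n where
  carrier := PUnit
  piece _ := ⊤
  isInternal := by
    refine ⟨fun a b _ => ?_, fun x => ⟨DirectSum.of
      (fun _ : Fin n → ℤ => (⊤ : AddSubgroup PUnit.{u + 1})) 0 ⟨x, trivial⟩,
      Subsingleton.elim (α := PUnit) _ _⟩⟩
    exact DFinsupp.ext fun q => Subtype.ext (Subsingleton.elim (α := PUnit) _ _)
  smul_mem _ _ _ _ _ _ := trivial

instance : HasZeroObject (GrMod k n) :=
  ⟨zeroObj, by
    rw [IsZero.iff_id_eq_zero]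
    exact hom_ext' fun x => Subsingleton.elim (α := PUnit) _ _⟩

instance : HasBinaryBiproducts (GrMod k n) where
  has_binary_biproduct M N := HasBinaryBiproduct.mk
    { bicone :=
        { pt := prod M N
          fst := ⟨LinearMap.fst _ M N, fun _ _ h => h.1⟩
          snd := ⟨LinearMap.snd _ M N, fun _ _ h => h.2⟩
          inl := ⟨LinearMap.inl _ M N, fun q _ h => ⟨h, (N.piece q).zero_mem⟩⟩
          inr := ⟨LinearMap.inr _ M N, fun q _ h => ⟨(M.piece q).zero_mem, h⟩⟩
          inl_fst := rfl
          inl_snd := rfl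
          inr_fst := rfl
          inr_snd := rfl }
      isBilimit := isBinaryBilimitOfTotal _ (hom_ext' fun x =>
        Prod.ext (add_zero (x.1 : M)) (zero_add (x.2 : N))) }

instance : HasFiniteProducts (GrMod k n) := hasFiniteProducts_of_has_binary_and_terminal

instance : Abelian (GrMod k n) where
  normalMonoOfMono f _ := ⟨normalMono f⟩
  normalEpiOfEpi f _ := ⟨normalEpi f⟩

end GrMod


/-! ### Equivariant sheaves on torus-invariant open subsets of affine space -/

section LinearAlgebra

variable {R : Type*} [CommRing R] (S : Submonoid R)
  {X Y Z X' Y' Z' : Type*} [AddCommGroup X] [AddCommGroup Y] [AddCommGroup Z]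
  [AddCommGroup X'] [AddCommGroup Y'] [AddCommGroup Z']
  [Module R X] [Module R Y] [Module R Z] [Module R X'] [Module R Y'] [Module R Z']

lemma isLocalizedModule_mk' (l : X →ₗ[R] X')
    (h₁ : ∀ s ∈ S, Function.Injective (fun x : X' => s • x))
    (h₂ : ∀ s ∈ S, Function.Surjective (fun x : X' => s • x))
    (h₃ : ∀ y, ∃ s ∈ S, ∃ x, s • y = l x)
    (h₄ : ∀ x, l x = 0 → ∃ s ∈ S, s • x = 0) : IsLocalizedModule S l where
  map_units s := (Module.End.isUnit_iff _).2 ⟨h₁ s s.2, h₂ s s.2⟩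
  surj y := by
    obtain ⟨s, hs, x, h⟩ := h₃ y
    exact ⟨(x, ⟨s, hs⟩), h⟩
  exists_of_eq {x₁ x₂} h := by
    obtain ⟨s, hs, h⟩ := h₄ (x₁ - x₂) (by rw [map_sub, h, sub_self])
    exact ⟨⟨s, hs⟩, by rwa [smul_sub, sub_eq_zero] at h⟩

variable {S}

lemma loc_bij (l : X →ₗ[R] X') [hl : IsLocalizedModule S l] {s : R} (hs : s ∈ S) : Function.Bijective (fun x : X' => s • x) :=
  (Module.End.isUnit_iff _).1 (hl.map_units ⟨s, hs⟩)

lemma loc_surj (l : X →ₗ[R] X') [hl : IsLocalizedModule S l]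
    (y : X') : ∃ s ∈ S, ∃ x, s • y = l x := by
  obtain ⟨⟨x, s⟩, h⟩ := hl.surj y
  exact ⟨s, s.2, x, h⟩

lemma loc_eq_zero (l : X →ₗ[R] X') [hl : IsLocalizedModule S l]
    (x : X) (h : l x = 0) : ∃ s ∈ S, s • x = 0 := by
  obtain ⟨s, hs⟩ := hl.exists_of_eq (x₁ := x) (x₂ := 0) (by simpa using h)
  exact ⟨s, s.2, by simpa [Submonoid.smul_def] using hs⟩

/-- Localization is compatible with kernels. -/
lemma isLocalizedModule_ker (i : X →ₗ[R] Y) (f : Y →ₗ[R] Z) (i' : X' →ₗ[R] Y') (f' : Y' →ₗ[R] Z')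
    (a : X →ₗ[R] X') (b : Y →ₗ[R] Y') (c : Z →ₗ[R] Z')
    (hi : Function.Injective i) (hi' : Function.Injective i')
    (hf : ∀ y, f y = 0 → ∃ x, i x = y) (hf' : ∀ y, f' y = 0 → ∃ x, i' x = y)
    (hz' : ∀ x, f' (i' x) = 0)
    (h₁ : ∀ x, i' (a x) = b (i x)) (h₂ : ∀ y, f' (b y) = c (f y))
    [IsLocalizedModule S b] [IsLocalizedModule S c] : IsLocalizedModule S a := by
  refine isLocalizedModule_mk' S a (fun s hs x x' h => ?_) (fun s hs x => ?_) (fun y => ?_)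
    (fun x hx => ?_)
  · apply hi'
    apply (loc_bij b hs).1
    simpa using congrArg i' h
  · obtain ⟨y, hy⟩ := (loc_bij b hs).2 (i' x)
    dsimp only at hy
    obtain ⟨x', rfl⟩ := hf' y ((loc_bij c hs).1 (by
      dsimp only
      rw [← map_smul, hy, hz', smul_zero]))
    exact ⟨x', hi' (by simpa using hy)⟩
  · obtain ⟨s, hs, y', h⟩ := loc_surj (S := S) b (i' y)
    obtain ⟨t, ht, h'⟩ := loc_eq_zero (S := S) c (f y') (by
      rw [← h₂, ← h, map_smul, hz', smul_zero])
    obtain ⟨x, hx⟩ := hf (t • y') (by rw [map_smul, h'])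
    refine ⟨t * s, S.mul_mem ht hs, x, hi' ?_⟩
    rw [h₁, hx, map_smul, map_smul, ← h, mul_smul]
  · obtain ⟨s, hs, h⟩ := loc_eq_zero (S := S) b (i x) (by rw [← h₁, hx, map_zero])
    exact ⟨s, hs, hi (by rw [map_smul, h, map_zero])⟩

/-- Localization is compatible with cokernels. -/
lemma isLocalizedModule_coker (f : X →ₗ[R] Y) (p : Y →ₗ[R] Z) (f' : X' →ₗ[R] Y') (p' : Y' →ₗ[R] Z')
    (a : X →ₗ[R] X') (b : Y →ₗ[R] Y') (c : Z →ₗ[R] Z')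
    (hp : Function.Surjective p) (hp' : Function.Surjective p')
    (hf' : ∀ y, p' y = 0 → ∃ x, f' x = y)
    (hz : ∀ x, p (f x) = 0) (hz' : ∀ x, p' (f' x) = 0)
    (h₁ : ∀ x, f' (a x) = b (f x)) (h₂ : ∀ y, p' (b y) = c (p y))
    [IsLocalizedModule S a] [IsLocalizedModule S b] : IsLocalizedModule S c := by
  refine isLocalizedModule_mk' S c (fun s hs => ?_) (fun s hs z => ?_) (fun z => ?_)
    (fun z hz => ?_)
  · have key : ∀ z : Z', s • z = 0 → z = 0 := by
      intro z hz
      obtain ⟨y, rfl⟩ := hp' z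
      obtain ⟨x, hx⟩ := hf' (s • y) (by rw [map_smul, hz])
      obtain ⟨x', rfl⟩ := (loc_bij a hs).2 x
      have : f' x' = y := (loc_bij b hs).1 (by
        dsimp only
        rw [← map_smul, hx])
      rw [← this, hz']
    intro z z' h
    dsimp only at h
    rw [← sub_eq_zero]
    apply key
    rw [smul_sub, h, sub_self]
  · obtain ⟨y, rfl⟩ := hp' z
    obtain ⟨y', rfl⟩ := (loc_bij b hs).2 y
    exact ⟨p' y', (map_smul _ _ _).symm⟩
  · obtain ⟨y, rfl⟩ := hp' z
    obtain ⟨s, hs, y', h⟩ := loc_surj (S := S) b y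
    exact ⟨s, hs, p y', by rw [← map_smul, h, h₂]⟩
  · obtain ⟨y, rfl⟩ := hp z
    obtain ⟨x', hx'⟩ := hf' (b y) (by rw [h₂, hz])
    obtain ⟨s, hs, x, h⟩ := loc_surj (S := S) a x'
    obtain ⟨t, ht, h'⟩ := loc_eq_zero (S := S) b (s • y - f x) (by
      rw [map_sub, map_smul, ← hx', ← h₁, ← h, map_smul, sub_self])
    refine ⟨t * s, S.mul_mem ht hs, ?_⟩
    rw [smul_sub, sub_eq_zero] at h'
    rw [mul_smul, ← map_smul, ← map_smul, h', map_smul, (by assumption : ∀ x, p (f x) = 0),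
      smul_zero]

/-- Localization is compatible with direct sums. -/
lemma isLocalizedModule_biprod (i₁ : X →ₗ[R] Z) (i₂ : Y →ₗ[R] Z) (p₁ : Z →ₗ[R] X) (p₂ : Z →ₗ[R] Y)
    (i₁' : X' →ₗ[R] Z') (i₂' : Y' →ₗ[R] Z') (p₁' : Z' →ₗ[R] X') (p₂' : Z' →ₗ[R] Y')
    (a : X →ₗ[R] X') (b : Y →ₗ[R] Y') (c : Z →ₗ[R] Z')
    (h₅ : ∀ z, i₁ (p₁ z) + i₂ (p₂ z) = z)
    (h₅' : ∀ z, i₁' (p₁' z) + i₂' (p₂' z) = z)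
    (n₁ : ∀ x, i₁' (a x) = c (i₁ x)) (n₂ : ∀ x, i₂' (b x) = c (i₂ x))
    (n₃ : ∀ z, p₁' (c z) = a (p₁ z)) (n₄ : ∀ z, p₂' (c z) = b (p₂ z))
    [IsLocalizedModule S a] [IsLocalizedModule S b] : IsLocalizedModule S c := by
  refine isLocalizedModule_mk' S c (fun s hs z z' h => ?_) (fun s hs z => ?_) (fun z => ?_)
    (fun z hz => ?_)
  · dsimp only at h
    rw [← h₅' z, ← h₅' z', (loc_bij a hs).1 (a₁ := p₁' z) (a₂ := p₁' z') (by
      dsimp only; rw [← map_smul, h, map_smul]), (loc_bij b hs).1 (a₁ := p₂' z) (a₂ := p₂' z') (by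
      dsimp only; rw [← map_smul, h, map_smul])]
  · obtain ⟨x, hx⟩ := (loc_bij a hs).2 (p₁' z)
    obtain ⟨y, hy⟩ := (loc_bij b hs).2 (p₂' z)
    dsimp only at hx hy
    refine ⟨i₁' x + i₂' y, ?_⟩
    dsimp only
    rw [smul_add, ← map_smul, ← map_smul, hx, hy, h₅']
  · obtain ⟨s, hs, x, hx⟩ := loc_surj (S := S) a (p₁' z)
    obtain ⟨t, ht, y, hy⟩ := loc_surj (S := S) b (p₂' z)
    refine ⟨t * s, S.mul_mem ht hs, t • i₁ x + s • i₂ y, ?_⟩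
    rw [map_add, map_smul, map_smul, ← n₁, ← n₂, ← hx, ← hy, map_smul, map_smul, ← mul_smul,
      ← mul_smul, mul_comm s t, ← smul_add, h₅']
  · obtain ⟨s, hs, hx⟩ := loc_eq_zero (S := S) a (p₁ z) (by rw [← n₃, hz, map_zero])
    obtain ⟨t, ht, hy⟩ := loc_eq_zero (S := S) b (p₂ z) (by rw [← n₄, hz, map_zero])
    refine ⟨t * s, S.mul_mem ht hs, ?_⟩
    rw [← h₅ z, smul_add, mul_smul, ← map_smul, hx, map_zero, smul_zero, mul_comm t s, mul_smul,
      ← map_smul, hy, map_zero, smul_zero, add_zero]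

end LinearAlgebra

/-- The faces of a simplicial complex `Δ` on `{1, …, n}`, ordered by inclusion. The face `σ`
stands for the invariant affine open set `U_σ = {z | z i ≠ 0 for all i ∉ σ}`. -/
abbrev Faces {n : ℕ} (Δ : LowerSet (Finset (Fin n))) : Type := {σ : Finset (Fin n) // σ ∈ Δ}

/-- The monomials in the `z i` with `i ∉ σ`. Inverting them in `k[z₁, …, zₙ]` gives the coordinate
ring of `U_σ`. -/
def denoms (k : Type u) [Field k] {n : ℕ} (σ : Finset (Fin n)) : Submonoid (PolyRing k n) :=
  Submonoid.closure {f | ∃ i, i ∉ σ ∧ f = MvPolynomial.X i}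

section Sheaves

variable (k : Type u) [Field k] {n : ℕ} (Δ : LowerSet (Finset (Fin n)))

/-- Equivariant presheaves of modules on the invariant affine open sets `U_σ` for `σ ∈ Δ`: a graded
module of sections over each `U_σ` and graded restriction maps from `U_σ` to `U_τ`
for `τ ⊆ σ`. -/
abbrev EquivPresheaf : Type (u + 1) := (Faces Δ)ᵒᵖ ⥤ GrMod k n

variable {Δ}

/-- The restriction map from `U_σ` to `U_τ`. -/
abbrev EquivPresheaf.res {k : Type u} [Field k] (F : EquivPresheaf k Δ) {τ σ : Faces Δ}
    (h : τ ≤ σ) : F.obj (.op σ) →ₗ[PolyRing k n] F.obj (.op τ) :=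
  GrMod.Hom.lin (F.map (homOfLE h).op)

variable (Δ)

/-- Quasi-coherence: the sections over `U_τ` are obtained from the sections over any larger `U_σ`
by inverting the coordinates that do not vanish on `U_τ`. (For `τ = σ` this says that these
coordinates act invertibly on the sections over `U_σ`, i.e. that the sections over `U_σ` are a
module over the coordinate ring of `U_σ`.) -/
def IsQuasiCoherent : ObjectProperty (EquivPresheaf k Δ) := fun F =>
  ∀ (τ σ : Faces Δ) (h : τ ≤ σ), IsLocalizedModule (denoms k τ.1) (F.res h)

/-- Finiteness: the sections over each `U_σ` are finitely generated over the coordinate ring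
of `U_σ`. (The sections over `U_σ` of a quasi-coherent `F` coincide with their localization.) -/
def IsLocallyFinite : ObjectProperty (EquivPresheaf k Δ) := fun F =>
  ∀ σ : Faces Δ, Module.Finite (Localization (denoms k σ.1))
    (LocalizedModule (denoms k σ.1) (F.obj (.op σ)))

/-- Coherence. -/
def IsCoherent : ObjectProperty (EquivPresheaf k Δ) := IsQuasiCoherent k Δ ⊓ IsLocallyFinite k Δ

/-- The category of coherent sheaves on the quotient stack `[U_Δ/𝔾ₘⁿ]`, i.e. of `𝔾ₘⁿ`-equivariant
coherent sheaves on `U_Δ = ⋃_{σ ∈ Δ} U_σ`. Such a sheaf is given by its equivariant modules of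
sections over the members of the invariant affine open cover `(U_σ)`, which is closed under
intersections as `U_σ ∩ U_τ = U_{σ ∩ τ}`, and by the restriction maps between them. -/
abbrev Coh : Type (u + 1) := (IsCoherent k Δ).FullSubcategory

section Exactness

variable {k Δ} {F G : EquivPresheaf k Δ} (f : F ⟶ G)

lemma kernelFork_app (c : KernelFork f) (hc : IsLimit c) (σ : (Faces Δ)ᵒᵖ) :
    Function.Injective (GrMod.Hom.lin (c.ι.app σ)) ∧
    (∀ y, GrMod.Hom.lin (f.app σ) y = 0 → ∃ x, GrMod.Hom.lin (c.ι.app σ) x = y) ∧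
    ∀ x, GrMod.Hom.lin (f.app σ) (GrMod.Hom.lin (c.ι.app σ) x) = 0 := by
  have h := KernelFork.mapIsLimit c hc ((evaluation _ (GrMod k n)).obj σ)
  have : Mono c.ι := mono_of_isLimit_fork hc
  have : Mono (c.ι.app σ) := inferInstance
  refine ⟨GrMod.injective_of_mono _, fun y hy => ?_, fun x => ?_⟩
  · have hl := KernelFork.IsLimit.lift' h (GrMod.kerι (f.app σ)) (GrMod.kerι_comp _)
    exact ⟨GrMod.Hom.lin hl.1 ⟨y, hy⟩,
      LinearMap.congr_fun (congrArg GrMod.Hom.lin hl.2) ⟨y, hy⟩⟩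
  · exact LinearMap.congr_fun (congrArg GrMod.Hom.lin (NatTrans.congr_app c.condition σ)) x

lemma cokernelCofork_app (c : CokernelCofork f) (hc : IsColimit c) (σ : (Faces Δ)ᵒᵖ) :
    Function.Surjective (GrMod.Hom.lin (c.π.app σ)) ∧
    (∀ y, GrMod.Hom.lin (c.π.app σ) y = 0 → ∃ x, GrMod.Hom.lin (f.app σ) x = y) ∧
    ∀ x, GrMod.Hom.lin (c.π.app σ) (GrMod.Hom.lin (f.app σ) x) = 0 := by
  have h := CokernelCofork.mapIsColimit c hc ((evaluation _ (GrMod k n)).obj σ)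
  have : Epi c.π := epi_of_isColimit_cofork hc
  have : Epi (c.π.app σ) := inferInstance
  refine ⟨GrMod.surjective_of_epi _, fun y hy => ?_, fun x => ?_⟩
  · have hl := CokernelCofork.IsColimit.desc' h (GrMod.cokerπ (f.app σ)) (GrMod.comp_cokerπ _)
    have h1 := LinearMap.congr_fun (congrArg GrMod.Hom.lin hl.2) y
    have h2 : GrMod.Hom.lin (GrMod.cokerπ (f.app σ)) y = 0 := by
      rw [← h1]
      exact (congrArg (GrMod.Hom.lin hl.1) hy).trans (map_zero _)
    exact (Submodule.Quotient.mk_eq_zero _).1 h2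
  · exact LinearMap.congr_fun (congrArg GrMod.Hom.lin (NatTrans.congr_app c.condition σ)) x

lemma lin_naturality {F G : EquivPresheaf k Δ} (f : F ⟶ G) {τ σ : Faces Δ} (h : τ ≤ σ)
    (x : F.obj (.op σ)) :
    GrMod.Hom.lin (f.app (.op τ)) (F.res h x) = G.res h (GrMod.Hom.lin (f.app (.op σ)) x) :=
  LinearMap.congr_fun (congrArg GrMod.Hom.lin (f.naturality (homOfLE h).op)) x

end Exactness

instance : (IsCoherent k Δ).ContainsZero where
  exists_zero := by
    obtain ⟨Z, hZ⟩ := HasZeroObject.zero (C := EquivPresheaf k Δ)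
    refine ⟨Z, hZ, fun τ σ h => ?_, fun σ => ?_⟩
    all_goals
      have hz : ∀ (σ : (Faces Δ)ᵒᵖ) (x : Z.obj σ), x = 0 := fun σ x => by
        have h0 : IsZero (Z.obj σ) :=
          ((evaluation _ (GrMod k n)).obj σ).map_isZero hZ
        exact LinearMap.congr_fun (congrArg GrMod.Hom.lin ((IsZero.iff_id_eq_zero _).1 h0)) x
    · refine isLocalizedModule_mk' _ _ (fun s _ x x' _ => ?_) (fun s _ x => ⟨x, ?_⟩)
        (fun y => ⟨1, Submonoid.one_mem _, 0, ?_⟩) (fun x _ => ⟨1, Submonoid.one_mem _, hz _ _⟩)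
      · exact (hz _ x).trans (hz _ x').symm
      · exact (hz _ _).trans (hz _ _).symm
      · exact (hz _ _).trans (hz _ _).symm
    · have : Subsingleton (Z.obj (.op σ)) :=
        ⟨fun x y => (hz _ x).trans (hz _ y).symm⟩
      exact Module.Finite.of_surjective
        (0 : (Localization (denoms k σ.1)) →ₗ[Localization (denoms k σ.1)] _)
        (fun x => ⟨0, Subsingleton.elim _ _⟩)

instance : (IsCoherent k Δ).IsClosedUnderKernels where
  kernels_le := by
    rintro _ ⟨f, c, hc, hF, hG⟩
    have e := kernelFork_app f c hc
    refine ⟨fun τ σ h => ?_, fun σ => ?_⟩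
    · have := hF.1 τ σ h
      have := hG.1 τ σ h
      exact isLocalizedModule_ker _ _ _ _ _ _ _ (e (.op σ)).1 (e (.op τ)).1 (e (.op σ)).2.1
        (e (.op τ)).2.1 (e (.op τ)).2.2 (lin_naturality c.ι h) (lin_naturality f h)
    · have := hF.2 σ
      have : IsNoetherianRing (Localization (denoms k σ.1)) :=
        IsLocalization.isNoetherianRing (denoms k σ.1) _ inferInstance
      exact Module.Finite.of_injective (LocalizedModule.map (denoms k σ.1) (GrMod.Hom.lin (c.ι.app (.op σ))))
        (LocalizedModule.map_injective _ _ (e (.op σ)).1)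

instance : (IsCoherent k Δ).IsClosedUnderCokernels where
  cokernels_le := by
    rintro _ ⟨f, c, hc, hF, hG⟩
    have e := cokernelCofork_app f c hc
    refine ⟨fun τ σ h => ?_, fun σ => ?_⟩
    · have := hF.1 τ σ h
      have := hG.1 τ σ h
      exact isLocalizedModule_coker _ _ _ _ _ _ _ (e (.op σ)).1 (e (.op τ)).1 (e (.op τ)).2.1
        (e (.op σ)).2.2 (e (.op τ)).2.2 (lin_naturality f h) (lin_naturality c.π h)
    · have := hG.2 σ
      exact Module.Finite.of_surjective (LocalizedModule.map (denoms k σ.1) (GrMod.Hom.lin (c.π.app (.op σ))))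
        (LocalizedModule.map_surjective _ _ (e (.op σ)).1)

instance : (IsCoherent k Δ).IsClosedUnderIsomorphisms where
  of_iso {X Y} e hX :=
    (IsCoherent k Δ).prop_of_isLimit_kernelFork (f := (0 : X ⟶ X))
      (k := KernelFork.ofι e.inv comp_zero)
      (KernelFork.IsLimit.ofι _ _ (fun g _ => g ≫ e.hom) (fun _ _ => by simp)
        (fun _ _ m hm => by simp [← hm])) hX hX

/-- Localization is compatible with direct sums. -/
lemma isCoherent_biprod (X Y : EquivPresheaf k Δ) (hX : IsCoherent k Δ X) (hY : IsCoherent k Δ Y) :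
    IsCoherent k Δ (X ⊞ Y) := by
  have e₅ : ∀ σ (z : (X ⊞ Y).obj σ), GrMod.Hom.lin ((biprod.inl : X ⟶ X ⊞ Y).app σ)
      (GrMod.Hom.lin ((biprod.fst : X ⊞ Y ⟶ X).app σ) z) +
      GrMod.Hom.lin ((biprod.inr : Y ⟶ X ⊞ Y).app σ)
      (GrMod.Hom.lin ((biprod.snd : X ⊞ Y ⟶ Y).app σ) z) = z := fun σ z =>
    LinearMap.congr_fun (congrArg GrMod.Hom.lin
      (NatTrans.congr_app (biprod.total (X := X) (Y := Y)) σ)) z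
  refine ⟨fun τ σ h => ?_, fun σ => ?_⟩
  · have := hX.1 τ σ h
    have := hY.1 τ σ h
    exact isLocalizedModule_biprod _ _ _ _ _ _ _ _ (X.res h) (Y.res h) ((X ⊞ Y).res h)
      (e₅ (.op σ)) (e₅ (.op τ))
      (lin_naturality biprod.inl h) (lin_naturality biprod.inr h)
      (lin_naturality biprod.fst h) (lin_naturality biprod.snd h)
  · have := hX.2 σ
    have := hY.2 σ
    let S := denoms k σ.1
    refine Module.Finite.of_surjective (LinearMap.coprod
      (LocalizedModule.map S (GrMod.Hom.lin ((biprod.inl : X ⟶ X ⊞ Y).app (.op σ))))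
      (LocalizedModule.map S (GrMod.Hom.lin ((biprod.inr : Y ⟶ X ⊞ Y).app (.op σ))))) ?_
    intro z
    induction z using LocalizedModule.induction_on with
    | _ z s =>
      refine ⟨(LocalizedModule.mk (GrMod.Hom.lin ((biprod.fst : X ⊞ Y ⟶ X).app (.op σ)) z) s,
        LocalizedModule.mk (GrMod.Hom.lin ((biprod.snd : X ⊞ Y ⟶ Y).app (.op σ)) z) s), ?_⟩
      rw [LinearMap.coprod_apply, LocalizedModule.map_mk, LocalizedModule.map_mk,
        LocalizedModule.mk_add_mk, ← smul_add, e₅, LocalizedModule.mk_cancel_common_left]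

instance : (IsCoherent k Δ).IsClosedUnderBinaryProducts where
  limitsOfShape_le := by
    rintro X ⟨p⟩
    let e : X ≅ p.diag.obj ⟨.left⟩ ⊞ p.diag.obj ⟨.right⟩ :=
      IsLimit.conePointsIsoOfNatIso p.isLimit (BinaryBiproduct.isLimit _ _)
        (mapPairIso (Iso.refl _) (Iso.refl _))
    exact (IsCoherent k Δ).prop_of_iso e.symm
      (isCoherent_biprod k Δ _ _ (p.prop_diag_obj _) (p.prop_diag_obj _))

instance : (IsCoherent k Δ).IsClosedUnderFiniteProducts := .mk'

instance : Abelian (Coh k Δ) := inferInstance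

instance : Linear k (Coh k Δ) := inferInstance

end Sheaves

/-! ### Equivariant line bundles -/

section LineBundle

variable (k : Type u) [Field k] (n : ℕ)

/-- Laurent polynomials in `z₁, …, zₙ`; the monomial `z ^ a` is `AddMonoidAlgebra.single a 1`. -/
abbrev Laurent : Type u := AddMonoidAlgebra k (Fin n → ℤ)

/-- The inclusion of polynomials into Laurent polynomials, `z i ↦ z ^ (ε i)`. -/
def polyToLaurent : PolyRing k n →ₐ[k] Laurent k n :=
  MvPolynomial.aeval fun i => AddMonoidAlgebra.single (Pi.single i 1) 1

instance : Module (PolyRing k n) (Laurent k n) :=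
  Module.compHom _ (polyToLaurent k n).toRingHom

variable {k n}

lemma poly_smul_def (f : PolyRing k n) (x : Laurent k n) : f • x = polyToLaurent k n f * x := rfl

lemma X_smul_coeff (i : Fin n) (x : Laurent k n) (a : Fin n → ℤ) :
    ((MvPolynomial.X i : PolyRing k n) • x).coeff a = x.coeff (-Pi.single i 1 + a) := by
  rw [poly_smul_def, polyToLaurent, MvPolynomial.aeval_X, AddMonoidAlgebra.coeff_single_mul_apply,
    one_mul]

lemma polyToLaurent_monomial (m : Fin n →₀ ℕ) (c : k) :
    polyToLaurent k n (MvPolynomial.monomial m c) =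
      AddMonoidAlgebra.single (Finsupp.weight (fun i : Fin n => (Pi.single i 1 : Fin n → ℤ)) m)
        c := by
  rw [polyToLaurent, MvPolynomial.aeval_monomial, Finsupp.weight_apply]
  simp only [AddMonoidAlgebra.single_pow, one_pow]
  rw [Finsupp.prod, AddMonoidAlgebra.prod_single, Finsupp.sum]
  simp [AddMonoidAlgebra.coe_algebraMap, AddMonoidAlgebra.single_mul_single]

lemma weight_nonneg (m : Fin n →₀ ℕ) (i : Fin n) :
    0 ≤ Finsupp.weight (fun i : Fin n => (Pi.single i 1 : Fin n → ℤ)) m i := by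
  rw [Finsupp.weight_apply, Finsupp.sum, Finset.sum_apply]
  refine Finset.sum_nonneg fun j _ => ?_
  rw [Pi.smul_apply]
  refine nsmul_nonneg ?_ _
  rw [Pi.single_apply]
  split_ifs <;> simp

/-- Laurent polynomials all of whose exponents lie in a set `A`. -/
def supportedIn (A : Set (Fin n → ℤ)) : AddSubgroup (Laurent k n) where
  carrier := {x | ∀ a, x.coeff a ≠ 0 → a ∈ A}
  zero_mem' a h := (h rfl).elim
  add_mem' {x y} hx hy a h := by
    by_cases hxa : x.coeff a = 0
    · exact hy a fun h' => h (by rw [AddMonoidAlgebra.coeff_add, Finsupp.add_apply, hxa, h', add_zero])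
    · exact hx a hxa
  neg_mem' {x} hx a h := hx a fun h' => h (by rw [AddMonoidAlgebra.coeff_neg, Finsupp.neg_apply, h', neg_zero])

lemma mem_supportedIn {A : Set (Fin n → ℤ)} {x : Laurent k n} :
    x ∈ supportedIn A ↔ ∀ a, x.coeff a ≠ 0 → a ∈ A := Iff.rfl

lemma smul_mem_supportedIn {A B : Set (Fin n → ℤ)} (f : PolyRing k n)
    (h : ∀ m, MvPolynomial.coeff m f ≠ 0 → ∀ a ∈ A,
      Finsupp.weight (fun i : Fin n => (Pi.single i 1 : Fin n → ℤ)) m + a ∈ B)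
    {x : Laurent k n} (hx : x ∈ supportedIn A) : f • x ∈ supportedIn (k := k) B := by
  rw [← MvPolynomial.support_sum_monomial_coeff f, Finset.sum_smul]
  refine AddSubgroup.sum_mem _ fun m hm a ha => ?_
  rw [poly_smul_def, polyToLaurent_monomial, AddMonoidAlgebra.coeff_single_mul_apply] at ha
  have := h m (MvPolynomial.mem_support_iff.1 hm) _ (hx _ (right_ne_zero_of_mul ha))
  rwa [add_neg_cancel_left] at this

lemma single_coeff_ne_zero {a b : Fin n → ℤ} {c : k}
    (h : (AddMonoidAlgebra.single a c : Laurent k n).coeff b ≠ 0) : a = b ∧ c ≠ 0 := by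
  rw [AddMonoidAlgebra.coeff_single] at h
  have hab : a = b := by
    by_contra h'
    exact h (Finsupp.single_eq_of_ne (Ne.symm h'))
  subst hab
  rw [Finsupp.single_eq_same] at h
  exact ⟨rfl, h⟩

/-- A family of subgroups with compatible projections is internal. -/
lemma isInternal_of_proj {X : Type*} [AddCommGroup X] (P : (Fin n → ℤ) → AddSubgroup X)
    (π : (Fin n → ℤ) → X →+ X) (h₁ : ∀ q, ∀ x ∈ P q, π q x = x)
    (h₂ : ∀ q q' x, q ≠ q' → x ∈ P q' → π q x = 0)
    (h₃ : ∀ x, ∃ (s : Finset (Fin n → ℤ)) (e : (Fin n → ℤ) → (Fin n → ℤ))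
      (y : ∀ a, P (e a)), x = ∑ a ∈ s, (y a : X)) : DirectSum.IsInternal P := by
  constructor
  · rw [injective_iff_map_eq_zero]
    intro d hd
    have key : ∀ q, (π q).comp (DirectSum.coeAddMonoidHom P) =
        (P q).subtype.comp (DFinsupp.evalAddMonoidHom (β := fun q => P q) q) := by
      intro q
      refine DirectSum.addHom_ext fun q' y => ?_
      simp only [AddMonoidHom.comp_apply, DirectSum.coeAddMonoidHom_of]
      by_cases hq : q = q'
      · subst hq
        refine (h₁ q y y.2).trans ?_
        exact congrArg Subtype.val (DirectSum.of_eq_same (β := fun q => P q) q y).symm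
      · refine (h₂ q q' y hq y.2).trans ?_
        exact congrArg Subtype.val (DirectSum.of_eq_of_ne (β := fun q => P q) q' q y hq).symm
    refine DFinsupp.ext fun q => Subtype.ext ?_
    refine (DFunLike.congr_fun (key q) d).symm.trans ?_
    exact (congrArg (π q) hd).trans (map_zero _)
  · intro x
    obtain ⟨s, e, y, rfl⟩ := h₃ x
    refine ⟨∑ a ∈ s, DirectSum.of (fun q => P q) (e a) (y a), ?_⟩
    rw [map_sum]
    exact Finset.sum_congr rfl fun a _ => DirectSum.coeAddMonoidHom_of P (e a) (y a)

/-- The exponents of the monomials that are regular on `U_σ`. -/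
def regularExponents (σ : Finset (Fin n)) : Set (Fin n → ℤ) := {a | ∀ i ∈ σ, 0 ≤ a i}

variable (k) in
/-- The coordinate ring of `U_σ`, i.e. `k[z i (i ∈ σ), z i ^ (±1) (i ∉ σ)]`, as a module over the
polynomial ring. -/
def coordModule (σ : Finset (Fin n)) : Submodule (PolyRing k n) (Laurent k n) where
  toAddSubmonoid := (supportedIn (k := k) (regularExponents σ)).toAddSubmonoid
  smul_mem' f _ hx := smul_mem_supportedIn (A := regularExponents σ) (B := regularExponents σ) f
    (fun m _ _ ha i hi => add_nonneg (weight_nonneg m i) (ha i hi)) hx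

lemma mem_coordModule {σ : Finset (Fin n)} {x : Laurent k n} :
    x ∈ coordModule k σ ↔ ∀ a, x.coeff a ≠ 0 → ∀ i ∈ σ, 0 ≤ a i := Iff.rfl

lemma coordModule_mono {τ σ : Finset (Fin n)} (h : τ ⊆ σ) : coordModule k σ ≤ coordModule k τ :=
  fun _ hx a ha i hi => hx a ha i (h hi)

variable (k) in
/-- The coordinate ring of `U_σ` with the grading shifted by `p`: the homogeneous piece of
degree `q` is spanned by the monomial `z ^ (p + q)` (if this is regular on `U_σ`). -/
def twistedCoordModule (p : Fin n → ℤ) (σ : Finset (Fin n)) : GrMod k n where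
  carrier := coordModule k σ
  piece q := (supportedIn {p + q}).comap (coordModule k σ).subtype.toAddMonoidHom
  isInternal := by
    have hs : ∀ (x : coordModule k σ) a, AddMonoidAlgebra.single a (x.1.coeff a) ∈ coordModule k σ :=
      fun x a b hb => by
        obtain ⟨rfl, h⟩ := single_coeff_ne_zero hb
        exact x.2 a h
    refine isInternal_of_proj _ (fun q =>
      { toFun := fun x => ⟨AddMonoidAlgebra.single (p + q) (x.1.coeff (p + q)), hs x _⟩
        map_zero' := Subtype.ext (AddMonoidAlgebra.single_zero _)
        map_add' := fun x y => Subtype.ext (AddMonoidAlgebra.single_add _ _ _) })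
      (fun q x hx => Subtype.ext ?_) (fun q q' x hq hx => Subtype.ext ?_) (fun x => ?_)
    · refine AddMonoidAlgebra.ext (Finsupp.ext fun a => ?_)
      by_cases ha : a = p + q
      · subst ha
        exact Finsupp.single_eq_same
      · refine (Finsupp.single_eq_of_ne ha).trans ?_
        by_contra h
        exact ha (hx a (Ne.symm h))
    · have : x.1.coeff (p + q) = 0 := by
        by_contra h
        exact hq (add_left_cancel (hx _ h))
      change AddMonoidAlgebra.single (p + q) (x.1.coeff (p + q)) = 0
      rw [this, AddMonoidAlgebra.single_zero]
    · refine ⟨x.1.coeff.support, fun a => a - p,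
        fun a => ⟨⟨AddMonoidAlgebra.single a (x.1.coeff a), hs x a⟩, ?_⟩, ?_⟩
      · intro b hb
        obtain ⟨rfl, h⟩ := single_coeff_ne_zero hb
        simp
      · refine Subtype.ext (Eq.trans (AddMonoidAlgebra.sum_coeff_single x.1).symm ?_)
        rw [Finsupp.sum, AddSubmonoidClass.coe_finsetSum]
  smul_mem := by
    intro d q f x hf hx
    refine smul_mem_supportedIn (A := {p + q}) f (fun m hm a ha => ?_) hx
    rw [Set.mem_singleton_iff] at ha ⊢
    rw [hf hm, ha]
    abel

variable (Δ : LowerSet (Finset (Fin n)))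

variable (k) in
/-- The equivariant presheaf on the `U_σ` given by the twisted coordinate rings, with
restriction maps the inclusions inside the Laurent polynomials. -/
def lineBundlePresheaf (p : Fin n → ℤ) : EquivPresheaf k Δ where
  obj σ := twistedCoordModule k p σ.unop.1
  map h := ⟨Submodule.inclusion (coordModule_mono (leOfHom h.unop)), fun _ _ hm => hm⟩
  map_id _ := rfl
  map_comp _ _ := rfl

lemma denoms_induction {σ : Finset (Fin n)} {C : PolyRing k n → Prop} (h1 : C 1)
    (hX : ∀ i, i ∉ σ → C (MvPolynomial.X i)) (hmul : ∀ f g, C f → C g → C (f * g)) :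
    ∀ s ∈ denoms k σ, C s := fun _ hs =>
  Submonoid.closure_induction (fun _ ⟨i, hi, e⟩ => e ▸ hX i hi) h1
    (fun _ _ _ _ hf hg => hmul _ _ hf hg) hs

lemma smul_coordModule_bijective (σ : Finset (Fin n)) : ∀ s ∈ denoms k σ,
    Function.Bijective (fun x : coordModule k σ => s • x) := by
  refine denoms_induction ?_ (fun i hi => ⟨fun x y h => ?_, fun x => ?_⟩) ?_
  · simp only [one_smul]
    exact Function.bijective_id
  · refine Subtype.ext (AddMonoidAlgebra.ext (Finsupp.ext fun a => ?_))
    have := congrArg (fun z : coordModule k σ => z.1.coeff (Pi.single i 1 + a)) h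
    simpa [X_smul_coeff] using this
  · refine ⟨⟨AddMonoidAlgebra.single (-Pi.single i 1) 1 * x.1, fun a ha j hj => ?_⟩, ?_⟩
    · rw [AddMonoidAlgebra.coeff_single_mul_apply, one_mul] at ha
      have h1 := x.2 _ ha j hj
      have hij : j ≠ i := fun h => hi (h ▸ hj)
      simpa [Pi.single_apply, hij] using h1
    · refine Subtype.ext (AddMonoidAlgebra.ext (Finsupp.ext fun a => ?_))
      change ((MvPolynomial.X i : PolyRing k n) • (_ : Laurent k n)).coeff a = _
      rw [X_smul_coeff, AddMonoidAlgebra.coeff_single_mul_apply, one_mul]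
      congr 1
      abel
  · intro f g hf hg
    have : (fun x : coordModule k σ => (f * g) • x) =
        (fun x : coordModule k σ => f • x) ∘ (fun x : coordModule k σ => g • x) := by
      funext x
      exact mul_smul f g x
    rw [this]
    exact hf.comp hg

lemma exists_denom_smul_mem (τ σ : Finset (Fin n)) (x : Laurent k n) (hx : x ∈ coordModule k τ) :
    ∃ s ∈ denoms k τ, s • x ∈ coordModule k σ := by
  classical
  suffices h : ∀ I : Finset (Fin n), ∃ s ∈ denoms k τ, s • x ∈ coordModule k (τ ∪ I) by
    obtain ⟨s, hs, h⟩ := h σ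
    exact ⟨s, hs, coordModule_mono Finset.subset_union_right h⟩
  intro I
  induction I using Finset.induction_on with
  | empty => exact ⟨1, Submonoid.one_mem _, by simpa using hx⟩
  | insert i I _ ih =>
    obtain ⟨s, hs, h⟩ := ih
    by_cases hi : i ∈ τ
    · refine ⟨s, hs, fun a ha j hj => ?_⟩
      rw [Finset.mem_union, Finset.mem_insert] at hj
      refine h a ha j (Finset.mem_union.2 ?_)
      rcases hj with hj | rfl | hj
      exacts [.inl hj, .inl hi, .inr hj]
    · set y := s • x with hy
      have hpow : ∀ (N : ℕ) (a : Fin n → ℤ),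
          (((MvPolynomial.X i : PolyRing k n) ^ N) • y).coeff a = y.coeff (a - N • Pi.single i 1) := by
        intro N
        induction N with
        | zero => intro a; simp
        | succ N ih =>
          intro a
          rw [pow_succ', mul_smul, X_smul_coeff, ih, succ_nsmul]
          congr 1
          abel
      have hX : (MvPolynomial.X i : PolyRing k n) ∈ denoms k τ :=
        Submonoid.subset_closure ⟨i, hi, rfl⟩
      let N : ℕ := ∑ a ∈ y.coeff.support, (a i).natAbs
      refine ⟨MvPolynomial.X i ^ N * s, Submonoid.mul_mem _ (Submonoid.pow_mem _ hX N) hs,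
        fun a ha j hj => ?_⟩
      rw [mul_smul, ← hy, hpow] at ha
      by_cases hji : j = i
      · subst hji
        have h1 : ((a - N • (Pi.single j 1 : Fin n → ℤ)) j).natAbs ≤ N :=
          Finset.single_le_sum (f := fun a : Fin n → ℤ => (a j).natAbs) (fun _ _ => Nat.zero_le _)
            (Finsupp.mem_support_iff.2 ha)
        have h2 : (a - N • (Pi.single j 1 : Fin n → ℤ)) j = a j - N := by simp
        rw [h2] at h1
        omega
      · have h1 := h _ ha j (by
          rw [Finset.mem_union, Finset.mem_insert] at hj
          rw [Finset.mem_union]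
          rcases hj with hj | hj | hj
          exacts [.inl hj, (hji hj).elim, .inr hj])
        simpa [Pi.single_apply, hji] using h1

/-- A Laurent polynomial with nonnegative exponents is a polynomial. -/
lemma exists_poly (x : Laurent k n) (hx : x ∈ coordModule k (Finset.univ : Finset (Fin n))) :
    ∃ f : PolyRing k n, polyToLaurent k n f = x := by
  refine ⟨x.coeff.sum fun a c => MvPolynomial.monomial (Finsupp.equivFunOnFinite.symm
    fun i => (a i).toNat) c, ?_⟩
  rw [map_finsuppSum]
  conv_rhs => rw [← AddMonoidAlgebra.sum_coeff_single x]
  refine Finset.sum_congr rfl fun a ha => ?_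
  refine (polyToLaurent_monomial _ _).trans ?_
  congr 1
  funext i
  rw [Finsupp.weight_apply, Finsupp.sum_fintype _ _ (by simp), Finset.sum_apply]
  simp [Pi.single_apply, hx a (Finsupp.mem_support_iff.1 ha) i (Finset.mem_univ i)]

lemma isCoherent_lineBundlePresheaf (p : Fin n → ℤ) :
    IsCoherent k Δ (lineBundlePresheaf k Δ p) := by
  refine ⟨fun τ σ h => ?_, fun σ => ?_⟩
  · refine isLocalizedModule_mk' _ _ (fun s hs => (smul_coordModule_bijective τ.1 s hs).1)
      (fun s hs => (smul_coordModule_bijective τ.1 s hs).2) (fun y => ?_)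
      (fun x hx => ⟨1, Submonoid.one_mem _, ?_⟩)
    · obtain ⟨s, hs, h'⟩ := exists_denom_smul_mem τ.1 σ.1 y.1 y.2
      exact ⟨s, hs, ⟨_, h'⟩, Subtype.ext rfl⟩
    · rw [one_smul]
      have hx' : Submodule.inclusion (coordModule_mono h) x = 0 := hx
      exact Subtype.ext (congrArg (fun z : coordModule k τ.1 => (z : Laurent k n)) hx')
  · have h1 : (1 : Laurent k n) ∈ coordModule k σ.1 := by
      intro a ha i _
      obtain ⟨rfl, -⟩ := single_coeff_ne_zero ha
      exact le_rfl
    let e : (lineBundlePresheaf k Δ p).obj (.op σ) := ⟨1, h1⟩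
    refine Module.Finite.of_surjective (LinearMap.toSpanSingleton (Localization (denoms k σ.1)) _
      (LocalizedModule.mk e (1 : denoms k σ.1))) fun z => ?_
    induction z using LocalizedModule.induction_on with
    | _ m t =>
      obtain ⟨s, hs, h'⟩ := exists_denom_smul_mem σ.1 Finset.univ m.1 m.2
      obtain ⟨f, hf⟩ := exists_poly _ h'
      refine ⟨Localization.mk f (⟨s, hs⟩ * t), ?_⟩
      rw [LinearMap.toSpanSingleton_apply, LocalizedModule.mk_smul_mk, mul_one,
        ← LocalizedModule.mk_cancel_common_left ⟨s, hs⟩ t m]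
      congr 1
      refine Subtype.ext ?_
      change polyToLaurent k n f * 1 = s • m.1
      rw [hf, mul_one]

variable (k) in
/-- The equivariant line bundle `𝒪^Δ(p)` on `U_Δ`, the restriction to `U_Δ` of the free graded module
`k[z₁, …, zₙ](p)` with `M(p)_q = M_{p + q}`. -/
def lineBundle (p : Fin n → ℤ) : Coh k Δ := ⟨lineBundlePresheaf k Δ p,
  isCoherent_lineBundlePresheaf Δ p⟩

end LineBundle

/-! ### The bounded derived category and exceptional collections -/

section Derived

open DerivedCategory.TStructure

/-- The bounded derived category `Dᵇ(A)`: the full triangulated subcategory of the derived category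
of `A` of the objects with bounded cohomology. -/
abbrev BoundedDerived (A : Type*) [Category A] [Abelian A] [HasDerivedCategory.{w} A] : Type _ :=
  (t : Triangulated.TStructure (DerivedCategory A)).bounded.FullSubcategory

/-- An object of `A`, as a complex concentrated in degree `0`. -/
def BoundedDerived.single {A : Type*} [Category A] [Abelian A] [HasDerivedCategory.{w} A]
    (X : A) : BoundedDerived.{w} A :=
  ⟨(DerivedCategory.singleFunctor A 0).obj X,
    ⟨0, inferInstanceAs (((DerivedCategory.singleFunctor A 0).obj X).IsGE 0)⟩,
    ⟨0, inferInstanceAs (((DerivedCategory.singleFunctor A 0).obj X).IsLE 0)⟩⟩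

variable (k : Type*) [Field k] {D : Type*} [Category D] [Preadditive D] [HasZeroObject D]
  [HasShift D ℤ] [∀ n : ℤ, (shiftFunctor D n).Additive] [Pretriangulated D] [Linear k D]
  {ι : Type*}

/-- The family `E` of objects of a `k`-linear triangulated category, ordered by the strict total
order `prec`, is an exceptional collection: each `E i` is exceptional, and there are no nonzero
morphisms from later objects to shifts of earlier ones. -/
structure IsExceptionalCollection (prec : ι → ι → Prop) (E : ι → D) : Prop where
  strictTotalOrder : IsStrictTotalOrder ι prec
  end_eq : ∀ i, Function.Bijective (fun c : k => c • 𝟙 (E i))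
  ext_self : ∀ (i : ι) (s : ℤ), s ≠ 0 → ∀ f : E i ⟶ (E i)⟦s⟧, f = 0
  ext_eq_zero : ∀ i j : ι, prec i j → ∀ (s : ℤ) (f : E j ⟶ (E i)⟦s⟧), f = 0

/-- The family `E` is full: the smallest strictly full triangulated subcategory containing all the
`E i` is the whole category. -/
def IsFullCollection (E : ι → D) : Prop :=
  ∀ P : ObjectProperty D, P.IsTriangulated → P.IsClosedUnderIsomorphisms →
    (∀ i, P (E i)) → ∀ X, P X

end Derived

/-! ### The collection on `𝔸³` without the coordinate axes -/

section Collection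

/-- The simplicial complex `{∅, {1}, {2}, {3}}` on three vertices. -/
def threePoints : LowerSet (Finset (Fin 3)) where
  carrier := {σ | σ.card ≤ 1}
  lower' _ _ h hσ := (Finset.card_le_card h).trans hσ

/-- The open set `U_Δ` of this complex, i.e. the set of the points whose vanishing coordinates form
a face, is the complement of the union of the sets `{z i = z j = 0}` for `i ≠ j`. -/
lemma zeros_mem_threePoints {K : Type*} [Field K] [DecidableEq K] (z : Fin 3 → K) :
    (Finset.univ.filter fun i => z i = 0) ∈ threePoints ↔ ¬ ∃ i j, i ≠ j ∧ z i = 0 ∧ z j = 0 := by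
  change Finset.card _ ≤ 1 ↔ _
  rw [Finset.card_le_one]
  simp only [Finset.mem_filter, Finset.mem_univ, true_and]
  push Not
  exact ⟨fun h i j hij hi hj => hij (h i hi j hj), fun h i hi j hj => by
    by_contra hij
    exact h i j hij hi hj⟩

/-- The four consecutive blocks of the collection. -/
def block : Fin 4 → Set (Fin 3 → ℤ)
  | 0 => {p | ∃ m : ℤ, 0 ≤ m ∧ p = ![0, 0, m]}
  | 1 => {p | ∃ a : ℤ, a ≠ 0 ∧ p = ![a, -a, 0]}
  | 2 => {p | ∃ a : ℤ, a ≠ 1 ∧ p = ![a, 1 - a, 0]}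
  | 3 => {p | ∃ m : ℤ, 0 ≤ m ∧ p = ![1, 0, -m]}

/-- The set of twists in the collection. -/
abbrev Twists : Type := {p : Fin 3 → ℤ // ∃ b, p ∈ block b}

/-- The admissible orders of the collection: a strict total order in which the blocks come one
after another, the first block is ordered by increasing `m`, the last one by decreasing `m`, and
the two middle blocks are ordered arbitrarily. -/
structure IsAdmissibleOrder (prec : Twists → Twists → Prop) : Prop where
  strictTotalOrder : IsStrictTotalOrder Twists prec
  blocks : ∀ b c : Fin 4, b < c → ∀ p q : Twists, p.1 ∈ block b → q.1 ∈ block c → prec p q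
  first : ∀ l m : ℤ, 0 ≤ l → l < m → ∀ p q : Twists,
    p.1 = ![0, 0, l] → q.1 = ![0, 0, m] → prec p q
  last : ∀ l m : ℤ, 0 ≤ m → m < l → ∀ p q : Twists,
    p.1 = ![1, 0, -l] → q.1 = ![1, 0, -m] → prec p q

/-- Admissible orders exist. -/
lemma exists_isAdmissibleOrder : ∃ prec : Twists → Twists → Prop, IsAdmissibleOrder prec := by
  let key : Twists → ℕ ×ₗ ℤ := fun p => toLex
    (if p.1 0 + p.1 1 = 0 then (if p.1 0 = 0 then 0 else 1)
      else (if p.1 1 = 0 then 3 else 2), p.1 0 + p.1 2)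
  have h0 : ∀ p : Twists, p.1 ∈ block 0 → key p = toLex (0, p.1 2) := by
    rintro ⟨p, hp⟩ ⟨m, hm, rfl⟩
    simp [key]
  have h1 : ∀ p : Twists, p.1 ∈ block 1 → key p = toLex (1, p.1 0) := by
    rintro ⟨p, hp⟩ ⟨m, hm, rfl⟩
    simp [key, hm]
  have h2 : ∀ p : Twists, p.1 ∈ block 2 → key p = toLex (2, p.1 0) := by
    rintro ⟨p, hp⟩ ⟨m, hm, rfl⟩
    simp [key, sub_eq_zero, hm.symm]
  have h3 : ∀ p : Twists, p.1 ∈ block 3 → key p = toLex (3, 1 + p.1 2) := by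
    rintro ⟨p, hp⟩ ⟨m, hm, rfl⟩
    simp [key]
  have hb : ∀ (b : Fin 4) (p : Twists), p.1 ∈ block b → ∃ z, key p = toLex (b.val, z) := by
    intro b p hp
    fin_cases b
    exacts [⟨_, h0 p hp⟩, ⟨_, h1 p hp⟩, ⟨_, h2 p hp⟩, ⟨_, h3 p hp⟩]
  have hinj : Function.Injective key := by
    rintro ⟨p, b, hp⟩ ⟨q, c, hq⟩ h
    obtain ⟨y, hy⟩ := hb b ⟨p, b, hp⟩ hp
    obtain ⟨z, hz⟩ := hb c ⟨q, c, hq⟩ hq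
    have hbc : b = c := Fin.ext (congrArg (fun t => (ofLex t).1) (hy.symm.trans (h.trans hz)))
    subst hbc
    apply Subtype.ext
    fin_cases b
    · have := congrArg (fun t => (ofLex t).2) ((h0 ⟨p, _, hp⟩ hp).symm.trans (h.trans (h0 ⟨q, _, hq⟩ hq)))
      obtain ⟨l, _, rfl⟩ := hp
      obtain ⟨m, _, rfl⟩ := hq
      simpa using this
    · have := congrArg (fun t => (ofLex t).2) ((h1 ⟨p, _, hp⟩ hp).symm.trans (h.trans (h1 ⟨q, _, hq⟩ hq)))
      obtain ⟨l, _, rfl⟩ := hp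
      obtain ⟨m, _, rfl⟩ := hq
      simpa using this
    · have := congrArg (fun t => (ofLex t).2) ((h2 ⟨p, _, hp⟩ hp).symm.trans (h.trans (h2 ⟨q, _, hq⟩ hq)))
      obtain ⟨l, _, rfl⟩ := hp
      obtain ⟨m, _, rfl⟩ := hq
      simpa using this
    · have := congrArg (fun t => (ofLex t).2) ((h3 ⟨p, _, hp⟩ hp).symm.trans (h.trans (h3 ⟨q, _, hq⟩ hq)))
      obtain ⟨l, _, rfl⟩ := hp
      obtain ⟨m, _, rfl⟩ := hq
      simpa using this
  refine ⟨fun p q => key p < key q,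
    { irrefl := fun p => lt_irrefl _, trans := fun p q r => lt_trans
      trichotomous := fun p q h h' => hinj (le_antisymm (not_lt.1 h') (not_lt.1 h)) },
    fun b c hbc p q hp hq => ?_, fun l m hl hlm p q hp hq => ?_, fun l m hm hlm p q hp hq => ?_⟩
  · obtain ⟨y, hy⟩ := hb b p hp
    obtain ⟨z, hz⟩ := hb c q hq
    rw [hy, hz, Prod.Lex.toLex_lt_toLex]
    exact .inl hbc
  · rw [h0 p ⟨l, hl, hp⟩, h0 q ⟨m, by omega, hq⟩, Prod.Lex.toLex_lt_toLex, hp, hq]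
    exact .inr ⟨rfl, by simpa using hlm⟩
  · rw [h3 p ⟨l, by omega, hp⟩, h3 q ⟨m, hm, hq⟩, Prod.Lex.toLex_lt_toLex, hp, hq]
    exact .inr ⟨rfl, by simp; omega⟩

end Collection

end

/-! Everything rests on the fact that each chart `U_i` has a single noninvertible coordinate `z_i`,
and that the charts meet in the open orbit.

Morphisms: a map `𝒪(p) ⟶ 𝒪(q)` is a scalar times the monomial `z^(q-p)`, and is zero unless `p ≤ q`
(`hom_eq_zero`, `exists_smul_mul_eq`). For any `a`, `b` there is a Mayer–Vietoris sequence `0 ⟶ 𝒪(a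
⊓ b) ⟶ 𝒪(a) ⊞ 𝒪(b) ⟶ 𝒪(a ⊔ b) ⟶ 0` (`shortExact_mul`). It is exact on the right because over `U_i`
one of `a i`, `b i` is the maximum.

Extensions: a class of positive degree on `𝒪(p)` dies on some epimorphism `Z ⟶ 𝒪(p)`. Lifting the
generator of `𝒪(p)` to `Z` over `U_i` and clearing poles shows that the class dies on `𝒪(r)`, where
`r` is `p` with all coordinates but the `i`-th lowered far enough (`exists_forall_killedBy`). If a
class dies on `𝒪(a)` and `𝒪(b)` with `a ⊔ b = p`, it is the Mayer–Vietoris class composed with a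
class `β` on `𝒪(a ⊓ b)` of degree one less. If `β` still has positive degree, lowering `a` and `b`
further without changing their supremum kills it, so `Ext` from a line bundle vanishes in degrees at
least 2. If `β` is a morphism to `𝒪(q)`, it is a multiple of a monomial; when at most one coordinate
of `q - p` is negative, it is zero or factors through `𝒪(a)` or `𝒪(b)`, so `Ext¹` vanishes. For `q ≺
p` in the collection exactly one coordinate of `q - p` is negative
(`IsAdmissibleOrder.exactlyOneLT`): this one kills `Hom`, and the other two kill `Ext¹`.

Fullness: it suffices to treat classes of coherent sheaves with two-out-of-three for short exact
sequences. The Mayer–Vietoris squares identify cokernels of parallel monomials, so changing one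
coordinate from `x` to `y` is allowed everywhere once it is allowed somewhere
(`lineBundle_update_of_update`). From the collection this reaches all line bundles. Finally, a
coherent sheaf is covered by finitely many line bundles, and the kernel of a map from a line bundle
is zero or again a line bundle (`mono_or_kernel_iso`), so induction on the number of line bundles in
the cover finishes. -/

noncomputable section

/-! ### Effaceability of extension classes. -/

section DerivedGeneralities

open Abelian DerivedCategory

universe v' u'

variable {A : Type u'} [Category.{v'} A] [Abelian A]

/-- A morphism of complexes to a single complex that is an isomorphism on homology is epi
on cycles. -/
lemma epi_iCycles_comp_of_quasiIso {K : CochainComplex A ℤ} {X : A}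
    (s : K ⟶ (HomologicalComplex.single A (ComplexShape.up ℤ) 0).obj X) [QuasiIso s] :
    Epi (K.iCycles 0 ≫ s.f 0) := by
  have h1 : ((HomologicalComplex.single A (ComplexShape.up ℤ) 0).obj X).d 0 1 = 0 :=
    HomologicalComplex.single_obj_d _ _ _ _ _
  have h2 : ((HomologicalComplex.single A (ComplexShape.up ℤ) 0).obj X).d (-1) 0 = 0 :=
    HomologicalComplex.single_obj_d _ _ _ _ _
  have : IsIso (((HomologicalComplex.single A (ComplexShape.up ℤ) 0).obj X).iCycles 0) :=
    HomologicalComplex.isIso_iCycles _ 0 1 (by simp) h1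
  have : IsIso (((HomologicalComplex.single A (ComplexShape.up ℤ) 0).obj X).homologyπ 0) :=
    HomologicalComplex.isIso_homologyπ _ (-1) 0 (by simp) h2
  -- By naturality this composite is the projection from the cycles of `K` to homology followed by
  -- the isomorphism that `s` induces.
  have h3 : Epi (HomologicalComplex.cyclesMap s 0 ≫
      ((HomologicalComplex.single A (ComplexShape.up ℤ) 0).obj X).homologyπ 0) := by
    rw [← HomologicalComplex.homologyπ_naturality]
    infer_instance
  have h4 : Epi (HomologicalComplex.cyclesMap s 0) := by
    have := epi_comp (HomologicalComplex.cyclesMap s 0 ≫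
      ((HomologicalComplex.single A (ComplexShape.up ℤ) 0).obj X).homologyπ 0)
      (inv (((HomologicalComplex.single A (ComplexShape.up ℤ) 0).obj X).homologyπ 0))
    simpa using this
  rw [← HomologicalComplex.cyclesMap_i]
  infer_instance

/-- A morphism in the derived category from an object of the heart to a complex that vanishes in
degree zero becomes zero on a suitable cover. -/
lemma exists_epi_Q_map_comp_eq_zero [HasDerivedCategory.{w} A] {X : A} {T : CochainComplex A ℤ}
    (hT : IsZero (T.X 0)) (f : Q.obj ((HomologicalComplex.single A (ComplexShape.up ℤ) 0).obj X) ⟶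
      Q.obj T) :
    ∃ (Z : A) (g : Z ⟶ X) (_ : Epi g),
      Q.map ((HomologicalComplex.single A (ComplexShape.up ℤ) 0).map g) ≫ f = 0 := by
  obtain ⟨K, s, hs, g, rfl⟩ := right_fac f
  have : QuasiIso s := (isIso_Q_map_iff_quasiIso A s).1 hs
  -- Here `f` is the inverse of `s` followed by `g`. The cover is the object of `0`-cycles of `K`:
  -- it maps onto `X` through `s`, and `g` vanishes on it because `T` has nothing in degree zero.
  let φ : (HomologicalComplex.single A (ComplexShape.up ℤ) 0).obj (K.cycles 0) ⟶ K :=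
    HomologicalComplex.mkHomFromSingle (K.iCycles 0) (fun i _ => by simp)
  obtain ⟨u, hu⟩ := (HomologicalComplex.single A (ComplexShape.up ℤ) 0).map_surjective (φ ≫ s)
  have hφg : φ ≫ g = 0 := HomologicalComplex.from_single_hom_ext (hT.eq_of_tgt _ _)
  refine ⟨K.cycles 0, u, ?_, ?_⟩
  · have h0 : φ.f 0 = (HomologicalComplex.singleObjXSelf (ComplexShape.up ℤ) 0 (K.cycles 0)).hom ≫
      K.iCycles 0 := HomologicalComplex.mkHomFromSingle_f _ _
    have h1 : ((HomologicalComplex.single A (ComplexShape.up ℤ) 0).map u).f 0 =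
        (HomologicalComplex.singleObjXSelf (ComplexShape.up ℤ) 0 (K.cycles 0)).hom ≫
        (K.iCycles 0 ≫ s.f 0) := by
      rw [hu, HomologicalComplex.comp_f, h0, Category.assoc]
    have h2 := epi_iCycles_comp_of_quasiIso s
    have h3 : u = (HomologicalComplex.singleObjXSelf (ComplexShape.up ℤ) 0 _).inv ≫
        ((HomologicalComplex.singleObjXSelf (ComplexShape.up ℤ) 0 (K.cycles 0)).hom ≫
        (K.iCycles 0 ≫ s.f 0)) ≫
        (HomologicalComplex.singleObjXSelf (ComplexShape.up ℤ) 0 _).hom := by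
      rw [← h1, HomologicalComplex.single_map_f_self]
      simp
    have h4 := epi_comp' h2 (inferInstance :
      Epi (HomologicalComplex.singleObjXSelf (ComplexShape.up ℤ) 0 X).hom)
    have h5 : u = (K.iCycles 0 ≫ s.f 0) ≫
        (HomologicalComplex.singleObjXSelf (ComplexShape.up ℤ) 0 X).hom := by
      rw [h3]
      simp
    rw [h5]
    exact h4
  · rw [hu, Functor.map_comp, Category.assoc, IsIso.hom_inv_id_assoc, ← Functor.map_comp, hφg,
      Functor.map_zero]

/-- Extension classes of positive degree are effaceable. -/
lemma Ext.exists_epi_comp_eq_zero [HasExt.{w} A] {X Y : A} {n : ℕ} (α : Ext.{w} X Y (n + 1)) :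
    ∃ (Z : A) (g : Z ⟶ X) (_ : Epi g), (Ext.mk₀ g).comp α (zero_add _) = 0 := by
  let := HasDerivedCategory.standard A
  let sY := (HomologicalComplex.single A (ComplexShape.up ℤ) 0).obj Y
  -- The shift of `Y` by `n + 1` sits in degree `-(n + 1)`, which is not zero.
  have hT : IsZero ((sY⟦((n + 1 : ℕ) : ℤ)⟧).X 0) :=
    (HomologicalComplex.isZero_single_obj_X (ComplexShape.up ℤ) 0 Y ((n + 1 : ℕ) : ℤ)
      (by omega)).of_iso (CochainComplex.shiftFunctorObjXIso sY _ _ _ (by simp))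
  let e := (Q.commShiftIso ((n + 1 : ℕ) : ℤ)).app sY
  obtain ⟨Z, g, hg, h⟩ := exists_epi_Q_map_comp_eq_zero hT (X := X) (α.hom ≫ e.inv)
  refine ⟨Z, g, hg, ?_⟩
  ext
  rw [Ext.comp_hom, Ext.mk₀_hom, ShiftedHom.mk₀_comp, Ext.zero_hom]
  have h' := congrArg (fun t => t ≫ e.hom) h
  refine Eq.trans (Eq.symm ?_) (h'.trans zero_comp)
  refine (Category.assoc _ _ _).trans (congrArg (fun t => _ ≫ t) ?_)
  exact (Category.assoc _ _ _).trans ((congrArg (fun t => _ ≫ t) e.inv_hom_id).trans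
    (Category.comp_id _))

end DerivedGeneralities

/-! ### From an abelian category to its bounded derived category. -/

section BoundedDerivedGeneralities

open Abelian DerivedCategory DerivedCategory.TStructure Pretriangulated

universe v' u'

variable {A : Type u'} [Category.{v'} A] [Abelian A] [HasDerivedCategory.{w} A]

/-- Morphisms in `Dᵇ(A)` between shifts of objects of `A` vanish if they do so in `D(A)`. -/
lemma BoundedDerived.hom_shift_eq_zero {X Y : A} {s : ℤ}
    (h : ∀ g : (singleFunctor A 0).obj X ⟶ ((singleFunctor A 0).obj Y)⟦s⟧, g = 0)
    (f : BoundedDerived.single.{w} X ⟶ (BoundedDerived.single.{w} Y)⟦s⟧) : f = 0 := by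
  let ι := (t : Triangulated.TStructure (DerivedCategory A)).bounded.ι
  apply ι.map_injective
  rw [← cancel_mono ((ι.commShiftIso s).hom.app (BoundedDerived.single Y)), Functor.map_zero,
    zero_comp]
  exact h _

/-- The shifted `Y` lives in degree `-s > 0` and `X` in degree `0`, so the t-structure forbids
nonzero maps. -/
lemma hom_shift_neg_eq_zero {X Y : A} {s : ℤ} (hs : s < 0)
    (g : (singleFunctor A 0).obj X ⟶ ((singleFunctor A 0).obj Y)⟦s⟧) : g = 0 := by
  have : (t : Triangulated.TStructure (DerivedCategory A)).IsGE
    (((singleFunctor A 0).obj Y)⟦s⟧) (-s) := t.isGE_shift _ 0 s (-s)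
  exact t.zero_of_isLE_of_isGE g 0 (-s) (by omega) inferInstance inferInstance

lemma hom_shift_natCast_eq_zero [HasExt.{w} A] {X Y : A} (n : ℕ)
    (h : ∀ α : Ext.{w} X Y n, α = 0)
    (g : (singleFunctor A 0).obj X ⟶ ((singleFunctor A 0).obj Y)⟦(n : ℤ)⟧) : g = 0 := by
  obtain ⟨α, rfl⟩ := (Ext.homEquiv (X := X) (Y := Y) (n := n)).surjective g
  rw [h α]
  exact Ext.zero_hom _ _ _

/-- The vanishing of the morphisms between shifts in `Dᵇ(A)` follows from that of `Ext`. -/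
lemma BoundedDerived.hom_shift_eq_zero_of_ext [HasExt.{w} A] {X Y : A} {s : ℤ}
    (h : ∀ n : ℕ, (n : ℤ) = s → ∀ α : Ext.{w} X Y n, α = 0)
    (f : BoundedDerived.single.{w} X ⟶ (BoundedDerived.single.{w} Y)⟦s⟧) : f = 0 := by
  refine BoundedDerived.hom_shift_eq_zero (fun g => ?_) f
  rcases lt_or_ge s 0 with hs | hs
  · exact hom_shift_neg_eq_zero hs g
  · obtain ⟨n, rfl⟩ := Int.eq_ofNat_of_zero_le hs
    exact hom_shift_natCast_eq_zero n (h n rfl) g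

/-- Both `A ⟶ D(A)` and `Dᵇ(A) ⟶ D(A)` are linear and fully faithful. -/
lemma BoundedDerived.end_bijective {k : Type*} [Field k] [Linear k A] {X : A}
    (h : Function.Bijective (fun c : k => c • 𝟙 X)) :
    Function.Bijective (fun c : k => c • 𝟙 (BoundedDerived.single.{w} X)) := by
  let ι := (t : Triangulated.TStructure (DerivedCategory A)).bounded.ι
  have key : ∀ c : k, ι.map (c • 𝟙 (BoundedDerived.single.{w} X)) =
      (singleFunctor A 0).map (c • 𝟙 X) := fun c => by
    rw [Functor.map_smul, Functor.map_smul]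
    exact congrArg (c • ·) (((singleFunctor A 0).map_id X).symm)
  constructor
  · intro a b hab
    apply h.1
    apply (singleFunctor A 0).map_injective
    dsimp only at hab ⊢
    rw [← key, ← key, hab]
  · intro f
    obtain ⟨g, hg⟩ := (singleFunctor A 0).map_surjective (ι.map f)
    obtain ⟨c, rfl⟩ := h.2 g
    exact ⟨c, ι.map_injective ((key c).trans hg)⟩

/-- A strictly full triangulated subcategory of `D(A)` containing `A` contains `Dᵇ(A)`. -/
lemma prop_of_bounded (R : ObjectProperty (DerivedCategory A)) [R.IsTriangulated]
    [R.IsClosedUnderIsomorphisms] (hR : ∀ X : A, R ((singleFunctor A 0).obj X))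
    (X : DerivedCategory A) (hX : (t : Triangulated.TStructure (DerivedCategory A)).bounded X) :
    R X := by
  -- Induction on the length of the interval `[a, a + n]` that carries the cohomology, splitting off
  -- the lowest degree by truncation.
  have key : ∀ (n : ℕ) (a : ℤ) (X : DerivedCategory A) [X.IsGE a] [X.IsLE (a + n)], R X := by
    intro n
    induction n with
    | zero =>
      intro a X _ h
      have : X.IsLE a := by simpa using h
      obtain ⟨Y, ⟨e⟩⟩ := exists_iso_singleFunctor_obj_of_isGE_of_isLE X a
      exact R.prop_of_iso (((singleFunctors A).shiftIso (-a) a 0 (by simp)).app Y ≪≫ e.symm)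
        (R.le_shift (-a) _ (hR Y))
    | succ n ih =>
      intro a X _ hX
      obtain ⟨Y, Z, hY, hZ, f, g, h, hT⟩ := t.exists_triangle X a (a + 1) rfl
      have hY' : t.IsLE Y a := ⟨hY⟩
      have hZ' : t.IsGE Z (a + 1) := ⟨hZ⟩
      -- Rotating the truncation triangle exhibits `Y` between a shift of `Z` and `X`, and `Z`
      -- between `X` and a shift of `Y`; this gives the two bounds that truncation does not provide
      -- by itself.
      have h1 : t.IsGE Y a := by
        refine t.isGE₂ _ (inv_rot_of_distTriang _ hT) a ?_ ‹_›
        have : t.IsGE (Z⟦(-1 : ℤ)⟧) (a + 2) := t.isGE_shift Z (a + 1) (-1) (a + 2)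
        exact t.isGE_of_ge (Z⟦(-1 : ℤ)⟧) a (a + 2)
      have h2 : t.IsLE Z (a + 1 + n) := by
        refine t.isLE₂ _ (rot_of_distTriang _ hT) (a + 1 + n) ?_ ?_
        · have : t.IsLE X (a + ((n + 1 : ℕ) : ℤ)) := hX
          exact t.isLE_of_le X (a + ((n + 1 : ℕ) : ℤ)) _ (by push_cast; omega)
        · have : t.IsLE (Y⟦(1 : ℤ)⟧) (a - 1) := t.isLE_shift Y a 1 (a - 1)
          exact t.isLE_of_le (Y⟦(1 : ℤ)⟧) (a - 1) _
      have h3 : t.IsLE Y (a + n) := t.isLE_of_le Y a _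
      exact R.ext_of_isTriangulatedClosed₂ _ hT (ih a Y) (ih (a + 1) Z)
  obtain ⟨⟨a, ha⟩, b, hb⟩ := hX
  -- For `b < a` the natural number `(b - a).toNat` is `0`, and `a` is still an upper bound.
  have : t.IsLE X (a + (b - a).toNat) := t.isLE_of_le X b _
  exact key (b - a).toNat a X

/-- A property of objects of an abelian category that satisfies two-out-of-three for short exact
sequences. -/
structure IsTwoOutOfThree (R : ObjectProperty A) : Prop where
  zero : ∀ X, IsZero X → R X
  iso : ∀ X Y, (X ≅ Y) → R X → R Y
  left : ∀ S : ShortComplex A, S.ShortExact → R S.X₂ → R S.X₃ → R S.X₁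
  middle : ∀ S : ShortComplex A, S.ShortExact → R S.X₁ → R S.X₃ → R S.X₂
  right : ∀ S : ShortComplex A, S.ShortExact → R S.X₁ → R S.X₂ → R S.X₃

/-- A short exact sequence becomes a distinguished triangle, and a triangulated subcategory contains
the third vertex of a triangle as soon as it contains two. -/
lemma isTwoOutOfThree_inverseImage (R : ObjectProperty (DerivedCategory A)) [R.IsTriangulated]
    [R.IsClosedUnderIsomorphisms] : IsTwoOutOfThree (R.inverseImage (singleFunctor A 0)) where
  zero _ hX := R.prop_of_isZero ((singleFunctor A 0).map_isZero hX)
  iso _ _ e h := R.prop_of_iso ((singleFunctor A 0).mapIso e) h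
  left _ hS h₂ h₃ := R.ext_of_isTriangulatedClosed₁ _ hS.singleTriangle_distinguished h₂ h₃
  middle _ hS h₁ h₃ := R.ext_of_isTriangulatedClosed₂ _ hS.singleTriangle_distinguished h₁ h₃
  right _ hS h₁ h₂ := R.ext_of_isTriangulatedClosed₃ _ hS.singleTriangle_distinguished h₁ h₂

/-- A family of objects of `A` is full in `Dᵇ(A)` if every two-out-of-three class of objects
of `A` that contains it is all of `A`. -/
lemma isFullCollection_of_isTwoOutOfThree {ι : Type*} (E : ι → A)
    (h : ∀ R : ObjectProperty A, IsTwoOutOfThree R → (∀ i, R (E i)) → ∀ X, R X) :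
    IsFullCollection (fun i => BoundedDerived.single.{w} (E i)) := by
  intro P _ _ hE X
  let B := (t : Triangulated.TStructure (DerivedCategory A)).bounded
  -- The closure under isomorphisms of the image of `P` in `D(A)`; full faithfulness of `B.ι` brings
  -- the conclusion back to `P`.
  let R := P.map B.ι
  have hR : ∀ Y, R ((singleFunctor A 0).obj Y) :=
    h _ (isTwoOutOfThree_inverseImage R) (fun i => ⟨_, hE i, ⟨Iso.refl _⟩⟩)
  obtain ⟨Y, hY, ⟨e⟩⟩ := prop_of_bounded R hR X.1 X.2
  exact P.prop_of_iso (B.ι.preimageIso e) hY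

end BoundedDerivedGeneralities

/-! ### Coherent sheaves through their sections on the charts. -/

section CohSections

variable {k : Type u} [Field k] {n : ℕ} {Δ : LowerSet (Finset (Fin n))}

namespace Coh

/-- The graded module of sections of a coherent sheaf over `U_σ`. -/
abbrev sec (F : Coh k Δ) (σ : Faces Δ) : GrMod k n := F.obj.obj (.op σ)

/-- The map on sections over `U_σ` given by a morphism of coherent sheaves. -/
abbrev app {F G : Coh k Δ} (f : F ⟶ G) (σ : Faces Δ) : F.sec σ →ₗ[PolyRing k n] G.sec σ :=
  GrMod.Hom.lin (f.hom.app (.op σ))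

/-- The restriction maps of a coherent sheaf. -/
abbrev res (F : Coh k Δ) {τ σ : Faces Δ} (h : τ ≤ σ) : F.sec σ →ₗ[PolyRing k n] F.sec τ :=
  F.obj.res h

lemma hom_ext {F G : Coh k Δ} {f g : F ⟶ G} (h : ∀ σ x, app f σ x = app g σ x) : f = g := by
  apply ObjectProperty.hom_ext
  ext σ : 2
  exact GrMod.hom_ext' fun x => h σ.unop x

lemma app_comp {F G H : Coh k Δ} (f : F ⟶ G) (g : G ⟶ H) (σ : Faces Δ) (x : F.sec σ) :
    app (f ≫ g) σ x = app g σ (app f σ x) := rfl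

lemma app_id {F : Coh k Δ} (σ : Faces Δ) (x : F.sec σ) : app (𝟙 F) σ x = x := rfl

lemma app_smul {F G : Coh k Δ} (c : k) (f : F ⟶ G) (σ : Faces Δ) (x : F.sec σ) :
    app (c • f) σ x = (MvPolynomial.C c : PolyRing k n) • app f σ x := rfl

lemma app_res {F G : Coh k Δ} (f : F ⟶ G) {τ σ : Faces Δ} (h : τ ≤ σ) (x : F.sec σ) :
    app f τ (F.res h x) = G.res h (app f σ x) :=
  lin_naturality f.hom h x

lemma app_mem {F G : Coh k Δ} (f : F ⟶ G) (σ : Faces Δ) {q : Fin n → ℤ} {x : F.sec σ}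
    (hx : x ∈ (F.sec σ).piece q) : app f σ x ∈ (G.sec σ).piece q :=
  GrMod.Hom.map_mem _ q x hx

lemma res_mem (F : Coh k Δ) {τ σ : Faces Δ} (h : τ ≤ σ) {q : Fin n → ℤ} {x : F.sec σ}
    (hx : x ∈ (F.sec σ).piece q) : F.res h x ∈ (F.sec τ).piece q :=
  GrMod.Hom.map_mem _ q x hx

lemma res_refl (F : Coh k Δ) {σ : Faces Δ} (h : σ ≤ σ) (x : F.sec σ) : F.res h x = x := by
  have : F.obj.map (homOfLE h).op = 𝟙 _ := F.obj.map_id (.op σ)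
  exact LinearMap.congr_fun (congrArg GrMod.Hom.lin this) x

/-- A morphism of coherent sheaves from degree preserving maps on sections that are compatible
with restriction. -/
def mkHom {F G : Coh k Δ} (φ : ∀ σ, F.sec σ →ₗ[PolyRing k n] G.sec σ)
    (hφ : ∀ σ q x, x ∈ (F.sec σ).piece q → φ σ x ∈ (G.sec σ).piece q)
    (h : ∀ (τ σ : Faces Δ) (h : τ ≤ σ) (x : F.sec σ), φ τ (F.res h x) = G.res h (φ σ x)) :
    F ⟶ G :=
  ObjectProperty.homMk
    { app := fun σ => ⟨φ σ.unop, hφ σ.unop⟩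
      naturality := fun σ τ e => GrMod.hom_ext' fun x => h τ.unop σ.unop (leOfHom e.unop) x }

/-- This is quasi-coherence for the pair `σ ≤ σ`. -/
lemma smul_bijective (F : Coh k Δ) (σ : Faces Δ) {s : PolyRing k n} (hs : s ∈ denoms k σ.1) :
    Function.Bijective (fun x : F.sec σ => s • x) :=
  have := F.property.1 σ σ le_rfl
  loc_bij (F.res le_rfl) hs

lemma mono_of_injective {F G : Coh k Δ} (f : F ⟶ G) (hf : ∀ σ, Function.Injective (app f σ)) :
    Mono f :=
  ⟨fun _ _ e => hom_ext fun σ x => hf σ (congrArg (fun t => app t σ x) e)⟩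

/-- Epimorphisms of coherent sheaves are surjective on sections over the members of the affine
cover. -/
lemma surjective_of_epi {F G : Coh k Δ} (f : F ⟶ G) [Epi f] (σ : Faces Δ) :
    Function.Surjective (app f σ) := by
  -- The cokernel in presheaves is coherent, so it receives the zero map from `G` when `f` is epi
  -- among coherent sheaves; and it is computed chart by chart.
  let c : CokernelCofork f.hom := CokernelCofork.ofπ (cokernel.π f.hom) (cokernel.condition f.hom)
  have hc : IsColimit c := cokernelIsCokernel f.hom
  have hQ : IsCoherent k Δ c.pt :=
    (IsCoherent k Δ).prop_of_isColimit_cokernelCofork hc F.property G.property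
  let π : G ⟶ (⟨c.pt, hQ⟩ : Coh k Δ) := ObjectProperty.homMk (cokernel.π f.hom)
  have hπ : π = 0 := by
    rw [← cancel_epi f, comp_zero]
    exact ObjectProperty.hom_ext _ (cokernel.condition f.hom)
  obtain ⟨-, h, -⟩ := cokernelCofork_app f.hom _ hc (.op σ)
  exact fun y => h y (congrArg (fun t => app t σ y) hπ)

/-- Kernels of morphisms of coherent sheaves can be recognized on sections. -/
def isLimitKernelFork {F G H : Coh k Δ} (f : F ⟶ G) (g : G ⟶ H) (w : f ≫ g = 0)
    (hf : ∀ σ, Function.Injective (app f σ))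
    (hfg : ∀ σ y, app g σ y = 0 → ∃ x, app f σ x = y) : IsLimit (KernelFork.ofι f w) := by
  let e := fun σ => LinearEquiv.ofInjective (app f σ) (hf σ)
  have hm : ∀ {T : Coh k Δ} (u : T ⟶ G) (_ : u ≫ g = 0) σ x,
      app u σ x ∈ LinearMap.range (app f σ) := fun u hu σ x =>
    hfg σ _ (congrArg (fun t => app t σ x) hu)
  let φ : ∀ {T : Coh k Δ} (u : T ⟶ G) (_ : u ≫ g = 0) σ, T.sec σ →ₗ[PolyRing k n] F.sec σ :=
    fun u hu σ => (e σ).symm.toLinearMap ∘ₗ (app u σ).codRestrict _ (hm u hu σ)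
  have hφ : ∀ {T : Coh k Δ} (u : T ⟶ G) (hu : u ≫ g = 0) σ x,
      app f σ (φ u hu σ x) = app u σ x := fun u hu σ x =>
    congrArg Subtype.val ((e σ).apply_symm_apply _)
  refine KernelFork.IsLimit.ofι _ _
    (fun u hu => mkHom (φ u hu) (fun σ q x hx => ?_) (fun τ σ h x => hf τ ?_))
    (fun u hu => hom_ext fun σ x => hφ u hu σ x)
    (fun u hu m hm => hom_ext fun σ x => hf σ ((congrArg (fun t => app t σ x) hm).trans
      (hφ u hu σ x).symm))
  · exact GrMod.piece_of_injective (f.hom.app (.op σ)) (hf σ) q _ (by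
      have := app_mem u σ hx
      rwa [← hφ u hu σ x] at this)
  · rw [hφ u hu, app_res, app_res, hφ u hu]

end Coh

end CohSections

/-! ### Homogeneous components and monomial denominators. -/

section GradedModules

variable {k : Type u} [Field k] {n : ℕ}

namespace GrMod

lemma decomp_of_mem (M : GrMod k n) {q : Fin n → ℤ} {x : M} (hx : x ∈ M.piece q) :
    (M.decomp x q : M) = x := by
  rw [decomp_coe M q ⟨x, hx⟩, DirectSum.of_eq_same]

lemma decomp_of_mem_ne (M : GrMod k n) {q q' : Fin n → ℤ} (hq : q ≠ q') {x : M}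
    (hx : x ∈ M.piece q) : (M.decomp x q' : M) = 0 := by
  rw [decomp_coe M q ⟨x, hx⟩, DirectSum.of_eq_of_ne _ _ _ hq.symm]
  rfl

/-- Multiplication by a homogeneous polynomial shifts homogeneous components. -/
lemma decomp_smul (M : GrMod k n) {b : Fin n → ℤ} {s : PolyRing k n} (hs : s ∈ polyDegree k n b)
    (x : M) (q : Fin n → ℤ) : (M.decomp (s • x) (b + q) : M) = s • (M.decomp x q : M) := by
  have key : ∀ d : DirectSum _ (fun q => M.piece q),
      (M.decomp (s • DirectSum.coeAddMonoidHom M.piece d) (b + q) : M) =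
      s • (M.decomp (DirectSum.coeAddMonoidHom M.piece d) q : M) := by
    intro d
    induction d using DirectSum.induction_on with
    | zero => simp
    | of q' y =>
      rw [DirectSum.coeAddMonoidHom_of]
      by_cases h : q' = q
      · subst h
        rw [decomp_of_mem M y.2, decomp_of_mem M (M.smul_mem _ _ _ _ hs y.2)]
      · rw [decomp_of_mem_ne M h y.2, smul_zero,
          decomp_of_mem_ne M (fun h' => h (add_left_cancel h')) (M.smul_mem _ _ _ _ hs y.2)]
    | add d d' h h' =>
      simp only [map_add, smul_add, DirectSum.add_apply, AddSubgroup.coe_add, h, h']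
  simpa only [coe_decomp] using key (M.decomp x)

/-- An element is homogeneous if a multiple by a homogeneous nonzerodivisor is. -/
lemma mem_piece_of_smul (M : GrMod k n) {b : Fin n → ℤ} {s : PolyRing k n}
    (hs : s ∈ polyDegree k n b) (hinj : Function.Injective (fun x : M => s • x)) {x : M}
    {q : Fin n → ℤ} (hx : s • x ∈ M.piece (b + q)) : x ∈ M.piece q := by
  have h : (M.decomp x q : M) = x := hinj (by
    dsimp only
    rw [← decomp_smul M hs, decomp_of_mem M hx])
  rw [← h]
  exact (M.decomp x q).2

end GrMod

lemma X_mem_polyDegree (i : Fin n) :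
    (MvPolynomial.X i : PolyRing k n) ∈ polyDegree k n (Pi.single i 1) :=
  MvPolynomial.isWeightedHomogeneous_X k _ i

lemma mul_mem_polyDegree {f g : PolyRing k n} {p q : Fin n → ℤ} (hf : f ∈ polyDegree k n p)
    (hg : g ∈ polyDegree k n q) : f * g ∈ polyDegree k n (p + q) :=
  MvPolynomial.IsWeightedHomogeneous.mul hf hg

lemma pow_mem_polyDegree {f : PolyRing k n} {p : Fin n → ℤ} (hf : f ∈ polyDegree k n p) (m : ℕ) :
    f ^ m ∈ polyDegree k n (m • p) :=
  MvPolynomial.IsWeightedHomogeneous.pow hf m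

lemma exists_degree_of_mem_denoms {σ : Finset (Fin n)} {s : PolyRing k n} (hs : s ∈ denoms k σ) :
    ∃ b, s ∈ polyDegree k n b := by
  refine denoms_induction (C := fun s => ∃ b, s ∈ polyDegree k n b) ⟨0, ?_⟩
    (fun i _ => ⟨_, X_mem_polyDegree i⟩) ?_ s hs
  · exact MvPolynomial.isWeightedHomogeneous_one _ _
  · rintro f g ⟨p, hf⟩ ⟨q, hg⟩
    exact ⟨_, mul_mem_polyDegree hf hg⟩

lemma denoms_anti {τ σ : Finset (Fin n)} (h : τ ⊆ σ) : denoms k σ ≤ denoms k τ :=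
  Submonoid.closure_mono fun _ ⟨i, hi, e⟩ => ⟨i, fun h' => hi (h h'), e⟩

lemma X_mem_denoms {σ : Finset (Fin n)} {i : Fin n} (hi : i ∉ σ) :
    (MvPolynomial.X i : PolyRing k n) ∈ denoms k σ :=
  Submonoid.subset_closure ⟨i, hi, rfl⟩

end GradedModules

/-! ### Sections of line bundles and monomial morphisms. -/

section LineBundleHoms

variable {k : Type u} [Field k] {n : ℕ}

lemma weight_single_apply (m : Fin n →₀ ℕ) (i : Fin n) :
    Finsupp.weight (fun i : Fin n => (Pi.single i 1 : Fin n → ℤ)) m i = m i := by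
  rw [Finsupp.weight_apply, Finsupp.sum_fintype _ _ (by simp), Finset.sum_apply]
  simp [Pi.single_apply]

lemma coeff_polyToLaurent (f : PolyRing k n) (m : Fin n →₀ ℕ) :
    (polyToLaurent k n f).coeff
      (Finsupp.weight (fun i : Fin n => (Pi.single i 1 : Fin n → ℤ)) m) = f.coeff m := by
  induction f using MvPolynomial.induction_on' with
  | monomial m' c =>
    rw [polyToLaurent_monomial, AddMonoidAlgebra.coeff_single, MvPolynomial.coeff_monomial]
    by_cases h : m' = m
    · subst h
      simp
    · rw [if_neg h, Finsupp.single_eq_of_ne]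
      intro h'
      apply h
      ext i
      have := congrFun h' i
      rw [weight_single_apply, weight_single_apply] at this
      exact_mod_cast this.symm
  | add f g hf hg => rw [map_add, AddMonoidAlgebra.coeff_add, Finsupp.add_apply, hf, hg,
      MvPolynomial.coeff_add]

lemma polyToLaurent_injective : Function.Injective (polyToLaurent k n) := by
  rw [injective_iff_map_eq_zero]
  intro f hf
  ext m
  rw [← coeff_polyToLaurent, hf]
  simp

/-- A polynomial is homogeneous if the associated Laurent polynomial is. -/
lemma mem_polyDegree_of_supportedIn {f : PolyRing k n} {q : Fin n → ℤ}
    (h : polyToLaurent k n f ∈ supportedIn {q}) : f ∈ polyDegree k n q := fun m hm =>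
  h _ (by rwa [coeff_polyToLaurent])

variable {Δ : LowerSet (Finset (Fin n))}

lemma one_mem_coordModule (σ : Finset (Fin n)) : (1 : Laurent k n) ∈ coordModule k σ := by
  intro a ha i _
  obtain ⟨rfl, -⟩ := single_coeff_ne_zero ha
  exact le_rfl

namespace Coh

/-- The generator of the sections of `𝒪(p)` over `U_σ`. -/
def one (p : Fin n → ℤ) (σ : Faces Δ) : (lineBundle k Δ p).sec σ :=
  (⟨1, one_mem_coordModule σ.1⟩ : coordModule k σ.1)

/-- A section of `𝒪(p)` over `U_σ` as a Laurent polynomial. -/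
def toLaurent {p : Fin n → ℤ} {σ : Faces Δ} (x : (lineBundle k Δ p).sec σ) : Laurent k n :=
  Subtype.val (p := fun x => x ∈ coordModule k σ.1) x

lemma toLaurent_injective {p : Fin n → ℤ} {σ : Faces Δ} :
    Function.Injective (toLaurent : (lineBundle k Δ p).sec σ → Laurent k n) :=
  Subtype.val_injective

lemma toLaurent_smul {p : Fin n → ℤ} {σ : Faces Δ} (f : PolyRing k n)
    (x : (lineBundle k Δ p).sec σ) : toLaurent (f • x) = polyToLaurent k n f * toLaurent x := rfl

lemma toLaurent_res {p : Fin n → ℤ} {τ σ : Faces Δ} (h : τ ≤ σ) (x : (lineBundle k Δ p).sec σ) :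
    toLaurent ((lineBundle k Δ p).res h x) = toLaurent x := rfl

lemma toLaurent_one (p : Fin n → ℤ) (σ : Faces Δ) :
    toLaurent (one p σ : (lineBundle k Δ p).sec σ) = 1 := rfl

lemma toLaurent_mem {p : Fin n → ℤ} {σ : Faces Δ} (x : (lineBundle k Δ p).sec σ) :
    toLaurent x ∈ coordModule k σ.1 := x.2

lemma mem_piece_iff {p : Fin n → ℤ} {σ : Faces Δ} {x : (lineBundle k Δ p).sec σ}
    {q : Fin n → ℤ} : x ∈ ((lineBundle k Δ p).sec σ).piece q ↔
      toLaurent x ∈ supportedIn {p + q} := Iff.rfl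

lemma one_mem (p : Fin n → ℤ) (σ : Faces Δ) :
    one p σ ∈ ((lineBundle k Δ p).sec σ).piece (-p) := by
  rw [mem_piece_iff, add_neg_cancel, toLaurent_one]
  exact fun a ha => (single_coeff_ne_zero ha).1.symm

lemma toLaurent_smul_one (p : Fin n → ℤ) (σ : Faces Δ) (f : PolyRing k n) :
    toLaurent (f • one p σ : (lineBundle k Δ p).sec σ) = polyToLaurent k n f := by
  rw [toLaurent_smul, toLaurent_one, mul_one]

lemma res_one (p : Fin n → ℤ) {τ σ : Faces Δ} (h : τ ≤ σ) :
    (lineBundle k Δ p).res h (one p σ) = one p τ := rfl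

/-- Every section of a line bundle over `U_σ` is a fraction. -/
lemma exists_smul_eq_smul_one {p : Fin n → ℤ} {σ : Faces Δ} (x : (lineBundle k Δ p).sec σ) :
    ∃ s ∈ denoms k σ.1, ∃ f : PolyRing k n, s • x = f • one p σ := by
  obtain ⟨s, hs, h⟩ := exists_denom_smul_mem σ.1 Finset.univ _ (toLaurent_mem x)
  obtain ⟨f, hf⟩ := exists_poly _ h
  refine ⟨s, hs, f, toLaurent_injective ?_⟩
  rw [toLaurent_smul_one, hf]
  rfl

/-- Linear maps from the sections of a line bundle are determined by the image of the generator. -/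
lemma lin_ext_of_one {p : Fin n → ℤ} {σ : Faces Δ} {F : Coh k Δ}
    {φ ψ : (lineBundle k Δ p).sec σ →ₗ[PolyRing k n] F.sec σ} (h : φ (one p σ) = ψ (one p σ)) :
    φ = ψ := by
  ext x
  obtain ⟨s, hs, f, e⟩ := exists_smul_eq_smul_one x
  apply (F.smul_bijective σ hs).1
  dsimp only
  rw [← map_smul, ← map_smul, e, map_smul, map_smul, h]

lemma hom_ext_of_one {p : Fin n → ℤ} {F : Coh k Δ} {f g : lineBundle k Δ p ⟶ F}
    (h : ∀ σ, app f σ (one p σ) = app g σ (one p σ)) : f = g :=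
  hom_ext fun σ x => LinearMap.congr_fun (lin_ext_of_one (h σ)) x

/-- The sections over `U_σ` are a localization of the polynomial ring with `one` as the image of
`1`. The universal property then produces maps out of `𝒪(p)` from the image of the generator. -/
lemma isLocalizedModule_toSpanSingleton_one (p : Fin n → ℤ) (σ : Faces Δ) :
    IsLocalizedModule (denoms k σ.1)
      (LinearMap.toSpanSingleton (PolyRing k n) _ (one p σ : (lineBundle k Δ p).sec σ)) := by
  refine isLocalizedModule_mk' _ _ (fun s hs => (smul_bijective _ σ hs).1)
    (fun s hs => (smul_bijective _ σ hs).2) (fun x => ?_) (fun f hf => ⟨1, Submonoid.one_mem _, ?_⟩)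
  · obtain ⟨s, hs, f, e⟩ := exists_smul_eq_smul_one x
    exact ⟨s, hs, f, by rw [e, LinearMap.toSpanSingleton_apply]⟩
  · rw [one_smul]
    apply polyToLaurent_injective
    rw [LinearMap.toSpanSingleton_apply] at hf
    rw [← toLaurent_smul_one p σ, hf, map_zero]
    rfl

/-- A compatible family of sections of degree `-p` defines a morphism from `𝒪(p)`. -/
lemma exists_hom_of_sections {F : Coh k Δ} {p : Fin n → ℤ} (y : ∀ σ, F.sec σ)
    (hy : ∀ σ, y σ ∈ (F.sec σ).piece (-p))
    (hc : ∀ (τ σ : Faces Δ) (h : τ ≤ σ), F.res h (y σ) = y τ) :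
    ∃ f : lineBundle k Δ p ⟶ F, ∀ σ, app f σ (one p σ) = y σ := by
  have hl := isLocalizedModule_toSpanSingleton_one (k := k) (Δ := Δ) p
  let φ : ∀ σ : Faces Δ, (lineBundle k Δ p).sec σ →ₗ[PolyRing k n] F.sec σ := fun σ =>
    IsLocalizedModule.lift (denoms k σ.1)
      (LinearMap.toSpanSingleton (PolyRing k n) _ (one p σ : (lineBundle k Δ p).sec σ))
      (LinearMap.toSpanSingleton (PolyRing k n) _ (y σ))
      (fun s => (Module.End.isUnit_iff _).2 (F.smul_bijective σ s.2))
  have hφ : ∀ σ, φ σ (one p σ) = y σ := fun σ => by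
    have := IsLocalizedModule.lift_apply (denoms k σ.1)
      (LinearMap.toSpanSingleton (PolyRing k n) _ (one p σ : (lineBundle k Δ p).sec σ))
      (LinearMap.toSpanSingleton (PolyRing k n) _ (y σ))
      (fun s => (Module.End.isUnit_iff _).2 (F.smul_bijective σ s.2)) 1
    simpa [φ] using this
  refine ⟨mkHom φ (fun σ q x hx => ?_) (fun τ σ h x => ?_), hφ⟩
  -- To see that `φ σ` preserves degrees, clear denominators by a homogeneous `s`. Then `f` is
  -- homogeneous of degree `p + b + q`, the generator has degree `-p`, and `s` can be cancelled.
  · obtain ⟨s, hs, f, e⟩ := exists_smul_eq_smul_one x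
    obtain ⟨b, hb⟩ := exists_degree_of_mem_denoms hs
    have h1 : f ∈ polyDegree k n (p + (b + q)) := by
      apply mem_polyDegree_of_supportedIn
      rw [← toLaurent_smul_one p σ, ← e, ← mem_piece_iff]
      exact GrMod.smul_mem _ _ _ _ _ hb hx
    refine GrMod.mem_piece_of_smul _ hb (F.smul_bijective σ hs).1 ?_
    rw [← map_smul, e, map_smul, hφ]
    have := GrMod.smul_mem _ _ _ _ _ h1 (hy σ)
    rwa [show p + (b + q) + -p = b + q by abel] at this
  · obtain ⟨s, hs, f, e⟩ := exists_smul_eq_smul_one x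
    apply (F.smul_bijective τ (denoms_anti h hs)).1
    dsimp only
    rw [← map_smul, ← map_smul, ← map_smul, ← map_smul, e, map_smul, map_smul, map_smul, map_smul,
      hφ, res_one, hφ, hc]

lemma single_mul_mem_coordModule {σ : Finset (Fin n)} {b : Fin n → ℤ} (hb : 0 ≤ b)
    {x : Laurent k n} (hx : x ∈ coordModule k σ) :
    AddMonoidAlgebra.single b 1 * x ∈ coordModule k σ := by
  intro a ha i hi
  rw [AddMonoidAlgebra.coeff_single_mul_apply, one_mul] at ha
  have h1 := hx _ ha i hi
  have h2 := hb i
  simp only [Pi.add_apply, Pi.neg_apply, Pi.zero_apply] at h1 h2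
  omega

/-- Multiplication by the monomial `z ^ (q - p)`, as a morphism `𝒪(p) ⟶ 𝒪(q)`. -/
def mul {p q : Fin n → ℤ} (h : p ≤ q) : lineBundle k Δ p ⟶ lineBundle k Δ q :=
  mkHom (fun σ =>
    { toFun := fun x => (⟨AddMonoidAlgebra.single (q - p) 1 * toLaurent x,
        single_mul_mem_coordModule (sub_nonneg.2 h) (toLaurent_mem x)⟩ : coordModule k σ.1)
      map_add' := fun x y => Subtype.ext (mul_add _ _ _)
      map_smul' := fun f x => Subtype.ext (mul_left_comm _ (polyToLaurent k n f) _) })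
    (fun σ d x hx a ha => by
      have ha' : (AddMonoidAlgebra.single (q - p) 1 * toLaurent x).coeff a ≠ 0 := ha
      rw [AddMonoidAlgebra.coeff_single_mul_apply, one_mul] at ha'
      have := hx _ ha'
      rw [Set.mem_singleton_iff] at this ⊢
      rw [← sub_eq_zero] at this ⊢
      rw [← this]
      abel)
    (fun _ _ _ _ => rfl)

lemma toLaurent_mul {p q : Fin n → ℤ} (h : p ≤ q) (σ : Faces Δ) (x : (lineBundle k Δ p).sec σ) :
    toLaurent (app (mul h) σ x) = AddMonoidAlgebra.single (q - p) 1 * toLaurent x := rfl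

lemma mul_comp_mul {p q r : Fin n → ℤ} (h : p ≤ q) (h' : q ≤ r) :
    (mul h : lineBundle k Δ p ⟶ _) ≫ mul h' = mul (h.trans h') :=
  hom_ext fun σ x => toLaurent_injective (by
    rw [app_comp, toLaurent_mul, toLaurent_mul, toLaurent_mul, ← mul_assoc,
      AddMonoidAlgebra.single_mul_single, mul_one, sub_add_sub_cancel])

lemma mul_refl (p : Fin n → ℤ) : (mul le_rfl : lineBundle k Δ p ⟶ _) = 𝟙 _ :=
  hom_ext fun σ x => toLaurent_injective (by
    rw [toLaurent_mul, sub_self, app_id]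
    exact one_mul _)

lemma mul_injective {p q : Fin n → ℤ} (h : p ≤ q) (σ : Faces Δ) :
    Function.Injective (app (mul h : lineBundle k Δ p ⟶ _) σ) := by
  intro x y hxy
  apply toLaurent_injective
  have h1 := congrArg toLaurent hxy
  rw [toLaurent_mul, toLaurent_mul] at h1
  have h2 := congrArg (fun t => AddMonoidAlgebra.single (-(q - p)) (1 : k) * t) h1
  simpa only [← mul_assoc, AddMonoidAlgebra.single_mul_single, neg_add_cancel, mul_one,
    ← AddMonoidAlgebra.one_def, one_mul] using h2

instance {p q : Fin n → ℤ} (h : p ≤ q) : Mono (mul h : lineBundle k Δ p ⟶ _) :=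
  mono_of_injective _ (mul_injective h)

/-- The range of multiplication by a monomial. -/
lemma exists_mul_eq {p q : Fin n → ℤ} (h : p ≤ q) {σ : Faces Δ} (x : (lineBundle k Δ q).sec σ)
    (hx : ∀ a, (toLaurent x).coeff a ≠ 0 → ∀ i ∈ σ.1, q i - p i ≤ a i) :
    ∃ y, app (mul h) σ y = x := by
  refine ⟨(⟨AddMonoidAlgebra.single (p - q) 1 * toLaurent x, fun a ha i hi => ?_⟩ :
    coordModule k σ.1), toLaurent_injective ?_⟩
  · rw [AddMonoidAlgebra.coeff_single_mul_apply, one_mul] at ha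
    have := hx _ ha i hi
    simp only [Pi.add_apply, Pi.neg_apply, Pi.sub_apply] at this
    omega
  · change AddMonoidAlgebra.single (q - p) 1 * (AddMonoidAlgebra.single (p - q) 1 * toLaurent x) = _
    rw [← mul_assoc, AddMonoidAlgebra.single_mul_single, mul_one, sub_add_sub_cancel, sub_self]
    exact one_mul _

lemma eq_single_of_mem_supportedIn {x : Laurent k n} {b : Fin n → ℤ} (hx : x ∈ supportedIn {b}) :
    x = AddMonoidAlgebra.single b (x.coeff b) := by
  refine AddMonoidAlgebra.ext (Finsupp.ext fun a => ?_)
  by_cases ha : a = b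
  · subst ha
    exact Finsupp.single_eq_same.symm
  · refine Eq.trans ?_ (Finsupp.single_eq_of_ne ha).symm
    by_contra h
    exact ha (hx a h)

end Coh

end LineBundleHoms

/-! ### The three charts and Mayer–Vietoris squares of line bundles. -/

section ThreePoints

variable {k : Type u} [Field k]

/-- The open orbit. -/
def emptyFace : Faces threePoints := ⟨∅, Nat.zero_le _⟩

/-- The chart in which only the `i`-th coordinate may vanish. -/
def pointFace (i : Fin 3) : Faces threePoints := ⟨{i}, (Finset.card_singleton i).le⟩

lemma emptyFace_le (σ : Faces threePoints) : emptyFace ≤ σ := Finset.empty_subset σ.1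

lemma face_cases (σ : Faces threePoints) : σ = emptyFace ∨ ∃ i, σ = pointFace i := by
  rcases Nat.le_one_iff_eq_zero_or_eq_one.1 σ.2 with h | h
  · exact .inl (Subtype.ext (Finset.card_eq_zero.1 h))
  · obtain ⟨i, hi⟩ := Finset.card_eq_one.1 h
    exact .inr ⟨i, Subtype.ext hi⟩

lemma le_cases {τ σ : Faces threePoints} (h : τ ≤ σ) : τ = σ ∨ τ = emptyFace := by
  have h' : τ.1 ⊆ σ.1 := h
  rcases face_cases σ with rfl | ⟨i, rfl⟩
  · exact .inr (Subtype.ext (Finset.subset_empty.1 h'))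
  · rcases Finset.subset_singleton_iff.1 h' with h | h
    exacts [.inr (Subtype.ext h), .inl (Subtype.ext h)]

namespace Coh

/-- Morphisms from a line bundle into a line bundle are multiples of monomials. -/
lemma exists_app_one_eq {p q : Fin 3 → ℤ}
    (f : lineBundle k threePoints p ⟶ lineBundle k threePoints q) :
    ∃ c : k, ∀ σ, toLaurent (app f σ (one p σ)) = AddMonoidAlgebra.single (q - p) c := by
  -- The coefficient read off on the open orbit serves all charts, since restriction does not change
  -- the Laurent polynomial.
  refine ⟨(toLaurent (app f emptyFace (one p emptyFace))).coeff (q - p), fun σ => ?_⟩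
  have h1 := app_mem f emptyFace (one_mem p emptyFace)
  rw [mem_piece_iff, ← sub_eq_add_neg] at h1
  rw [← eq_single_of_mem_supportedIn h1, ← res_one p (emptyFace_le σ), app_res, toLaurent_res]

/-- The only candidate is the monomial `z^(q-p)`, and it has a pole along `z_i = 0` in the chart
`U_i` if `q i < p i`. -/
lemma hom_eq_zero {p q : Fin 3 → ℤ} (h : ¬ p ≤ q)
    (f : lineBundle k threePoints p ⟶ lineBundle k threePoints q) : f = 0 := by
  obtain ⟨c, hc⟩ := exists_app_one_eq f
  obtain ⟨i, hi⟩ := not_forall.1 h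
  have hc0 : c = 0 := by
    by_contra hne
    have h1 := toLaurent_mem (app f (pointFace i) (one p (pointFace i)))
    rw [hc] at h1
    have := h1 (q - p) (by simpa using hne) i (Finset.mem_singleton_self i)
    exact hi (sub_nonneg.1 this)
  refine hom_ext_of_one fun σ => toLaurent_injective ?_
  rw [hc, hc0, AddMonoidAlgebra.single_zero]
  rfl

lemma exists_smul_mul_eq {p q : Fin 3 → ℤ} (h : p ≤ q)
    (f : lineBundle k threePoints p ⟶ lineBundle k threePoints q) : ∃ c : k, f = c • mul h := by
  obtain ⟨c, hc⟩ := exists_app_one_eq f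
  refine ⟨c, hom_ext_of_one fun σ => toLaurent_injective ?_⟩
  rw [hc, app_smul, toLaurent_smul, toLaurent_mul, toLaurent_one, mul_one,
    polyToLaurent, MvPolynomial.aeval_C, AddMonoidAlgebra.coe_algebraMap, Function.comp_apply,
    AddMonoidAlgebra.single_mul_single]
  simp

lemma end_bijective (p : Fin 3 → ℤ) :
    Function.Bijective (fun c : k => c • 𝟙 (lineBundle k threePoints p)) := by
  constructor
  · intro a b hab
    have h : ∀ c : k, toLaurent (app (c • 𝟙 (lineBundle k threePoints p)) emptyFace
        (one p emptyFace)) = AddMonoidAlgebra.single 0 c := fun c => by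
      rw [app_smul, toLaurent_smul, app_id, toLaurent_one, mul_one, polyToLaurent,
        MvPolynomial.aeval_C, AddMonoidAlgebra.coe_algebraMap, Function.comp_apply]
      simp
    have h2 := congrArg (fun f => toLaurent (app f emptyFace (one p emptyFace))) hab
    dsimp only at h2
    rw [h, h] at h2
    have h3 := congrArg (fun t => t.coeff 0) h2
    simpa using h3
  · intro f
    obtain ⟨c, rfl⟩ := exists_smul_mul_eq le_rfl f
    exact ⟨c, by rw [mul_refl]⟩

/-- The exponent `q - p` involves only coordinates outside `σ`, which are invertible on `U_σ`. -/
lemma mul_surjective {p q : Fin 3 → ℤ} (h : p ≤ q) {σ : Faces threePoints}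
    (hσ : ∀ i ∈ σ.1, q i = p i) :
    Function.Surjective (app (mul h : lineBundle k threePoints p ⟶ _) σ) := fun x =>
  exists_mul_eq h x fun a ha i hi => by
    rw [hσ i hi, sub_self]
    exact toLaurent_mem x a ha i hi

/-- On the union of the charts, `𝒪(a ⊔ b)` is covered by `𝒪(a)` and `𝒪(b)`. -/
lemma eq_zero_of_mul_comp {a b : Fin 3 → ℤ} {F : Coh k threePoints}
    (f : lineBundle k threePoints (a ⊔ b) ⟶ F) (ha : mul le_sup_left ≫ f = 0)
    (hb : mul le_sup_right ≫ f = 0) : f = 0 := by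
  have key : ∀ c (hc : c ≤ a ⊔ b) (σ : Faces threePoints), mul hc ≫ f = 0 →
      (∀ i ∈ σ.1, (a ⊔ b) i = c i) → ∀ x, app f σ x = 0 := fun c hc σ h0 hσ x => by
    obtain ⟨y, rfl⟩ := mul_surjective hc hσ x
    exact congrArg (fun t => app t σ y) h0
  refine hom_ext fun σ x => ?_
  -- At most one coordinate `i` is noninvertible on a chart, and `(a ⊔ b) i` is `a i` or `b i`, so
  -- one of the two multiplications is onto there. This is where the removal of the axes enters.
  rcases face_cases σ with rfl | ⟨i, rfl⟩
  · exact key a _ _ ha (fun i hi => absurd hi (Finset.notMem_empty i)) x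
  · rcases le_total (a i) (b i) with h | h
    · refine key b _ _ hb (fun j hj => ?_) x
      rw [Finset.mem_singleton.1 hj, Pi.sup_apply, sup_eq_right.2 h]
    · refine key a _ _ ha (fun j hj => ?_) x
      rw [Finset.mem_singleton.1 hj, Pi.sup_apply, sup_eq_left.2 h]

lemma mul_square (a b : Fin 3 → ℤ) :
    (mul inf_le_left : lineBundle k threePoints (a ⊓ b) ⟶ lineBundle k threePoints a) ≫
      mul (le_sup_left : a ≤ a ⊔ b) = mul inf_le_right ≫ mul (le_sup_right : b ≤ a ⊔ b) := by
  rw [mul_comp_mul, mul_comp_mul]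

/-- The square of line bundles given by `a`, `b` and their infimum and supremum is cartesian. -/
lemma isPullback_mul (a b : Fin 3 → ℤ) : IsPullback
    (mul inf_le_left : lineBundle k threePoints (a ⊓ b) ⟶ lineBundle k threePoints a)
    (mul inf_le_right) (mul (le_sup_left : a ≤ a ⊔ b)) (mul (le_sup_right : b ≤ a ⊔ b)) := by
  refine ⟨⟨mul_square a b⟩, ⟨(CommSq.isLimitEquivIsLimitKernelFork ⟨mul_square a b⟩).symm ?_⟩⟩
  have e : ∀ σ (z : (lineBundle k threePoints a ⊞ lineBundle k threePoints b : Coh _ _).sec σ),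
      app biprod.inl σ (app biprod.fst σ z) + app biprod.inr σ (app biprod.snd σ z) = z :=
    fun σ z => congrArg (fun t => app t σ z) (biprod.total (X := lineBundle k threePoints a)
      (Y := lineBundle k threePoints b))
  have e' : ∀ {F : Coh k threePoints} (u : lineBundle k threePoints a ⟶ F)
      (v : lineBundle k threePoints b ⟶ F) σ z, app (biprod.desc u v) σ z =
      app u σ (app biprod.fst σ z) + app v σ (app biprod.snd σ z) := fun u v σ z => by
    conv_lhs => rw [← e σ z, map_add, ← app_comp biprod.inl, ← app_comp biprod.inr,
      biprod.inl_desc, biprod.inr_desc]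
  refine isLimitKernelFork _ _ _ (fun σ x y h => ?_) (fun σ z hz => ?_)
  · apply mul_injective (inf_le_left : a ⊓ b ≤ a) σ
    have := congrArg (app biprod.fst σ) h
    rwa [← app_comp, ← app_comp, biprod.lift_fst] at this
  · rw [e'] at hz
    have hz' : app (mul (le_sup_left : a ≤ a ⊔ b)) σ (app biprod.fst σ z) =
        app (mul (le_sup_right : b ≤ a ⊔ b)) σ (app biprod.snd σ z) := by
      rw [← sub_eq_zero, sub_eq_add_neg]
      exact hz
    set x := app biprod.fst σ z with hx
    set y := app biprod.snd σ z with hy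
    have hxy := congrArg toLaurent hz'
    rw [toLaurent_mul, toLaurent_mul] at hxy
    -- From `z^(a ⊔ b - a) x = z^(a ⊔ b - b) y`, an exponent `d` of `x` matches the exponent `d + b
    -- - a` of `y`. Nonnegativity of both at `i ∈ σ` says `d i ≥ a i - min (a i) (b i)`, which is
    -- divisibility of `x` by `z^(a - a ⊓ b)`.
    have hc : ∀ d, (toLaurent x).coeff d ≠ 0 → (toLaurent y).coeff (d + b - a) ≠ 0 := by
      intro d hd
      have := congrArg (fun t => t.coeff (a ⊔ b - a + d)) hxy
      simp only [AddMonoidAlgebra.coeff_single_mul_apply, one_mul, neg_add_cancel_left] at this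
      rw [this] at hd
      convert! hd using 2
      abel
    obtain ⟨w, hw⟩ := exists_mul_eq (inf_le_left : a ⊓ b ≤ a) x (fun d hd i hi => by
      have h1 := toLaurent_mem x d hd i hi
      have h2 := toLaurent_mem y _ (hc d hd) i hi
      rw [Pi.sub_apply, Pi.add_apply] at h2
      rw [Pi.inf_apply]
      rcases min_choice (a i) (b i) with h | h
      · change _ - min (a i) (b i) ≤ _
        omega
      · change _ - min (a i) (b i) ≤ _
        omega)
    have hw' : app (mul (inf_le_right : a ⊓ b ≤ b)) σ w = y := by
      apply mul_injective (le_sup_right : b ≤ a ⊔ b) σ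
      rw [← hz', ← hw, ← app_comp, ← app_comp, mul_square]
    refine ⟨w, ?_⟩
    rw [← e σ z, ← e σ (app (biprod.lift _ _) σ w), ← app_comp _ biprod.fst,
      ← app_comp _ biprod.snd, biprod.lift_fst, biprod.lift_snd, hw, hw']

/-- The Mayer–Vietoris sequence of line bundles. -/
lemma shortExact_mul (a b : Fin 3 → ℤ) :
    (CommSq.shortComplex' (⟨mul_square a b⟩ : CommSq
      (mul inf_le_left : lineBundle k threePoints (a ⊓ b) ⟶ _) _ _ _)).ShortExact where
  exact := (isPullback_mul a b).exact_shortComplex'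
  mono_f := by
    have h : Mono (biprod.lift (mul (inf_le_left : a ⊓ b ≤ a))
        (mul (inf_le_right : a ⊓ b ≤ b)) : lineBundle k threePoints (a ⊓ b) ⟶ _) :=
      mono_of_mono_fac (biprod.lift_fst _ _)
    exact h
  epi_g := by
    have key : ∀ {F : Coh k threePoints} (f : lineBundle k threePoints (a ⊔ b) ⟶ F),
        biprod.desc (mul (le_sup_left : a ≤ a ⊔ b)) (-mul (le_sup_right : b ≤ a ⊔ b)) ≫ f = 0 →
          f = 0 := fun f hf => by
      refine eq_zero_of_mul_comp f ?_ ?_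
      · rw [← biprod.inl_desc_assoc (mul le_sup_left) (-mul le_sup_right) f, hf, comp_zero]
      · rw [← neg_eq_zero, ← Preadditive.neg_comp,
          ← biprod.inr_desc_assoc (mul le_sup_left) (-mul le_sup_right) f, hf, comp_zero]
    exact (Preadditive.epi_iff_cancel_zero _).2 fun F f hf => key f hf

/-- Cokernels of multiplication maps on opposite sides of a Mayer–Vietoris square agree. -/
lemma isIso_cokernel_map_mul (a b : Fin 3 → ℤ) : IsIso (cokernel.map
    (mul inf_le_left : lineBundle k threePoints (a ⊓ b) ⟶ lineBundle k threePoints a)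
    (mul (le_sup_right : b ≤ a ⊔ b)) (mul inf_le_right) (mul le_sup_left)
    (mul_square a b)) := by
  -- Cartesianness gives injectivity; the joint surjectivity in `eq_zero_of_mul_comp` gives that the
  -- map is epi.
  have := Abelian.mono_cokernel_map_of_isPullback (isPullback_mul (k := k) a b)
  have : Epi (cokernel.map
    (mul inf_le_left : lineBundle k threePoints (a ⊓ b) ⟶ lineBundle k threePoints a)
    (mul (le_sup_right : b ≤ a ⊔ b)) (mul inf_le_right) (mul le_sup_left)
    (mul_square a b)) := by
    refine (Preadditive.epi_iff_cancel_zero _).2 fun F f hf => ?_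
    rw [← cancel_epi (cokernel.π _), comp_zero]
    refine eq_zero_of_mul_comp _ ?_ ?_
    · have := congrArg (fun t => cokernel.π _ ≫ t) hf
      simpa using this
    · rw [cokernel.condition_assoc, zero_comp]
  exact isIso_of_mono_of_epi _

end Coh

end ThreePoints

/-! ### Extending sections across the coordinate divisors. -/

section SectionExtension

variable {k : Type u} [Field k]

/-- The only variable inverted on the open orbit but not on `U_i` is `X i`. -/
lemma exists_X_pow_mul {n : ℕ} (i : Fin n) : ∀ s ∈ denoms k (∅ : Finset (Fin n)),
    ∃ c : ℕ, ∃ t ∈ denoms k {i}, s = MvPolynomial.X i ^ c * t := by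
  refine denoms_induction ⟨0, 1, Submonoid.one_mem _, by simp⟩ (fun j _ => ?_) ?_
  · by_cases h : j = i
    · exact ⟨1, 1, Submonoid.one_mem _, by simp [h]⟩
    · exact ⟨0, _, X_mem_denoms (mt Finset.mem_singleton.1 h), by simp⟩
  · rintro _ _ ⟨c, s, hs, rfl⟩ ⟨d, t, ht, rfl⟩
    exact ⟨c + d, s * t, Submonoid.mul_mem _ hs ht, by ring⟩

/-- The product of the `N`-th powers of the variables in a set. -/
abbrev powProd (k : Type u) [Field k] {n : ℕ} (A : Finset (Fin n)) (N : ℕ) : PolyRing k n :=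
  ∏ l ∈ A, MvPolynomial.X l ^ N

lemma powProd_mem_polyDegree {n : ℕ} (A : Finset (Fin n)) (N : ℕ) :
    powProd k A N ∈ polyDegree k n (∑ l ∈ A, N • Pi.single l 1) :=
  MvPolynomial.IsWeightedHomogeneous.prod A _ _ fun l _ => pow_mem_polyDegree (X_mem_polyDegree l) N

lemma powProd_mem_denoms {n : ℕ} {A σ : Finset (Fin n)} (h : Disjoint A σ) (N : ℕ) :
    powProd k A N ∈ denoms k σ :=
  Submonoid.prod_mem _ fun _ hl => Submonoid.pow_mem _ (X_mem_denoms (Finset.disjoint_left.1 h hl)) N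

lemma sum_single_apply {n : ℕ} (A : Finset (Fin n)) (N : ℕ) (j : Fin n) :
    (∑ l ∈ A, N • (Pi.single l 1 : Fin n → ℤ)) j = if j ∈ A then (N : ℤ) else 0 := by
  rw [Finset.sum_apply]
  simp [Pi.single_apply]

namespace Coh

/-- A section over the open orbit extends over a divisor after multiplication by a power of the
equation of the divisor. -/
lemma exists_res_eq_pow_smul (F : Coh k threePoints) {d : Fin 3 → ℤ} {x : F.sec emptyFace}
    (hx : x ∈ (F.sec emptyFace).piece d) (j : Fin 3) :
    ∃ N₀ : ℕ, ∀ N ≥ N₀, ∃ w ∈ (F.sec (pointFace j)).piece (N • Pi.single j 1 + d),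
      F.res (emptyFace_le _) w = (MvPolynomial.X j ^ N : PolyRing k 3) • x := by
  have := F.property.1 emptyFace (pointFace j) (emptyFace_le _)
  obtain ⟨s, hs, y, hy⟩ := loc_surj (S := denoms k emptyFace.1)
    (F.res (emptyFace_le (pointFace j))) x
  obtain ⟨c, t, ht, rfl⟩ := exists_X_pow_mul j s hs
  -- The part `t` of the denominator free of `X j` is already invertible on `U_j`, so it is absorbed
  -- into `y`.
  obtain ⟨y, rfl⟩ := (F.smul_bijective (pointFace j) ht).2 y
  have hy' : F.res (emptyFace_le (pointFace j)) y = (MvPolynomial.X j ^ c : PolyRing k 3) • x := by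
    apply (F.smul_bijective emptyFace (denoms_anti (Finset.empty_subset {j}) ht)).1
    dsimp only at hy ⊢
    rw [← map_smul, ← hy, smul_smul, mul_comm]
  refine ⟨c, fun N hN => ?_⟩
  have hd := pow_mem_polyDegree (k := k) (X_mem_polyDegree j) c
  -- The extension `y` need not be homogeneous; its component in the degree of `X j ^ c • x` has the
  -- same restriction.
  refine ⟨(MvPolynomial.X j ^ (N - c) : PolyRing k 3) •
    ((F.sec (pointFace j)).decomp y (c • Pi.single j 1 + d) : F.sec (pointFace j)), ?_, ?_⟩
  · have := GrMod.smul_mem _ _ _ _ _ (pow_mem_polyDegree (k := k) (X_mem_polyDegree j) (N - c))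
      ((F.sec (pointFace j)).decomp y (c • Pi.single j 1 + d)).2
    rwa [← add_assoc, ← add_smul, Nat.sub_add_cancel hN] at this
  · have h2 := GrMod.decomp_map_apply (F.obj.map (homOfLE (emptyFace_le (pointFace j))).op) y
      (c • Pi.single j 1 + d)
    have h3 : F.res (emptyFace_le (pointFace j)) ((F.sec (pointFace j)).decomp y
        (c • Pi.single j 1 + d)) = (MvPolynomial.X j ^ c : PolyRing k 3) • x := by
      refine h2.symm.trans ?_
      change ((F.sec emptyFace).decomp (F.res (emptyFace_le (pointFace j)) y) _ : F.sec emptyFace) = _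
      rw [hy', GrMod.decomp_of_mem]
      exact GrMod.smul_mem _ _ _ _ _ hd hx
    rw [map_smul, h3, smul_smul, ← pow_add, Nat.sub_add_cancel hN]

/-- A section over a chart extends to a morphism from a line bundle after multiplication by powers
of the other coordinates. -/
lemma exists_hom_app_one (F : Coh k threePoints) {i : Fin 3} {d : Fin 3 → ℤ}
    {x : F.sec (pointFace i)} (hx : x ∈ (F.sec (pointFace i)).piece d) :
    ∃ N₀ : ℕ, ∀ N ≥ N₀,
      ∃ h : lineBundle k threePoints (-(∑ l ∈ Finset.univ.erase i, N • Pi.single l 1 + d)) ⟶ F,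
        app h (pointFace i) (one _ _) = powProd k (Finset.univ.erase i) N • x := by
  choose N₀ hN₀ using F.exists_res_eq_pow_smul (F.res_mem (emptyFace_le _) hx)
  refine ⟨∑ j, N₀ j, fun N hN => ?_⟩
  have hN' : ∀ j, N₀ j ≤ N := fun j =>
    (Finset.single_le_sum (fun _ _ => Nat.zero_le _) (Finset.mem_univ j)).trans hN
  have hm := F.sec (pointFace i) |>.smul_mem _ _ _ _
    (powProd_mem_polyDegree (k := k) (Finset.univ.erase i) N) hx
  -- The section to be glued is `powProd • x`. Over `U_j` with `j ≠ i` the factor `X j ^ N` removes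
  -- the pole of `x`, and the remaining factors are multiplied in afterwards. All these sections
  -- agree on the open orbit.
  have key : ∀ σ, ∃ y ∈ (F.sec σ).piece (∑ l ∈ Finset.univ.erase i, N • Pi.single l 1 + d),
      F.res (emptyFace_le σ) y =
        powProd k (Finset.univ.erase i) N • F.res (emptyFace_le (pointFace i)) x ∧
      ∀ h : σ ≤ pointFace i, F.res h (powProd k (Finset.univ.erase i) N • x) = y := by
    intro σ
    rcases face_cases σ with rfl | ⟨j, rfl⟩
    · exact ⟨_, F.res_mem (emptyFace_le _) hm, by rw [res_refl, map_smul], fun _ => rfl⟩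
    · by_cases hj : j = i
      · subst hj
        exact ⟨_, hm, map_smul _ _ _, fun _ => res_refl _ _ _⟩
      · obtain ⟨w, hw, e⟩ := hN₀ j N (hN' j)
        have hji : j ∈ Finset.univ.erase i := Finset.mem_erase.2 ⟨hj, Finset.mem_univ j⟩
        refine ⟨powProd k ((Finset.univ.erase i).erase j) N • w, ?_, ?_, fun h => ?_⟩
        · have := GrMod.smul_mem _ _ _ _ _
            (powProd_mem_polyDegree (k := k) ((Finset.univ.erase i).erase j) N) hw
          rwa [← add_assoc, Finset.sum_erase_add _ _ hji] at this
        · rw [map_smul, e, smul_smul, Finset.prod_erase_mul _ _ hji]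
        · exact absurd (Finset.mem_singleton.1 (h (Finset.mem_singleton_self j))) hj
  choose y hy hy₁ hy₂ using key
  obtain ⟨h, hh⟩ := exists_hom_of_sections (F := F)
    (p := -(∑ l ∈ Finset.univ.erase i, N • Pi.single l 1 + d)) y
    (fun σ => by rw [neg_neg]; exact hy σ) (fun τ σ h => by
      rcases le_cases h with rfl | rfl
      · exact res_refl _ _ _
      · rw [hy₁, ← hy₁ emptyFace, res_refl])
  exact ⟨h, by rw [hh, ← hy₂ _ le_rfl, res_refl]⟩

end Coh

end SectionExtension

/-! ### Monomials killed by a morphism from a line bundle. -/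

section Presentations

variable {k : Type u} [Field k] {n : ℕ}

lemma polyToLaurent_C_mul_prod (c : k) (e : Fin n → ℕ) :
    polyToLaurent k n (MvPolynomial.C c * ∏ l, MvPolynomial.X l ^ e l) =
      AddMonoidAlgebra.single (fun l => (e l : ℤ)) c := by
  have h : MvPolynomial.C c * ∏ l, MvPolynomial.X l ^ e l =
      MvPolynomial.monomial (Finsupp.equivFunOnFinite.symm e) c := by
    rw [MvPolynomial.monomial_eq, Finsupp.prod_fintype _ _ (by simp)]
    rfl
  rw [h, polyToLaurent_monomial]
  congr 1
  funext i
  rw [weight_single_apply]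
  rfl

lemma prod_pow_mul_prod_pow_compl (σ : Finset (Fin n)) (e : Fin n → ℕ) :
    (∏ l ∈ σ, (MvPolynomial.X l : PolyRing k n) ^ e l) * ∏ l ∈ σᶜ, MvPolynomial.X l ^ e l =
      ∏ l, MvPolynomial.X l ^ e l :=
  Finset.prod_mul_prod_compl σ _

lemma prod_compl_mem_denoms (σ : Finset (Fin n)) (e : Fin n → ℕ) :
    (∏ l ∈ σᶜ, (MvPolynomial.X l : PolyRing k n) ^ e l) ∈ denoms k σ :=
  Submonoid.prod_mem _ fun _ hl => Submonoid.pow_mem _ (X_mem_denoms (Finset.mem_compl.1 hl)) _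

variable {Δ : LowerSet (Finset (Fin n))}

namespace Coh

/-- Serves to isolate one monomial of a section: the exponent `p + q` occurs in degree `q` only. -/
lemma toLaurent_decomp_coeff {p : Fin n → ℤ} {σ : Faces Δ} (x : (lineBundle k Δ p).sec σ)
    (q : Fin n → ℤ) :
    (toLaurent (((lineBundle k Δ p).sec σ).decomp x q : (lineBundle k Δ p).sec σ)).coeff (p + q) =
      (toLaurent x).coeff (p + q) := by
  have key : ∀ d : DirectSum _ (fun q => ((lineBundle k Δ p).sec σ).piece q),
      (toLaurent (((lineBundle k Δ p).sec σ).decomp (DirectSum.coeAddMonoidHom _ d) q :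
        (lineBundle k Δ p).sec σ)).coeff (p + q) =
      (toLaurent (DirectSum.coeAddMonoidHom ((lineBundle k Δ p).sec σ).piece d)).coeff (p + q) := by
    intro d
    induction d using DirectSum.induction_on with
    | zero => simp
    | of q' y =>
      rw [DirectSum.coeAddMonoidHom_of]
      by_cases h : q' = q
      · subst h
        rw [GrMod.decomp_of_mem _ y.2]
      · rw [GrMod.decomp_of_mem_ne _ h y.2]
        by_contra h'
        exact h (add_left_cancel (mem_piece_iff.1 y.2 _ (Ne.symm h'))).symm
    | add d d' h h' =>
      rw [map_add (DirectSum.coeAddMonoidHom _) d d', map_add (GrMod.decomp _),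
        DirectSum.add_apply]
      exact congrArg₂ (· + ·) h h'
  simpa only [GrMod.coe_decomp] using key (((lineBundle k Δ p).sec σ).decomp x)

/-- If a morphism from a line bundle kills a section, then it kills the part over the chart of each
monomial of this section. -/
lemma prod_smul_app_one_eq_zero {p : Fin n → ℤ} {F : Coh k Δ} (f : lineBundle k Δ p ⟶ F)
    {σ : Faces Δ} {y : (lineBundle k Δ p).sec σ} (hy : app f σ y = 0) {a : Fin n → ℤ}
    (ha : (toLaurent y).coeff a ≠ 0) :
    (∏ l ∈ σ.1, (MvPolynomial.X l : PolyRing k n) ^ (a l).toNat) • app f σ (one p σ) = 0 := by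
  -- As `f` preserves degrees it kills each homogeneous component of `y`, in particular the one that
  -- is a multiple of `z^a`.
  set z : (lineBundle k Δ p).sec σ :=
    (((lineBundle k Δ p).sec σ).decomp y (a - p) : (lineBundle k Δ p).sec σ) with hz
  have hfz : app f σ z = 0 := by
    refine (GrMod.decomp_map_apply (f.hom.app (.op σ)) y (a - p)).symm.trans ?_
    change ((F.sec σ).decomp (app f σ y) _ : F.sec σ) = 0
    rw [hy, map_zero]
    rfl
  have hzl : toLaurent z = AddMonoidAlgebra.single a ((toLaurent y).coeff a) := by
    have h1 : toLaurent z ∈ supportedIn {p + (a - p)} :=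
      mem_piece_iff.1 (((lineBundle k Δ p).sec σ).decomp y (a - p)).2
    rw [eq_single_of_mem_supportedIn h1, hz, toLaurent_decomp_coeff, add_sub_cancel]
  set c := (toLaurent y).coeff a
  -- Negative exponents occur only outside `σ`. Clearing them turns the monomial into a polynomial
  -- multiple of the generator.
  have e : (∏ l ∈ σ.1ᶜ, (MvPolynomial.X l : PolyRing k n) ^ (-a l).toNat) • z =
      (MvPolynomial.C c * ∏ l, MvPolynomial.X l ^ (a l).toNat : PolyRing k n) • one p σ := by
    apply toLaurent_injective
    have h1 : (∏ l ∈ σ.1ᶜ, (MvPolynomial.X l : PolyRing k n) ^ (-a l).toNat) =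
        MvPolynomial.C 1 * ∏ l, MvPolynomial.X l ^ (if l ∈ σ.1 then 0 else (-a l).toNat) := by
      rw [map_one, one_mul, ← prod_pow_mul_prod_pow_compl σ.1, Finset.prod_eq_one (s := σ.1),
        one_mul]
      · refine Finset.prod_congr rfl fun l hl => ?_
        rw [if_neg (Finset.mem_compl.1 hl)]
      · intro l hl
        rw [if_pos hl, pow_zero]
    rw [h1, toLaurent_smul, toLaurent_smul_one, polyToLaurent_C_mul_prod, polyToLaurent_C_mul_prod,
      hzl, AddMonoidAlgebra.single_mul_single, one_mul]
    congr 1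
    funext l
    have h0 := toLaurent_mem y a ha l
    change ((if l ∈ σ.1 then 0 else (-a l).toNat : ℕ) : ℤ) + a l = ((a l).toNat : ℤ)
    split_ifs with h
    · have := h0 h
      simp [this]
    · omega
  have e2 := congrArg (app f σ) e
  rw [map_smul, map_smul, hfz, smul_zero, ← prod_pow_mul_prod_pow_compl σ.1,
    mul_comm (Finset.prod _ _),
    mul_smul, mul_smul] at e2
  have e3 := congrArg (fun t => (MvPolynomial.C c⁻¹ : PolyRing k n) • t) e2.symm
  rw [smul_zero, smul_smul, ← map_mul, inv_mul_cancel₀ ha, map_one, one_smul] at e3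
  -- The variables outside `σ` are invertible on `U_σ`, so only the factors over `σ` remain.
  exact (F.smul_bijective σ (prod_compl_mem_denoms σ.1 _)).1 (e3.trans (smul_zero _).symm)

end Coh

end Presentations

/-! ### Kernels of maps from line bundles and finite covers by line bundles. -/

section Presentations

variable {k : Type u} [Field k]

namespace Coh

/-- A morphism from a line bundle is a monomorphism, or its kernel is a line bundle. -/
lemma mono_or_kernel_iso {p : Fin 3 → ℤ} {F : Coh k threePoints}
    (f : lineBundle k threePoints p ⟶ F) :
    Mono f ∨ ∃ q, Nonempty (lineBundle k threePoints q ≅ kernel f) := by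
  -- If the image of the generator survives on the open orbit, `f` is injective. If it dies there,
  -- then on each `U_i` it is killed by a power of `X i`; the least such exponents `c i` define the
  -- kernel `𝒪(p - c)`.
  by_cases h0 : app f emptyFace (one p emptyFace) = 0
  · right
    have hc : ∀ i, ∃ c : ℕ, (MvPolynomial.X i ^ c : PolyRing k 3) •
        app f (pointFace i) (one p (pointFace i)) = 0 := fun i => by
      have := F.property.1 emptyFace (pointFace i) (emptyFace_le _)
      obtain ⟨s, hs, h⟩ := loc_eq_zero (S := denoms k emptyFace.1)
        (F.res (emptyFace_le (pointFace i))) (app f (pointFace i) (one p (pointFace i)))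
        (by rw [← app_res, res_one, h0])
      obtain ⟨c, t, ht, rfl⟩ := exists_X_pow_mul i s hs
      rw [mul_comm, mul_smul] at h
      exact ⟨c, (F.smul_bijective (pointFace i) ht).1 (h.trans (smul_zero _).symm)⟩
    classical
    let c : Fin 3 → ℕ := fun i => Nat.find (hc i)
    have hle : (p - fun i => (c i : ℤ)) ≤ p := sub_le_self _ fun i => by simp
    have h1 : ∀ σ, app (mul (k := k) (Δ := threePoints) hle) σ (one _ σ) =
        (MvPolynomial.C 1 * ∏ l, MvPolynomial.X l ^ c l : PolyRing k 3) • one p σ := fun σ => by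
      apply toLaurent_injective
      rw [toLaurent_mul, toLaurent_one, mul_one, toLaurent_smul_one, polyToLaurent_C_mul_prod,
        sub_sub_cancel]
    have hw : mul hle ≫ f = 0 := hom_ext_of_one fun σ => by
      change app f σ (app (mul hle) σ (one _ σ)) = 0
      rw [h1, map_smul]
      rcases face_cases σ with rfl | ⟨i, rfl⟩
      · rw [h0, smul_zero]
      · rw [← prod_pow_mul_prod_pow_compl {i}, Finset.prod_singleton, map_one, one_mul, mul_comm,
          mul_smul, Nat.find_spec (hc i), smul_zero]
    refine ⟨_, ⟨IsLimit.conePointUniqueUpToIso (isLimitKernelFork (mul hle) f hw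
      (mul_injective hle) fun σ y hy => exists_mul_eq hle y fun a ha i hi => ?_)
      (limit.isLimit _)⟩⟩
    have ha0 := toLaurent_mem y a ha i hi
    -- Each monomial of a killed section yields a power of `X i` that kills the generator;
    -- minimality of `c i` bounds its exponent below.
    have h2 := prod_smul_app_one_eq_zero f hy ha
    obtain rfl : σ = pointFace i := by
      rcases face_cases σ with rfl | ⟨j, rfl⟩
      · exact absurd hi (Finset.notMem_empty i)
      · rw [Finset.mem_singleton.1 hi]
    change (∏ l ∈ {i}, _) • _ = _ at h2
    rw [Finset.prod_singleton] at h2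
    have h3 := Nat.find_min' (hc i) h2
    change p i - (p i - (c i : ℤ)) ≤ a i
    change c i ≤ _ at h3
    omega
  · left
    have hinj : ∀ σ y, app f σ y = 0 → y = 0 := fun σ y hy => by
      apply toLaurent_injective
      refine AddMonoidAlgebra.ext (Finsupp.ext fun a => ?_)
      by_contra ha
      apply h0
      -- On the open orbit the product over the face is empty, so one monomial of a killed section
      -- already forces the generator to die, against `h0`.
      have := prod_smul_app_one_eq_zero f (σ := emptyFace)
        (y := (lineBundle k threePoints p).res (emptyFace_le σ) y)
        (by rw [app_res, hy, map_zero]) ha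
      rwa [show emptyFace.1 = (∅ : Finset (Fin 3)) from rfl, Finset.prod_empty, one_smul] at this
    exact mono_of_injective f fun σ => (injective_iff_map_eq_zero _).2 (hinj σ)

/-- Finitely many morphisms from line bundles detect vanishing on a given section. -/
lemma exists_finset_detect (F : Coh k threePoints) {i : Fin 3} (x : F.sec (pointFace i)) :
    ∃ S : Finset (Σ p, lineBundle k threePoints p ⟶ F), ∀ (G : Coh k threePoints) (t : F ⟶ G),
      (∀ e ∈ S, e.2 ≫ t = 0) → app t (pointFace i) x = 0 := by
  classical
  have key : ∀ d : DirectSum _ (fun q => (F.sec (pointFace i)).piece q),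
      ∃ S : Finset (Σ p, lineBundle k threePoints p ⟶ F), ∀ (G : Coh k threePoints) (t : F ⟶ G),
      (∀ e ∈ S, e.2 ≫ t = 0) →
        app t (pointFace i) (DirectSum.coeAddMonoidHom (F.sec (pointFace i)).piece d) = 0 := by
    intro d
    induction d using DirectSum.induction_on with
    | zero => exact ⟨∅, fun G t _ => by rw [map_zero, map_zero]⟩
    | of q y =>
      obtain ⟨N, hN⟩ := F.exists_hom_app_one y.2
      obtain ⟨h, hh⟩ := hN N le_rfl
      refine ⟨{⟨_, h⟩}, fun G t ht => ?_⟩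
      have h0 := congrArg (fun u => app u (pointFace i) (one _ _))
        (ht _ (Finset.mem_singleton_self _))
      dsimp only at h0
      rw [app_comp, hh, map_smul] at h0
      rw [DirectSum.coeAddMonoidHom_of]
      -- The morphism from the line bundle hits a multiple of `y` by powers of the coordinates other
      -- than `z_i`, which are invertible on `U_i`.
      exact (G.smul_bijective (pointFace i) (powProd_mem_denoms
        (Finset.disjoint_left.2 fun l hl hl' => (Finset.mem_erase.1 hl).1
          (Finset.mem_singleton.1 hl')) N)).1 (h0.trans (smul_zero _).symm)
    | add d d' h h' =>
      obtain ⟨S, hS⟩ := h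
      obtain ⟨S', hS'⟩ := h'
      refine ⟨S ∪ S', fun G t ht => ?_⟩
      rw [map_add, map_add, hS G t fun e he => ht e (Finset.mem_union_left _ he),
        hS' G t fun e he => ht e (Finset.mem_union_right _ he), add_zero]
  obtain ⟨S, hS⟩ := key ((F.sec (pointFace i)).decomp x)
  exact ⟨S, fun G t ht => by simpa only [GrMod.coe_decomp] using hS G t ht⟩

/-- Every coherent sheaf is covered by finitely many line bundles. -/
lemma exists_finset_jointly_epi (F : Coh k threePoints) :
    ∃ S : Finset (Σ p, lineBundle k threePoints p ⟶ F), ∀ (G : Coh k threePoints) (t : F ⟶ G),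
      (∀ e ∈ S, e.2 ≫ t = 0) → t = 0 := by
  classical
  have h1 : ∀ i, ∃ S : Finset (Σ p, lineBundle k threePoints p ⟶ F),
      ∀ (G : Coh k threePoints) (t : F ⟶ G), (∀ e ∈ S, e.2 ≫ t = 0) →
        ∀ x, app t (pointFace i) x = 0 := fun i => by
    have hfin := F.property.2 (pointFace i)
    obtain ⟨T, hT⟩ := hfin.fg_top
    choose S hS using fun x : F.sec (pointFace i) => F.exists_finset_detect x
    choose m s hms using fun z : LocalizedModule (denoms k (pointFace i).1) (F.sec (pointFace i)) =>
      LocalizedModule.induction_on (β := fun z => ∃ m s, z = LocalizedModule.mk m s)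
        (fun m s => ⟨m, s, rfl⟩) z
    -- Local finiteness gives finitely many generating fractions; it is enough to detect vanishing
    -- on their numerators.
    refine ⟨T.biUnion fun z => S (m z), fun G t ht x => ?_⟩
    have h2 : LocalizedModule.map (denoms k (pointFace i).1) (app t (pointFace i)) = 0 := by
      refine LinearMap.ext_on hT fun z hz => ?_
      rw [hms z]
      simp only [LocalizedModule.map_mk, LinearMap.zero_apply]
      rw [hS (m z) G t fun e he => ht e (Finset.mem_biUnion.2 ⟨z, hz, he⟩), LocalizedModule.zero_mk]
    have h3 := LinearMap.congr_fun h2 (LocalizedModule.mk x 1)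
    rw [LocalizedModule.map_mk, LinearMap.zero_apply] at h3
    obtain ⟨s, hs, h4⟩ := loc_eq_zero (S := denoms k (pointFace i).1)
      (LocalizedModule.mkLinearMap _ _) (app t (pointFace i) x) h3
    exact (G.smul_bijective (pointFace i) hs).1 (h4.trans (smul_zero _).symm)
  choose S hS using h1
  refine ⟨Finset.univ.biUnion S, fun G t ht => ?_⟩
  have h2 : ∀ i x, app t (pointFace i) x = 0 := fun i =>
    hS i G t fun e he => ht e (Finset.mem_biUnion.2 ⟨i, Finset.mem_univ i, he⟩)
  refine hom_ext fun σ x => ?_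
  rcases face_cases σ with rfl | ⟨i, rfl⟩
  -- Any chart would do: sections on the open orbit are fractions of sections on it.
  · have := F.property.1 emptyFace (pointFace 0) (emptyFace_le _)
    obtain ⟨s, hs, y, hy⟩ := loc_surj (S := denoms k emptyFace.1)
      (F.res (emptyFace_le (pointFace 0))) x
    apply (G.smul_bijective emptyFace hs).1
    change s • app t emptyFace x = s • 0
    rw [← map_smul, hy, app_res, h2, map_zero, smul_zero]
  · exact h2 i x

end Coh

end Presentations

/-! ### Vanishing of extensions between line bundles. -/

section ExtVanishing

open Abelian

variable {k : Type u} [Field k] [HasExt.{w} (Coh k threePoints)]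

namespace Coh

/-- The connecting class of the Mayer–Vietoris sequence of line bundles. -/
def mvClass (a b : Fin 3 → ℤ) : Ext.{w} (lineBundle k threePoints (a ⊔ b))
    (lineBundle k threePoints (a ⊓ b)) 1 :=
  (shortExact_mul a b).extClass

/-- Exactness of the contravariant long `Ext` sequence of the Mayer–Vietoris sequence, read at `𝒪(a
⊔ b)`. -/
lemma exists_mvClass_comp {a b : Fin 3 → ℤ} {Y : Coh k threePoints} {m : ℕ}
    (α : Ext.{w} (lineBundle k threePoints (a ⊔ b)) Y (m + 1))
    (ha : (Ext.mk₀ (mul (le_sup_left : a ≤ a ⊔ b))).comp α (zero_add _) = 0)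
    (hb : (Ext.mk₀ (mul (le_sup_right : b ≤ a ⊔ b))).comp α (zero_add _) = 0) :
    ∃ β : Ext.{w} (lineBundle k threePoints (a ⊓ b)) Y m,
      (mvClass a b).comp β (add_comm 1 m) = α := by
  have h : (Ext.mk₀ (biprod.desc (mul (le_sup_left : a ≤ a ⊔ b))
      (-mul (le_sup_right : b ≤ a ⊔ b)))).comp α (zero_add _) = 0 := by
    apply Ext.biprod_ext
    · rw [Ext.mk₀_comp_mk₀_assoc, biprod.inl_desc, ha, Ext.comp_zero]
    · rw [Ext.mk₀_comp_mk₀_assoc, biprod.inr_desc, Ext.mk₀_neg, Ext.neg_comp, hb, neg_zero,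
        Ext.comp_zero]
  exact Ext.contravariant_sequence_exact₃ (shortExact_mul a b) Y α h (add_comm 1 m)

/-- The connecting class composed with the next map of the sequence is zero; project to the first
summand. Hence a morphism that factors through `𝒪(a)` contributes nothing. -/
lemma mvClass_comp_mul_left (a b : Fin 3 → ℤ) : (mvClass a b).comp
    (Ext.mk₀ (mul (inf_le_left : a ⊓ b ≤ a) : lineBundle k threePoints _ ⟶ _)) (add_zero 1) =
      (0 : Ext.{w} _ _ 1) := by
  have h : (mvClass a b).comp (Ext.mk₀ (biprod.lift (mul (inf_le_left : a ⊓ b ≤ a))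
      (mul (inf_le_right : a ⊓ b ≤ b)) : lineBundle k threePoints _ ⟶ _)) (add_zero 1) =
      (0 : Ext.{w} _ _ 1) := (shortExact_mul a b).extClass_comp
  have h' := congrArg (fun t => t.comp (Ext.mk₀ biprod.fst) (add_zero 1)) h
  rwa [Ext.comp_assoc_of_third_deg_zero, Ext.mk₀_comp_mk₀, biprod.lift_fst, Ext.zero_comp] at h'

lemma mvClass_comp_mul_right (a b : Fin 3 → ℤ) : (mvClass a b).comp
    (Ext.mk₀ (mul (inf_le_right : a ⊓ b ≤ b) : lineBundle k threePoints _ ⟶ _)) (add_zero 1) =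
      (0 : Ext.{w} _ _ 1) := by
  have h : (mvClass a b).comp (Ext.mk₀ (biprod.lift (mul (inf_le_left : a ⊓ b ≤ a))
      (mul (inf_le_right : a ⊓ b ≤ b)) : lineBundle k threePoints _ ⟶ _)) (add_zero 1) =
      (0 : Ext.{w} _ _ 1) := (shortExact_mul a b).extClass_comp
  have h' := congrArg (fun t => t.comp (Ext.mk₀ biprod.snd) (add_zero 1)) h
  rwa [Ext.comp_assoc_of_third_deg_zero, Ext.mk₀_comp_mk₀, biprod.lift_snd, Ext.zero_comp] at h'

/-- The monomials form a morphism between the two Mayer–Vietoris sequences. The case of interest is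
`a' ⊔ b' = a ⊔ b`: then the class on the supremum is unchanged while `β` on the infimum is pulled
back to `a' ⊓ b'`. -/
lemma mvClass_naturality {a b a' b' : Fin 3 → ℤ} (ha : a' ≤ a) (hb : b' ≤ b) :
    (mvClass a' b').comp
      (Ext.mk₀ (mul (inf_le_inf ha hb) : lineBundle k threePoints _ ⟶ _)) (add_zero 1) =
    (Ext.mk₀ (mul (sup_le_sup ha hb))).comp (mvClass.{w} a b) (zero_add 1) := by
  have h₁ : mul (inf_le_inf ha hb) ≫ biprod.lift (mul (inf_le_left : a ⊓ b ≤ a))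
      (mul (inf_le_right : a ⊓ b ≤ b)) = biprod.lift (mul (inf_le_left : a' ⊓ b' ≤ a'))
      (mul (inf_le_right : a' ⊓ b' ≤ b') : lineBundle k threePoints _ ⟶ _) ≫
        biprod.map (mul ha) (mul hb) := by
    apply biprod.hom_ext <;> simp [mul_comp_mul]
  have h₂ : biprod.map (mul ha) (mul hb) ≫ biprod.desc (mul (le_sup_left : a ≤ a ⊔ b))
      (-mul (le_sup_right : b ≤ a ⊔ b) : lineBundle k threePoints _ ⟶ _) =
      biprod.desc (mul (le_sup_left : a' ≤ a' ⊔ b')) (-mul (le_sup_right : b' ≤ a' ⊔ b')) ≫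
        mul (sup_le_sup ha hb) := by
    apply biprod.hom_ext' <;> simp [mul_comp_mul]
  let f : (CommSq.shortComplex' (⟨mul_square (k := k) a' b'⟩ : CommSq _ _ _ _)) ⟶
      (CommSq.shortComplex' (⟨mul_square (k := k) a b⟩ : CommSq _ _ _ _)) :=
    { τ₁ := mul (inf_le_inf ha hb)
      τ₂ := biprod.map (mul ha) (mul hb)
      τ₃ := mul (sup_le_sup ha hb)
      comm₁₂ := h₁
      comm₂₃ := h₂ }
  exact ShortComplex.ShortExact.extClass_naturality (shortExact_mul a' b') (shortExact_mul a b) f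

/-- The pull-back of an extension of `𝒪(p)` to `𝒪(q)` vanishes. -/
def KilledBy {p : Fin 3 → ℤ} {Y : Coh k threePoints} {m : ℕ}
    (α : Ext.{w} (lineBundle k threePoints p) Y m) (q : Fin 3 → ℤ) : Prop :=
  ∃ h : q ≤ p, (Ext.mk₀ (mul h)).comp α (zero_add m) = 0

lemma KilledBy.mono {p : Fin 3 → ℤ} {Y : Coh k threePoints} {m : ℕ}
    {α : Ext.{w} (lineBundle k threePoints p) Y m} {q q' : Fin 3 → ℤ} (h : KilledBy α q)
    (hq : q' ≤ q) : KilledBy α q' := by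
  obtain ⟨h, h0⟩ := h
  refine ⟨hq.trans h, ?_⟩
  rw [← mul_comp_mul hq h, ← Ext.mk₀_comp_mk₀_assoc, h0, Ext.comp_zero]

lemma KilledBy.eq_zero {p : Fin 3 → ℤ} {Y : Coh k threePoints} {m : ℕ}
    {α : Ext.{w} (lineBundle k threePoints p) Y m} (h : KilledBy α p) : α = 0 := by
  obtain ⟨h, h0⟩ := h
  rwa [mul_refl, Ext.mk₀_id_comp] at h0

lemma killedBy_mul_comp_iff {p q r : Fin 3 → ℤ} {Y : Coh k threePoints} {m : ℕ}
    (α : Ext.{w} (lineBundle k threePoints p) Y m) (h : q ≤ p) (hr : r ≤ q) :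
    KilledBy ((Ext.mk₀ (mul h)).comp α (zero_add m)) r ↔ KilledBy α r := by
  simp only [KilledBy, hr, hr.trans h, exists_true_left, Ext.mk₀_comp_mk₀_assoc, mul_comp_mul]

/-- An extension class of positive degree is killed by lowering all coordinates but one. -/
lemma exists_forall_killedBy {p : Fin 3 → ℤ} {Y : Coh k threePoints} {m : ℕ}
    (α : Ext.{w} (lineBundle k threePoints p) Y (m + 1)) :
    ∃ N : ℕ, ∀ (i : Fin 3) (q : Fin 3 → ℤ), q ≤ p → (∀ l ≠ i, q l ≤ p l - N) → KilledBy α q := by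
  obtain ⟨Z, g, hg, h0⟩ := Ext.exists_epi_comp_eq_zero α
  -- The epimorphism `g` effaces `α`, and it is surjective on each chart, so the generator of `𝒪(p)`
  -- lifts locally in the same degree.
  have h1 : ∀ i, ∃ x ∈ (Z.sec (pointFace i)).piece (-p), app g (pointFace i) x = one p _ :=
    fun i => GrMod.piece_of_surjective (g.hom.app (.op (pointFace i)))
      (surjective_of_epi g (pointFace i)) _ _ (one_mem p _)
  choose x hx hxg using h1
  choose N hN using fun i => Z.exists_hom_app_one (hx i)
  refine ⟨∑ i, N i, fun i q hq hql => ?_⟩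
  have hM := hN i (∑ i, N i)
    (Finset.single_le_sum (fun _ _ => Nat.zero_le _) (Finset.mem_univ i))
  generalize ∑ i, N i = M at hM hql
  -- So `r` is `p` with every coordinate except the `i`-th lowered by `M`.
  generalize hr : -(∑ l ∈ Finset.univ.erase i, M • (Pi.single l 1 : Fin 3 → ℤ) + -p) = r at hM
  obtain ⟨h, hh⟩ := hM
  have hrl : ∀ l, r l = p l - if l ∈ Finset.univ.erase i then (M : ℤ) else 0 := fun l => by
    rw [← hr, Pi.neg_apply, Pi.add_apply, sum_single_apply, Pi.neg_apply]
    ring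
  have hrp : r ≤ p := fun l => by
    rw [hrl, sub_le_self_iff]
    split_ifs
    exacts [Int.natCast_nonneg M, le_rfl]
  refine KilledBy.mono (q := r) ⟨hrp, ?_⟩ fun l => ?_
  -- The composite `𝒪(r) ⟶ Z ⟶ 𝒪(p)` is a multiple of the monomial; evaluating at the generator over
  -- `U_i` shows that the scalar is `1`.
  · have h2 : mul hrp = h ≫ g := by
      obtain ⟨c, hc⟩ := exists_smul_mul_eq hrp (h ≫ g)
      have h3 := congrArg (fun t => toLaurent (app t (pointFace i) (one r _))) hc
      have h4 : powProd k (Finset.univ.erase i) M =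
          MvPolynomial.C 1 * ∏ l, MvPolynomial.X l ^ (if l ∈ Finset.univ.erase i then M else 0) := by
        rw [map_one, one_mul, ← Finset.prod_erase_mul _ _ (Finset.mem_univ i),
          if_neg (Finset.notMem_erase i _), pow_zero, mul_one]
        exact Finset.prod_congr rfl fun l hl => by rw [if_pos hl]
      rw [app_comp, hh, map_smul, hxg, toLaurent_smul_one, h4, polyToLaurent_C_mul_prod, app_smul,
        toLaurent_smul, toLaurent_mul, toLaurent_one, mul_one, polyToLaurent, MvPolynomial.aeval_C,
        AddMonoidAlgebra.coe_algebraMap, Function.comp_apply, AddMonoidAlgebra.single_mul_single,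
        zero_add, mul_one] at h3
      have h5 := congrArg (fun t => t.coeff (p - r)) h3
      have h6 : (fun l => ((if l ∈ Finset.univ.erase i then M else 0 : ℕ) : ℤ)) = p - r := by
        funext l
        rw [Pi.sub_apply, hrl]
        split_ifs <;> simp
      rw [h6] at h5
      simp only [AddMonoidAlgebra.coeff_single, Finsupp.single_eq_same, Algebra.algebraMap_self,
        RingHom.id_apply] at h5
      rw [hc, ← h5, one_smul]
    rw [h2, ← Ext.mk₀_comp_mk₀_assoc, h0, Ext.comp_zero]
  · rw [hrl]
    split_ifs with hl
    · exact hql l (Finset.mem_erase.1 hl).1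
    · simpa using hq l

/-- Lowering of a coordinate by `N`. -/
abbrev lower (p : Fin 3 → ℤ) (i : Fin 3) (N : ℕ) : Fin 3 → ℤ := p - Pi.single i (N : ℤ)

lemma lower_le (p : Fin 3 → ℤ) (i : Fin 3) (N : ℕ) : lower p i N ≤ p :=
  sub_le_self _ (Pi.single_nonneg.2 (Int.natCast_nonneg N))

lemma exists_third {i j : Fin 3} (h : i ≠ j) :
    ∃ l, l ≠ i ∧ l ≠ j ∧ ∀ m, m ≠ l → m = i ∨ m = j := by
  revert i j
  decide

lemma lower_sup_lower {p : Fin 3 → ℤ} {i j : Fin 3} (h : i ≠ j) (N : ℕ) :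
    lower p i N ⊔ lower p j N = p := by
  funext l
  simp only [Pi.sup_apply, lower, Pi.sub_apply, Pi.single_apply]
  split_ifs with h1 h2
  · exact absurd (h1.symm.trans h2) h
  all_goals simp

lemma lower_inf_lower_apply (p : Fin 3 → ℤ) (i j : Fin 3) (N : ℕ) (l : Fin 3) :
    (lower p i N ⊓ lower p j N) l = if l = i ∨ l = j then p l - N else p l := by
  change min (p l - (Pi.single i (N : ℤ) : Fin 3 → ℤ) l)
    (p l - (Pi.single j (N : ℤ) : Fin 3 → ℤ) l) = _
  rw [Pi.single_apply, Pi.single_apply]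
  by_cases h1 : l = i <;> by_cases h2 : l = j <;> simp only [h1, h2, if_true, if_false,
    or_true, true_or, or_self] <;> omega

/-- A class that is killed on two complementary divisors comes from the intersection. -/
lemma exists_mvClass_comp_of_killedBy {p a b : Fin 3 → ℤ} (hp : a ⊔ b = p) {Y : Coh k threePoints}
    {m : ℕ} {α : Ext.{w} (lineBundle k threePoints p) Y (m + 1)} (ha : KilledBy α a)
    (hb : KilledBy α b) : ∃ β : Ext.{w} (lineBundle k threePoints (a ⊓ b)) Y m,
      ∀ a' b', a' ≤ a → b' ≤ b → a' ⊔ b' = p → KilledBy β (a' ⊓ b') → α = 0 := by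
  subst hp
  obtain ⟨β, rfl⟩ := exists_mvClass_comp α ha.2 hb.2
  refine ⟨β, fun a' b' ha' hb' hp h0 => KilledBy.eq_zero ?_⟩
  -- The class is unchanged by passing to `a' ⊔ b' = p`. By naturality its pull-back is the
  -- connecting class of `a'`, `b'` composed with the pull-back of `β`, which is zero.
  suffices h : KilledBy ((mvClass.{w} a b).comp β (add_comm 1 m)) (a' ⊔ b') by rwa [hp] at h
  refine ⟨sup_le_sup ha' hb', ?_⟩
  rw [← Ext.comp_assoc (a₁₂ := 1) _ _ _ (by omega) (by omega) (by omega),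
    ← mvClass_naturality ha' hb', Ext.comp_assoc (a₂₃ := m) _ _ _ (by omega) (by omega) (by omega),
    h0.2,
    Ext.comp_zero]

/-- Here `β` has positive degree `m + 1`, so it dies once the coordinates `i` and `j` are lowered
further by some `M`. Lowering only coordinate `i` in one corner and only `j` in the other keeps
their supremum equal to `p`. -/
lemma eq_zero_of_killedBy_lower {p : Fin 3 → ℤ} {Y : Coh k threePoints} {m : ℕ}
    {α : Ext.{w} (lineBundle k threePoints p) Y (m + 2)} {i j : Fin 3} (hij : i ≠ j) {N : ℕ}
    (hi : KilledBy α (lower p i N)) (hj : KilledBy α (lower p j N)) : α = 0 := by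
  obtain ⟨β, hβ⟩ := exists_mvClass_comp_of_killedBy (m := m + 1) (lower_sup_lower hij N) hi hj
  obtain ⟨M, hM⟩ := exists_forall_killedBy β
  have hle : ∀ r, lower p r (N + M) ≤ lower p r N := fun r =>
    sub_le_sub_left (Pi.single_le_single.2 (by simp)) p
  refine hβ (lower p i (N + M)) (lower p j (N + M)) (hle i) (hle j) (lower_sup_lower hij _) ?_
  obtain ⟨l, -, -, hl⟩ := exists_third hij
  refine hM l _ (inf_le_inf (hle i) (hle j)) fun r hr => ?_
  rw [lower_inf_lower_apply, lower_inf_lower_apply, if_pos (hl r hr), if_pos (hl r hr)]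
  push_cast
  omega

/-- In degree one `β` is a morphism `𝒪(a ⊓ b) ⟶ 𝒪(q)`: it is zero, or a multiple of a monomial that
factors through `𝒪(a)` or `𝒪(b)`, where the connecting class vanishes. -/
lemma eq_zero_of_killedBy_of_le {a b p q : Fin 3 → ℤ} (hp : a ⊔ b = p)
    {α : Ext.{w} (lineBundle k threePoints p) (lineBundle k threePoints q) 1} (ha : KilledBy α a)
    (hb : KilledBy α b) (h : a ⊓ b ≤ q → a ≤ q ∨ b ≤ q) : α = 0 := by
  subst hp
  obtain ⟨β, rfl⟩ := exists_mvClass_comp (m := 0) α ha.2 hb.2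
  obtain ⟨g, rfl⟩ := (Ext.mk₀_bijective _ _).2 β
  by_cases hle : a ⊓ b ≤ q
  · obtain ⟨c, rfl⟩ := exists_smul_mul_eq hle g
    rcases h hle with h | h
    · rw [← mul_comp_mul inf_le_left h, ← Linear.comp_smul, ← Ext.mk₀_comp_mk₀,
        ← Ext.comp_assoc (a₁₂ := 1) _ _ _ (by omega) (by omega) (by omega), mvClass_comp_mul_left,
        Ext.zero_comp]
    · rw [← mul_comp_mul inf_le_right h, ← Linear.comp_smul, ← Ext.mk₀_comp_mk₀,
        ← Ext.comp_assoc (a₁₂ := 1) _ _ _ (by omega) (by omega) (by omega), mvClass_comp_mul_right,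
        Ext.zero_comp]
  · rw [hom_eq_zero hle g, Ext.mk₀_zero, Ext.comp_zero]

/-- Two of the three coordinates satisfy `p ≤ q`, so `i` or `j` is among them. If `j` is, then
`lower p i N` differs from the infimum of the corners in coordinate `j` only, and there `p j ≤ q j`
suffices. -/
lemma eq_zero_of_killedBy_lower_of_le {p q : Fin 3 → ℤ} {s t : Fin 3} (hst : s ≠ t)
    (hs : p s ≤ q s) (ht : p t ≤ q t)
    {α : Ext.{w} (lineBundle k threePoints p) (lineBundle k threePoints q) 1} {i j : Fin 3}
    (hij : i ≠ j) {N : ℕ} (hi : KilledBy α (lower p i N)) (hj : KilledBy α (lower p j N)) :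
    α = 0 := by
  refine eq_zero_of_killedBy_of_le (lower_sup_lower hij N) hi hj fun h => ?_
  have key : ∀ {i j : Fin 3} (_ : i ≠ j) (_ : lower p i N ⊓ lower p j N ≤ q) (_ : p j ≤ q j),
      lower p i N ≤ q := fun {i j} hij h hj l => by
    have h1 := h l
    rw [lower_inf_lower_apply] at h1
    by_cases hl : l = j
    · subst hl
      exact (lower_le p i N l).trans hj
    · by_cases hl' : l = i
      · subst hl'
        rw [if_pos (.inl rfl)] at h1
        simpa [lower] using h1
      · rw [if_neg (by tauto)] at h1
        exact (lower_le p i N l).trans h1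
  obtain ⟨l, -, -, hl⟩ := exists_third hij
  have hj' : p i ≤ q i ∨ p j ≤ q j := by
    by_cases hsl : s = l
    · rcases hl t fun h => hst (hsl.trans h.symm) with rfl | rfl
      exacts [.inl ht, .inr ht]
    · rcases hl s hsl with rfl | rfl
      exacts [.inl hs, .inr hs]
  rcases hj' with h' | h'
  · rw [inf_comm] at h
    exact .inr (key hij.symm h h')
  · exact .inl (key hij h h')

/-- If the classes killed by lowering two coordinates vanish, then all classes do. -/
lemma ext_eq_zero_of_killedBy_lower {p : Fin 3 → ℤ} {Y : Coh k threePoints} {m : ℕ}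
    (h : ∀ p' (_ : p' ≤ p) (α : Ext.{w} (lineBundle k threePoints p') Y (m + 1)) (N : ℕ)
      (i j : Fin 3),
      i ≠ j → KilledBy α (lower p' i N) → KilledBy α (lower p' j N) → α = 0)
    (α : Ext.{w} (lineBundle k threePoints p) Y (m + 1)) : α = 0 := by
  obtain ⟨N, hN⟩ := exists_forall_killedBy α
  -- Lowering two coordinates leaves only the third untouched, so it kills `α`.
  have hij : ∀ i j, i ≠ j → KilledBy α (lower (lower p i N) j N) := fun i j hij => by
    obtain ⟨l, -, -, hl⟩ := exists_third hij
    refine hN l _ ((lower_le _ _ _).trans (lower_le _ _ _)) fun r hr => ?_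
    rcases hl r hr with rfl | rfl
    · simp [lower, hij]
    · simp [lower, hij]
  -- The restriction of `α` to `lower p i N` is killed by lowering either of the other two
  -- coordinates, so the hypothesis applies to it. This is why the hypothesis ranges over all `p' ≤
  -- p`.
  have hi : ∀ i, KilledBy α (lower p i N) := fun i => by
    obtain ⟨j, hji, l, hli, hjl⟩ : ∃ j, j ≠ i ∧ ∃ l, l ≠ i ∧ j ≠ l := by
      revert i
      decide
    refine ⟨lower_le p i N, h _ (lower_le p i N) _ N j l hjl ?_ ?_⟩
    · exact (killedBy_mul_comp_iff _ _ (lower_le _ _ _)).2 (hij i j hji.symm)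
    · exact (killedBy_mul_comp_iff _ _ (lower_le _ _ _)).2 (hij i l hli.symm)
  exact h p le_rfl α N 0 1 (by decide) (hi 0) (hi 1)

/-- Line bundles have no extensions of degree at least `2`. -/
lemma ext_add_two_eq_zero {p : Fin 3 → ℤ} {Y : Coh k threePoints} {m : ℕ}
    (α : Ext.{w} (lineBundle k threePoints p) Y (m + 2)) : α = 0 :=
  ext_eq_zero_of_killedBy_lower (m := m + 1)
    (fun _ _ _ _ _ _ hij hi hj => eq_zero_of_killedBy_lower hij hi hj) α

/-- Extensions of line bundles vanish if at most one coordinate of the difference is negative. -/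
lemma ext_one_eq_zero {p q : Fin 3 → ℤ} {s t : Fin 3} (hst : s ≠ t) (hs : p s ≤ q s)
    (ht : p t ≤ q t)
    (α : Ext.{w} (lineBundle k threePoints p) (lineBundle k threePoints q) 1) : α = 0 :=
  ext_eq_zero_of_killedBy_lower (m := 0) (fun _ hp' _ _ _ _ hij hi hj =>
    eq_zero_of_killedBy_lower_of_le hst ((hp' s).trans hs) ((hp' t).trans ht) hij hi hj) α

end Coh

end ExtVanishing

/-! ### Two-out-of-three classes in an abelian category. -/

section TwoOutOfThree

universe v' u'

variable {A : Type u'} [Category.{v'} A] [Abelian A]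

namespace IsTwoOutOfThree

variable {R : ObjectProperty A} {X Y : A}

lemma shortExact_of_mono (f : X ⟶ Y) [Mono f] :
    (ShortComplex.mk f (cokernel.π f) (cokernel.condition f)).ShortExact where
  exact := ShortComplex.exact_cokernel f

lemma of_mono_left (hR : IsTwoOutOfThree R) (f : X ⟶ Y) [Mono f] (hY : R Y)
    (hc : R (cokernel f)) : R X :=
  hR.left _ (shortExact_of_mono f) hY hc

lemma of_mono_middle (hR : IsTwoOutOfThree R) (f : X ⟶ Y) [Mono f] (hX : R X)
    (hc : R (cokernel f)) : R Y :=
  hR.middle _ (shortExact_of_mono f) hX hc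

lemma cokernel_of_mono (hR : IsTwoOutOfThree R) (f : X ⟶ Y) [Mono f] (hX : R X)
    (hY : R Y) : R (cokernel f) :=
  hR.right _ (shortExact_of_mono f) hX hY

/-- The exact sequence from kernel to cokernel is cut at the coimage into two short exact sequences.
-/
lemma of_kernel_of_cokernel (hR : IsTwoOutOfThree R) (f : X ⟶ Y)
    (hk : R (kernel f)) (hX : R X) (hc : R (cokernel f)) : R Y := by
  have h1 : R (Abelian.coimage f) := hR.cokernel_of_mono (kernel.ι f) hk hX
  refine hR.of_mono_middle (Abelian.factorThruCoimage f) h1 (hR.iso _ _ ?_ hc)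
  exact cokernelIsoOfEq (Abelian.coimage.fac f).symm ≪≫ cokernelEpiComp _ _

end IsTwoOutOfThree

end TwoOutOfThree

/-! ### Generation of all coherent sheaves by the collection. -/

section Generation

variable {k : Type u} [Field k] {R : ObjectProperty (Coh k threePoints)}

namespace Coh

/-- The cokernel of multiplication by a monomial has the property `R`. -/
def CokernelProp (R : ObjectProperty (Coh k threePoints)) (p q : Fin 3 → ℤ) : Prop :=
  ∀ h : p ≤ q, R (cokernel (mul h : lineBundle k threePoints p ⟶ lineBundle k threePoints q))

lemma cokernelProp_inf_iff (hR : IsTwoOutOfThree R) (a b : Fin 3 → ℤ) :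
    CokernelProp R (a ⊓ b) a ↔ CokernelProp R b (a ⊔ b) := by
  have := isIso_cokernel_map_mul (k := k) a b
  let e := asIso (cokernel.map
    (mul inf_le_left : lineBundle k threePoints (a ⊓ b) ⟶ lineBundle k threePoints a)
    (mul (le_sup_right : b ≤ a ⊔ b)) (mul inf_le_right) (mul le_sup_left)
    (mul_square a b))
  exact ⟨fun h _ => hR.iso _ _ e (h inf_le_left), fun h _ => hR.iso _ _ e.symm (h le_sup_right)⟩

/-- The four twists are the corners of one Mayer–Vietoris square, with `a = update r i y` and `b =
update p i x`, so the parallel cokernels are isomorphic. -/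
lemma cokernelProp_update_iff_of_le (hR : IsTwoOutOfThree R) {r p : Fin 3 → ℤ} (hr : r ≤ p)
    (i : Fin 3) {x y : ℤ} (hxy : x ≤ y) :
    CokernelProp R (Function.update r i x) (Function.update r i y) ↔
      CokernelProp R (Function.update p i x) (Function.update p i y) := by
  have h := cokernelProp_inf_iff hR (Function.update r i y) (Function.update p i x)
  have h1 : Function.update r i y ⊓ Function.update p i x = Function.update r i x := by
    funext l
    rw [Pi.inf_apply]
    by_cases hl : l = i
    · subst hl
      simpa using hxy
    · simpa [hl] using hr l
  have h2 : Function.update r i y ⊔ Function.update p i x = Function.update p i y := by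
    funext l
    rw [Pi.sup_apply]
    by_cases hl : l = i
    · subst hl
      simpa using hxy
    · simpa [hl] using hr l
  rwa [h1, h2] at h

/-- Both sides are compared with `p ⊓ q`. The cokernel thus depends only on the coordinate and its
two values. -/
lemma cokernelProp_update_iff (hR : IsTwoOutOfThree R) (p q : Fin 3 → ℤ) (i : Fin 3) {x y : ℤ}
    (hxy : x ≤ y) : CokernelProp R (Function.update p i x) (Function.update p i y) ↔
      CokernelProp R (Function.update q i x) (Function.update q i y) :=
  (cokernelProp_update_iff_of_le hR inf_le_left i hxy).symm.trans
    (cokernelProp_update_iff_of_le hR (inf_le_right : p ⊓ q ≤ q) i hxy)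

/-- Exchange of one coordinate. -/
lemma lineBundle_update_of_update (hR : IsTwoOutOfThree R) (p q : Fin 3 → ℤ) (i : Fin 3) (x y : ℤ)
    (hpx : R (lineBundle k threePoints (Function.update p i x)))
    (hpy : R (lineBundle k threePoints (Function.update p i y)))
    (hqx : R (lineBundle k threePoints (Function.update q i x))) :
    R (lineBundle k threePoints (Function.update q i y)) := by
  rcases le_total x y with h | h
  · have hc : CokernelProp R (Function.update p i x) (Function.update p i y) := fun h =>
      hR.cokernel_of_mono (mul h) hpx hpy
    have hle : Function.update q i x ≤ Function.update q i y := update_le_update_iff'.2 h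
    exact hR.of_mono_middle (mul hle) hqx ((cokernelProp_update_iff hR p q i h).1 hc hle)
  · have hc : CokernelProp R (Function.update p i y) (Function.update p i x) := fun h =>
      hR.cokernel_of_mono (mul h) hpy hpx
    have hle : Function.update q i y ≤ Function.update q i x := update_le_update_iff'.2 h
    exact hR.of_mono_left (mul hle) hqx ((cokernelProp_update_iff hR p q i h).1 hc hle)

lemma lineBundle_exchange_one (hR : IsTwoOutOfThree R) {a c a' c' x y : ℤ}
    (h1 : R (lineBundle k threePoints ![a, x, c])) (h2 : R (lineBundle k threePoints ![a, y, c]))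
    (h3 : R (lineBundle k threePoints ![a', x, c'])) :
    R (lineBundle k threePoints ![a', y, c']) := by
  have e : ∀ a c z : ℤ, Function.update ![a, 0, c] 1 z = ![a, z, c] := fun a c z => by
    ext i
    fin_cases i <;> rfl
  rw [← e] at h1 h2 h3 ⊢
  exact lineBundle_update_of_update hR _ _ 1 x y h1 h2 h3

lemma lineBundle_exchange_two (hR : IsTwoOutOfThree R) {a b a' b' x y : ℤ}
    (h1 : R (lineBundle k threePoints ![a, b, x])) (h2 : R (lineBundle k threePoints ![a, b, y]))
    (h3 : R (lineBundle k threePoints ![a', b', x])) :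
    R (lineBundle k threePoints ![a', b', y]) := by
  have e : ∀ a b z : ℤ, Function.update ![a, b, 0] 2 z = ![a, b, z] := fun a b z => by
    ext i
    fin_cases i <;> rfl
  rw [← e] at h1 h2 h3 ⊢
  exact lineBundle_update_of_update hR _ _ 2 x y h1 h2 h3

/-- A two-out-of-three class that contains the collection contains all line bundles. -/
lemma lineBundle_of_collection (hR : IsTwoOutOfThree R)
    (h : ∀ p : Twists, R (lineBundle k threePoints p.1)) (p : Fin 3 → ℤ) :
    R (lineBundle k threePoints p) := by
  have h0 : ∀ m : ℤ, 0 ≤ m → R (lineBundle k threePoints ![0, 0, m]) := fun m hm =>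
    h ⟨_, 0, m, hm, rfl⟩
  have h3 : ∀ m : ℤ, 0 ≤ m → R (lineBundle k threePoints ![1, 0, -m]) := fun m hm =>
    h ⟨_, 3, m, hm, rfl⟩
  have h1 : ∀ a : ℤ, R (lineBundle k threePoints ![a, -a, 0]) := fun a => by
    -- The point missing from the second block lies in the first one; likewise `a = 1` below is
    -- found in the last block.
    by_cases ha : a = 0
    · subst ha
      exact h0 0 le_rfl
    · exact h ⟨_, 1, a, ha, rfl⟩
  have h2 : ∀ a : ℤ, R (lineBundle k threePoints ![a, 1 - a, 0]) := fun a => by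
    by_cases ha : a = 1
    · subst ha
      exact h3 0 le_rfl
    · exact h ⟨_, 2, a, ha, rfl⟩
  -- Nonnegative `m` are transported from the ray `(0, 0, m)` by exchanging the third coordinate.
  have h4 : ∀ m : ℤ, R (lineBundle k threePoints ![1, 0, m]) := fun m => by
    rcases le_total 0 m with hm | hm
    · exact lineBundle_exchange_two hR (h0 0 le_rfl) (h0 m hm) (h3 0 le_rfl)
    · simpa using h3 (-m) (neg_nonneg.2 hm)
  -- Start from `(b, -b, 0)`. The step from `y` to `y + 1` is copied from the pair `(-y, y, 0)`,
  -- `(-y, y + 1, 0)` on the two antidiagonals; the step down to `y - 1` uses the pair with first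
  -- coordinate `1 - y`.
  have h5 : ∀ b y : ℤ, R (lineBundle k threePoints ![b, y, 0]) := fun b y => by
    induction y using Int.inductionOn' (b := -b) with
    | zero => exact h1 b
    | succ y _ ih =>
      have h6 := h1 (-y)
      have h7 := h2 (-y)
      rw [neg_neg] at h6
      rw [sub_neg_eq_add, add_comm] at h7
      exact lineBundle_exchange_one hR h6 h7 ih
    | pred y _ ih =>
      have h6 := h2 (1 - y)
      have h7 := h1 (1 - y)
      rw [sub_sub_cancel] at h6
      rw [neg_sub] at h7
      exact lineBundle_exchange_one hR h6 h7 ih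
  have e : p = ![p 0, p 1, p 2] := by
    ext i
    fin_cases i <;> rfl
  rw [e]
  exact lineBundle_exchange_two hR (h4 0) (h4 (p 2)) (h5 _ _)

/-- A two-out-of-three class that contains all line bundles contains all coherent sheaves. -/
lemma of_forall_lineBundle (hR : IsTwoOutOfThree R)
    (h : ∀ p, R (lineBundle k threePoints p)) (F : Coh k threePoints) : R F := by
  have key : ∀ (n : ℕ) (F : Coh k threePoints) (S : List (Σ p, lineBundle k threePoints p ⟶ F)),
      S.length = n → (∀ (G : Coh k threePoints) (t : F ⟶ G), (∀ e ∈ S, e.2 ≫ t = 0) → t = 0) →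
        R F := by
    intro n
    induction n with
    | zero =>
      intro F S hS hF
      obtain rfl := List.length_eq_zero_iff.1 hS
      exact hR.zero _ ((IsZero.iff_id_eq_zero F).2 (hF F (𝟙 F) (by simp)))
    | succ n ih =>
      intro F S hS hF
      obtain ⟨⟨p, f⟩, S, rfl⟩ := List.exists_of_length_succ S hS
      -- The cokernel of the first morphism is covered by the remaining ones, so the induction
      -- hypothesis applies to it.
      have hc : R (cokernel f) := by
        refine ih _ (S.map fun e => ⟨e.1, e.2 ≫ cokernel.π f⟩) (by simpa using hS) fun G t ht => ?_
        rw [← cancel_epi (cokernel.π f), comp_zero]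
        refine hF _ _ fun e he => ?_
        rcases List.mem_cons.1 he with rfl | he
        · rw [cokernel.condition_assoc, zero_comp]
        · rw [← Category.assoc]
          exact ht ⟨e.1, e.2 ≫ cokernel.π f⟩ (List.mem_map.2 ⟨e, he, rfl⟩)
      rcases mono_or_kernel_iso f with hf | ⟨q, ⟨e⟩⟩
      · exact hR.of_mono_middle f (h p) hc
      · exact hR.of_kernel_of_cokernel f (hR.iso _ _ e (h q)) (h p) hc
  obtain ⟨S, hS⟩ := F.exists_finset_jointly_epi
  exact key _ F S.toList rfl fun G t ht => hS G t fun e he => ht e (Finset.mem_toList.2 he)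

end Coh

end Generation

/-! ### The numerical condition on the collection and the conclusion. -/

section Collection

open Abelian

variable {k : Type u} [Field k]

/-- Exactly one coordinate of `q` is smaller than that of `p`. -/
def ExactlyOneLT (q p : Fin 3 → ℤ) : Prop := ∃ r, q r < p r ∧ ∀ s ≠ r, p s ≤ q s

lemma exactlyOneLT_of_or {q p : Fin 3 → ℤ} (h : (q 0 < p 0 ∧ p 1 ≤ q 1 ∧ p 2 ≤ q 2) ∨
    (q 1 < p 1 ∧ p 0 ≤ q 0 ∧ p 2 ≤ q 2) ∨ (q 2 < p 2 ∧ p 0 ≤ q 0 ∧ p 1 ≤ q 1)) :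
    ExactlyOneLT q p := by
  rcases h with ⟨h, h', h''⟩ | ⟨h, h', h''⟩ | ⟨h, h', h''⟩
  · exact ⟨0, h, fun s hs => by fin_cases s <;> simp_all⟩
  · exact ⟨1, h, fun s hs => by fin_cases s <;> simp_all⟩
  · exact ⟨2, h, fun s hs => by fin_cases s <;> simp_all⟩

/-- The first two coordinates of every twist lie on `x + y = 0` (first two blocks) or `x + y = 1`
(last two). Between distinct points of one line they change with opposite signs; from `(a, -a)` to
`(b, 1 - b)` the first grows if `b > a`, the second if `b ≤ a`, never both. The third coordinate
does not grow from block to block, and within the first and the last block it alone grows. -/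
lemma IsAdmissibleOrder.exactlyOneLT {prec : Twists → Twists → Prop} (h : IsAdmissibleOrder prec)
    {q p : Twists} (hqp : prec q p) : ExactlyOneLT q.1 p.1 := by
  have := h.strictTotalOrder
  have hne : q.1 ≠ p.1 := fun e => by
    obtain rfl := Subtype.ext e
    exact irrefl_of prec q hqp
  obtain ⟨b, hb⟩ := q.2
  obtain ⟨c, hc⟩ := p.2
  have hbc : ¬ c < b := fun hlt => asymm_of prec hqp (h.blocks c b hlt p q hc hb)
  have h0 : ∀ l m : ℤ, 0 ≤ m → q.1 = ![0, 0, l] → p.1 = ![0, 0, m] → ¬ m < l :=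
    fun l m hm e e' hlt => asymm_of prec hqp (h.first m l hm hlt p q e' e)
  have h3 : ∀ l m : ℤ, 0 ≤ l → q.1 = ![1, 0, -l] → p.1 = ![1, 0, -m] → ¬ l < m :=
    fun l m hl e e' hlt => asymm_of prec hqp (h.last m l hl hlt p q e' e)
  apply exactlyOneLT_of_or
  fin_cases b <;> fin_cases c <;> try exact absurd (by decide) hbc
  all_goals
    obtain ⟨l, hl, e⟩ := hb
    obtain ⟨m, hm, e'⟩ := hc
    have h0 := h0 l m
    have h3 := h3 l m
    rw [e, e'] at hne h0 h3 ⊢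
    simp at hne h0 h3 ⊢
    omega

namespace Coh

/-- The one smaller coordinate rules out morphisms, the other two rule out `Ext¹`, and higher
extensions vanish for all line bundles. -/
lemma ext_eq_zero_of_exactlyOneLT [HasExt.{w} (Coh k threePoints)] {q p : Fin 3 → ℤ}
    (h : ExactlyOneLT q p) : ∀ (n : ℕ)
    (α : Ext.{w} (lineBundle k threePoints p) (lineBundle k threePoints q) n), α = 0
  | 0, α => by
    obtain ⟨r, hr, -⟩ := h
    obtain ⟨f, rfl⟩ := (Ext.mk₀_bijective _ _).2 α
    rw [hom_eq_zero (fun hle => (hle r).not_gt hr) f, Ext.mk₀_zero]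
  | 1, α => by
    obtain ⟨r, -, hr⟩ := h
    obtain ⟨s, hs, t, ht, hst⟩ : ∃ s, s ≠ r ∧ ∃ t, t ≠ r ∧ s ≠ t := by
      clear hr
      revert r
      decide
    exact ext_one_eq_zero hst (hr s hs) (hr t ht) α
  | n + 2, α => ext_add_two_eq_zero α

lemma ext_self_eq_zero [HasExt.{w} (Coh k threePoints)] {p : Fin 3 → ℤ} : ∀ (n : ℕ) (_ : n ≠ 0)
    (α : Ext.{w} (lineBundle k threePoints p) (lineBundle k threePoints p) n), α = 0
  | 0, h, _ => absurd rfl h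
  | 1, _, α => ext_one_eq_zero (s := 0) (t := 1) (by decide) le_rfl le_rfl α
  | n + 2, _, α => ext_add_two_eq_zero α

end Coh

end Collection

end

theorem mainTheorem8 (k : Type u) [Field k] [HasDerivedCategory.{w} (Coh k threePoints)]
    (prec : Twists → Twists → Prop) (hprec : IsAdmissibleOrder prec) :
    IsExceptionalCollection k prec
      (fun p : Twists => BoundedDerived.single (lineBundle k threePoints p.1)) ∧
    IsFullCollection
      (fun p : Twists => BoundedDerived.single (lineBundle k threePoints p.1)) := by
  have : HasExt.{w} (Coh k threePoints) := hasExt_of_hasDerivedCategory _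
  refine ⟨⟨hprec.strictTotalOrder, fun p => BoundedDerived.end_bijective (Coh.end_bijective p.1),
    fun p s hs f => ?_, fun q p hqp s f => ?_⟩, ?_⟩
  · exact BoundedDerived.hom_shift_eq_zero_of_ext (fun n hn α =>
      Coh.ext_self_eq_zero n (fun h => hs (by rw [← hn, h]; rfl)) α) f
  · exact BoundedDerived.hom_shift_eq_zero_of_ext (fun n _ α =>
      Coh.ext_eq_zero_of_exactlyOneLT (hprec.exactlyOneLT hqp) n α) f
  · exact isFullCollection_of_isTwoOutOfThree _ fun R hR h F =>
      Coh.of_forall_lineBundle hR (Coh.lineBundle_of_collection hR h) F
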